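/- **Conventions.** Let $k$ be a field of characteristic $2$. A *differential category* is a $k$-linear category whose spaces of morphisms carry $k$-linear square-zero operators $d$ with $d(fg)=d(f)g+f\,d(g)$; a morphism $f$ is *closed* if $d(f)=0$. Differential functors are $k$-linear and commute with $d$; a natural transformation is closed if its components are. A *2-representation* on $\mathcal V$ (an action of $\mathcal U$ on $\mathcal V$) is a pair $(E,\tau)$ of a differential endofunctor $E$ of $\mathcal V$ and $\tau\in\mathrm{End}(E^2)$ with $d(\tau)=1$, $\tau^2=0$ and $E\tau\circ\tau E\circ E\tau=\tau E\circ E\tau\circ\tau E$. A *morphism* $(\mathcal V,E,\tau)\to(\mathcal V',E',\tau')$ is a differential functor $\Phi$ with a closed isomorphism $\varphi:\Phi E\xrightarrow{\sim}E'\Phi$ such that $\tau'\Phi\circ E'\varphi\circ\varphi E=E'\varphi\circ\varphi E\circ\Phi\tau$. On $E^n$ put $T_r=E^{r-1}\tau E^{n-r-1}$ ($1\le r<n$). A differential category is *idempotent-complete* if its closed idempotents split by closed morphisms, and *strongly pretriangulated* if every closed $f:a\to b$ has a cone, that is, an object representing $x\mapsto \mathrm{Hom}(x,a)\oplus\mathrm{Hom}(x,b)$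 with $d(u,v)=(du,\,fu+dv)$. The cone is written $a\oplus b$, with differential twisted by $f$. $\overline{\mathcal W}^i$ denotes the idempotent completion of the category of twisted objects of $\mathcal W$ (finite families $\bigoplus x_s$ with a strictly triangular matrix $\delta$ satisfying $d(\delta)=\delta^2$). Differential functors and natural transformations on $\mathcal W$ extend to it. **Setting.** Let $\mathcal W$ be a differential category with 2-representations $(F_1,\tau_1)$ and $(E_2,\tau_2)$ and a closed $\lambda:F_1E_2\to E_2F_1$ such that $$E_2\tau_1\circ\lambda F_1\circ F_1\lambda=\lambda F_1\circ F_1\lambda\circ\tau_1E_2,\qquad \tau_2F_1\circ E_2\lambda\circ\lambda E_2=E_2\lambda\circ\lambda E_2\circ F_1\tau_2 .$$ Suppose $F_1$ has a right adjoint $E_1$ in the differential sense ($E_1$ is differential, the unit $\eta$ and the counit $\varepsilon$ are closed). Let $\tau_1\in\mathrm{End}(E_1^2)$ correspond by adjunction to $\tau_1\in\mathrm{End}(F_1^2)$, and put $$\sigma=E_1E_2\varepsilon\circ E_1\lambda E_1\circ\eta E_2E_1:E_2E_1\to E_1E_2,\qquad \rho=\varepsilon E_1F_1\circ F_1\tau_1F_1\circ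 F_1E_1\eta:F_1E_1\to E_1F_1 .$$ Assume that $\sigma$ is invertible. For a word in $F_1,E_2,E_1$ and a permutation $w$ with reduced expression $s_{i_1}\cdots s_{i_r}$, $\lambda_w$ is the corresponding composition (the rightmost factor applied first), where $s_i$ acts on the $i$-th and $(i+1)$-st letters, counted from the left, by $\tau_1:F_1F_1\to F_1F_1$, $\tau_2:E_2E_2\to E_2E_2$, $\tau_1:E_1E_1\to E_1E_1$, $\lambda:F_1E_2\to E_2F_1$, $\sigma:E_2E_1\to E_1E_2$ or $\rho:F_1E_1\to E_1F_1$. In particular $\mu_{i,j}:E_2^iF_1^iE_2^jF_1^j\to E_2^{i+j}F_1^{i+j}$ is the map that moves $F_1^i$ past $E_2^j$ by means of $\lambda$. *The category $\Delta_\lambda\mathcal W$.* Objects are pairs $(m,(\varsigma_i)_{i\ge1})$ with $m\in\overline{\mathcal W}^i$ and closed $\varsigma_i:E_2^iF_1^i(m)\to m$ such that $\varsigma_i\circ E_2^iF_1^i\varsigma_j=\varsigma_{i+j}\circ\mu_{i,j}$ for $i,j\ge1$ and $\varsigma_i\circ T_rF_1^i=\varsigma_i\circ E_2^iT_r$ for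 $1\le r<i$. Morphisms $(m,\varsigma)\to(m',\varsigma')$ are the $f\in\mathrm{Hom}_{\overline{\mathcal W}^i}(m,m')$ with $f\circ\varsigma_i=\varsigma'_i\circ E_2^iF_1^if$ for all $i\ge1$; the differential is that of $\overline{\mathcal W}^i$. Put $\varsigma_0=\mathrm{id}_m$ and $\pi(\varsigma)=E_1\varsigma_1\circ\sigma F_1\circ E_2\eta:E_2(m)\to E_1(m)$. *The category $\Delta_\sigma\mathcal W$.* Objects are pairs $(m,\pi)$ with $m\in\overline{\mathcal W}^i$ and $\pi:E_2(m)\to E_1(m)$ closed such that $\tau_1\circ E_1\pi\circ\sigma\circ E_2\pi=E_1\pi\circ\sigma\circ E_2\pi\circ\tau_2$. Morphisms $(m,\pi)\to(m',\pi')$ are the $f:m\to m'$ with $E_1f\circ\pi=\pi'\circ E_2f$. **Theorem.** (0) $(E_1,\tau_1)$ is a 2-representation on $\mathcal W$, and $\sigma$ satisfies $E_1\tau_2\circ\sigma E_2\circ E_2\sigma=\sigma E_2\circ E_2\sigma\circ\tau_2E_1$ and $\tau_1E_2\circ E_1\sigma\circ\sigma E_1=E_1\sigma\circ\sigma E_1\circ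 E_2\tau_1$. (1) There is an endofunctor $E$ of $\Delta_\lambda\mathcal W$ with $E(m,\varsigma)=(m',\varsigma')$, where $m'=E_2(m)\oplus E_1(m)$ is the cone of $\pi(\varsigma)$ and, for $i\geq 1$, $$\varsigma'_i=\begin{pmatrix}E_2\varsigma_i\circ\lambda_{(1\cdots 2i+1)}&\sum_{r=1}^iE_2\varsigma_{i-1}\circ E_2^iF_1^{i-1}\varepsilon\circ\lambda_{(1\cdots r)(2i\cdots i+r)}\\0&E_1\varsigma_i\circ\lambda_{(1\cdots2i+1)}\end{pmatrix},$$ and $E(f)=\begin{pmatrix}E_2f&0\\0&E_1f\end{pmatrix}$. The matrix $$\tau=\begin{pmatrix}\tau_2&0&0&0\\0&0&\sigma^{-1}&0\\0&0&0&0\\0&0&0&\tau_1\end{pmatrix}\quad\text{on}\quad E_2^2(m)\oplus E_2E_1(m)\oplus E_1E_2(m)\oplus E_1^2(m)$$ defines an endomorphism $\tau$ of $E^2$, and $(E,\tau)$ is a 2-representation on $\Delta_\lambda\mathcal W$. The differential category $\Delta_\lambda\mathcal W$ is idempotent-complete and strongly pretriangulated. (2) There is an endofunctor $E$ of $\Delta_\sigma\mathcal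 W$ with $E(m,\pi)=(m',\pi')$, where $m'=E_2(m)\oplus E_1(m)$ is the cone of $\pi$, $\pi'=\begin{pmatrix}\sigma\circ E_2\pi\circ\tau_2&\sigma\\0&\tau_1\circ E_1\pi\circ\sigma\end{pmatrix}$ and $E(f)=\begin{pmatrix}E_2f&0\\0&E_1f\end{pmatrix}$. The same matrix $\tau$ defines an endomorphism of $E^2$, and $(E,\tau)$ is a 2-representation on $\Delta_\sigma\mathcal W$. There is a functor $\Gamma:\Delta_\lambda\mathcal W\to\Delta_\sigma\mathcal W$, $(m,\varsigma)\mapsto(m,\pi(\varsigma))$, $f\mapsto f$, and $\Gamma$, with the isomorphism $\Gamma E\simeq E\Gamma$ given by the identity maps of the cones, is a morphism of 2-representations. -/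

import Mathlib

open CategoryTheory

namespace DiffRep

noncomputable section

universe w v u v' u'

/-! ### Differential categories -/

/-- A differential category over `k` (`k` will be a field of characteristic `2`): a `k`-linear
category with a `k`-linear square-zero operator `d` on its spaces of morphisms such that
`d (f ≫ g) = d f ≫ g + f ≫ d g`. -/
class DiffCategory (k : Type w) [Field k] (V : Type u) [Category.{v} V] [Preadditive V]
    [Linear k V] where
  d : ∀ {X Y : V}, (X ⟶ Y) →ₗ[k] (X ⟶ Y)
  d_d : ∀ {X Y : V} (f : X ⟶ Y), d (d f) = 0
  d_comp : ∀ {X Y Z : V} (f : X ⟶ Y) (g : Y ⟶ Z), d (f ≫ g) = d f ≫ g + f ≫ d g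

section Basic

variable (k : Type w) [Field k] {V : Type u} [Category.{v} V] [Preadditive V] [Linear k V]

/-- The differential on morphisms. A morphism `f` is closed when `d k f = 0`. -/
def d [DiffCategory k V] {X Y : V} : (X ⟶ Y) →ₗ[k] (X ⟶ Y) := DiffCategory.d

theorem add_self [CharP k 2] {X Y : V} (f : X ⟶ Y) : f + f = 0 := by
  rw [← two_smul k f, CharTwo.two_eq_zero, zero_smul]

theorem two_zsmul_zero [CharP k 2] {X Y : V} (f : X ⟶ Y) : (2 : ℤ) • f = 0 := by
  rw [two_zsmul, add_self k]

theorem eq_of_add [CharP k 2] {X Y : V} {f g : X ⟶ Y} (h : f + g = 0) : f = g := by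
  rw [← add_zero f, ← add_self k g, ← add_assoc, h, zero_add]

variable [DiffCategory k V]

theorem d_d {X Y : V} (f : X ⟶ Y) : d k (d k f) = 0 := DiffCategory.d_d f

theorem d_comp {X Y Z : V} (f : X ⟶ Y) (g : Y ⟶ Z) :
    d k (f ≫ g) = d k f ≫ g + f ≫ d k g := DiffCategory.d_comp f g

theorem d_id (X : V) : d k (𝟙 X) = 0 := by
  have h := d_comp k (𝟙 X) (𝟙 X)
  simp only [Category.comp_id, Category.id_comp] at h
  simpa using h

theorem d_comp_closed {X Y Z : V} {f : X ⟶ Y} {g : Y ⟶ Z} (hf : d k f = 0) (hg : d k g = 0) :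
    d k (f ≫ g) = 0 := by
  rw [d_comp, hf, hg]; simp

end Basic

/-- A differential functor: `k`-linear on morphisms and compatible with the differentials. -/
class IsDiff (k : Type w) [Field k] {V : Type u} [Category.{v} V] [Preadditive V] [Linear k V]
    [DiffCategory k V] {V' : Type u'} [Category.{v'} V'] [Preadditive V'] [Linear k V']
    [DiffCategory k V'] (F : V ⥤ V') : Prop where
  map_add : ∀ {X Y : V} (f g : X ⟶ Y), F.map (f + g) = F.map f + F.map g
  map_smul : ∀ {X Y : V} (a : k) (f : X ⟶ Y), F.map (a • f) = a • F.map f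
  map_d : ∀ {X Y : V} (f : X ⟶ Y), F.map (d k f) = d k (F.map f)

section Functors

variable (k : Type w) [Field k] {V : Type u} [Category.{v} V] [Preadditive V] [Linear k V]
  [DiffCategory k V] {V' : Type u'} [Category.{v'} V'] [Preadditive V'] [Linear k V']
  [DiffCategory k V']

theorem map_zero' (F : V ⥤ V') [IsDiff k F] (X Y : V) : F.map (0 : X ⟶ Y) = 0 := by
  have h := IsDiff.map_smul (k := k) (F := F) 0 (0 : X ⟶ Y)
  simpa using h

theorem map_sum' (F : V ⥤ V') [IsDiff k F] {X Y : V} {ι : Type} (s : Finset ι) (f : ι → (X ⟶ Y)) :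
    F.map (∑ i ∈ s, f i) = ∑ i ∈ s, F.map (f i) :=
  map_sum (AddMonoidHom.mk' (fun g : X ⟶ Y => F.map g) (IsDiff.map_add (k := k))) f s

instance isDiff_id : IsDiff k (𝟭 V) := ⟨fun _ _ => rfl, fun _ _ => rfl, fun _ => rfl⟩

instance isDiff_comp (F G : V ⥤ V) [IsDiff k F] [IsDiff k G] : IsDiff k (F ⋙ G) :=
  ⟨fun f g => by simp [IsDiff.map_add (k := k)],
   fun a f => by simp [IsDiff.map_smul],
   fun f => by simp [IsDiff.map_d]⟩

theorem d_map_closed (F : V ⥤ V') [IsDiff k F] {X Y : V} {f : X ⟶ Y} (hf : d k f = 0) :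
    d k (F.map f) = 0 := by
  rw [← IsDiff.map_d, hf, map_zero' k]

/-- A natural transformation is closed when all its components are. -/
def NatClosed {F G : V ⥤ V'} (α : F ⟶ G) : Prop := ∀ X, d k (α.app X) = 0

end Functors

/-! ### `2`-representations -/

section TwoRep

variable (k : Type w) [Field k] {V : Type u} [Category.{v} V] [Preadditive V] [Linear k V]
  [DiffCategory k V] {V' : Type u'} [Category.{v'} V'] [Preadditive V'] [Linear k V']
  [DiffCategory k V']

/-- `(E, τ)` is a `2`-representation on `V` (an action of `𝒰` on `V`): `E` is a differential
endofunctor and `τ` an endomorphism of `E²` with `d(τ) = 1`, `τ² = 0` and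
`Eτ ∘ τE ∘ Eτ = τE ∘ Eτ ∘ τE`. Note that `(Eτ)(x) = E(τ(x))` and `(τE)(x) = τ(E(x))`. -/
structure IsTwoRep (E : V ⥤ V) (τ : E ⋙ E ⟶ E ⋙ E) : Prop where
  isDiff : IsDiff k E
  d_tau : ∀ x, d k (τ.app x) = 𝟙 _
  sq : ∀ x, τ.app x ≫ τ.app x = 0
  braid : ∀ x, E.map (τ.app x) ≫ τ.app (E.obj x) ≫ E.map (τ.app x) =
    τ.app (E.obj x) ≫ E.map (τ.app x) ≫ τ.app (E.obj x)

/-- `(Φ, φ)` is a morphism of `2`-representations `(V, E, τ) → (V', E', τ')`: `Φ` is a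
differential functor, `φ : ΦE ≅ E'Φ` is closed and
`τ'Φ ∘ E'φ ∘ φE = E'φ ∘ φE ∘ Φτ`. -/
structure IsTwoRepMorphism {E : V ⥤ V} (τ : E ⋙ E ⟶ E ⋙ E) {E' : V' ⥤ V'}
    (τ' : E' ⋙ E' ⟶ E' ⋙ E') (Φ : V ⥤ V') (φ : E ⋙ Φ ≅ Φ ⋙ E') : Prop where
  isDiff : IsDiff k Φ
  closed : NatClosed k φ.hom
  comm : ∀ x, φ.hom.app (E.obj x) ≫ E'.map (φ.hom.app x) ≫ τ'.app (Φ.obj x) =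
    Φ.map (τ.app x) ≫ φ.hom.app (E.obj x) ≫ E'.map (φ.hom.app x)

variable (V) in
/-- Every closed idempotent has an image. -/
def IdempotentComplete : Prop :=
  ∀ (X : V) (e : X ⟶ X), d k e = 0 → e ≫ e = e →
    ∃ (Y : V) (i : Y ⟶ X) (p : X ⟶ Y), d k i = 0 ∧ d k p = 0 ∧ i ≫ p = 𝟙 Y ∧ p ≫ i = e

variable (V) in
/-- For every closed `f : A ⟶ B` the cone of `Hom(-, f)`, that is the differential module
`X ↦ Hom(X, A) ⊕ Hom(X, B)` with `d(a, b) = (d a, f ∘ a + d b)`, is representable. -/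
def StronglyPretriangulated : Prop :=
  ∀ (A B : V) (f : A ⟶ B), d k f = 0 →
    ∃ (C : V) (e : ∀ X : V, (X ⟶ C) ≃ₗ[k] (X ⟶ A) × (X ⟶ B)),
      (∀ (X Y : V) (h : X ⟶ Y) (g : Y ⟶ C),
        e X (h ≫ g) = (h ≫ (e Y g).1, h ≫ (e Y g).2)) ∧
      ∀ (X : V) (g : X ⟶ C),
        e X (d k g) = (d k (e X g).1, (e X g).1 ≫ f + d k (e X g).2)

/-- The cone of `f : A ⟶ B`: an object `C` which is `A ⊕ B` by means of (non-closed) morphisms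
`inl`, `inr`, `fst`, `snd`, its differential being that of `A ⊕ B` twisted by `f`. -/
structure ConeData {A B : V} (f : A ⟶ B) where
  obj : V
  inl : A ⟶ obj
  inr : B ⟶ obj
  fst : obj ⟶ A
  snd : obj ⟶ B
  inl_fst : inl ≫ fst = 𝟙 A
  inr_snd : inr ≫ snd = 𝟙 B
  inl_snd : inl ≫ snd = 0
  inr_fst : inr ≫ fst = 0
  total : fst ≫ inl + snd ≫ inr = 𝟙 obj
  d_inl : d k inl = f ≫ inr
  d_inr : d k inr = 0
  d_fst : d k fst = 0
  d_snd : d k snd = fst ≫ f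

variable (V) in
/-- A choice of a cone for every closed morphism. -/
class HasCones where
  cone : ∀ {A B : V} (f : A ⟶ B), d k f = 0 → ConeData k f

/-- A differential category with cones is strongly pretriangulated. -/
theorem stronglyPretriangulated_of_hasCones [CharP k 2] [HasCones k V] : StronglyPretriangulated k V := by
  intro A B f hf
  let c : ConeData k f := HasCones.cone f hf
  refine ⟨c.obj, fun X =>
    { toFun := fun g => (g ≫ c.fst, g ≫ c.snd)
      invFun := fun q => q.1 ≫ c.inl + q.2 ≫ c.inr
      map_add' := fun g h => by simp
      map_smul' := fun a g => by simp
      left_inv := fun g => by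
        simp only [Category.assoc, ← Preadditive.comp_add, c.total, Category.comp_id]
      right_inv := fun q => by
        simp [c.inl_fst, c.inr_snd, c.inl_snd, c.inr_fst] }, ?_, ?_⟩
  · intro X Y h g
    simp
  · intro X g
    ext
    · simp [d_comp, c.d_fst]
    · simp only [LinearEquiv.coe_mk, LinearMap.coe_mk, AddHom.coe_mk, d_comp, c.d_snd]
      rw [Category.assoc, ← add_assoc, add_right_comm, add_self k, zero_add]

end TwoRep

/-! ### Twisted objects and idempotent completion -/

section Mat

variable (k : Type w) [Field k] {V : Type u} [Category.{v} V] [Preadditive V] [Linear k V]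

instance matModule (M N : Mat_ V) : Module k (M ⟶ N) :=
  inferInstanceAs (Module k (∀ i j, M.X i ⟶ N.X j))

theorem mat_smul_apply {M N : Mat_ V} (a : k) (f : M ⟶ N) (i j) : (a • f) i j = a • f i j := rfl

instance matLinear : Linear k (Mat_ V) where
  homModule M N := matModule k M N
  smul_comp M N K r f g := by
    ext i j
    simp [mat_smul_apply, Finset.smul_sum]
  comp_smul M N K f r g := by
    ext i j
    simp [mat_smul_apply, Finset.smul_sum]

variable [DiffCategory k V]

theorem mat_d_id (M : Mat_ V) (i j : M.ι) : d k ((𝟙 M : M ⟶ M) i j) = 0 := by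
  classical
  by_cases h : i = j
  · subst h
    rw [Mat_.id_apply_self, d_id]
  · rw [Mat_.id_apply_of_ne _ _ _ h, map_zero]

/-- The entrywise differential of a matrix of morphisms. -/
def matD {M N : Mat_ V} (f : M ⟶ N) : M ⟶ N := fun i j => d k (f i j)

theorem matD_apply {M N : Mat_ V} (f : M ⟶ N) (i j) : matD k f i j = d k (f i j) := rfl

/-- Matrices of morphisms, with the entrywise differential. -/
instance matDiff : DiffCategory k (Mat_ V) where
  d {M N} :=
    { toFun := fun f => matD k f
      map_add' := fun f g => by ext i j; simp [matD_apply]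
      map_smul' := fun a f => by ext i j; simp [matD_apply, mat_smul_apply] }
  d_d f := by ext i j; exact d_d k (f i j)
  d_comp f g := by
    ext i j
    show matD k (f ≫ g) i j = (matD k f ≫ g + f ≫ matD k g) i j
    simp [matD_apply, d_comp, Finset.sum_add_distrib]

theorem mat_d_apply {M N : Mat_ V} (f : M ⟶ N) (i j) : d k f i j = d k (f i j) := rfl

end Mat

section Twisted

variable (k : Type w) [Field k] (V : Type u) [Category.{v} V] [Preadditive V] [Linear k V]
  [DiffCategory k V]

/-- A twisted object of `V`: a non-empty finite family of objects of `V`, with a matrix `δ` such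
that `d(δ) = δ ∘ δ` and which is strictly triangular for some ordering of the family. -/
structure TwObj where
  mat : Mat_ V
  nonempty : Nonempty mat.ι
  δ : mat ⟶ mat
  d_δ : d k δ = δ ≫ δ
  triangular : ∃ rank : mat.ι → ℕ, ∀ i j, rank j ≤ rank i → δ i j = 0

/-- An object of the idempotent completion of the category of twisted objects of `V`: a twisted
object with a closed idempotent endomorphism `p`. The morphisms between twisted objects are
all matrices `f`, with the differential `f ↦ d f + f ∘ δ + δ ∘ f`. -/
structure Perf extends TwObj k V where
  p : mat ⟶ mat
  closed : d k p + (δ ≫ p + p ≫ δ) = 0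
  idem : p ≫ p = p

variable {V} {k}

/-- A morphism `(X, p) ⟶ (Y, q)` in the idempotent completion: a matrix `f` with
`f ∘ p = f = q ∘ f`. -/
@[ext]
structure PerfHom (X Y : Perf k V) where
  val : X.mat ⟶ Y.mat
  left : X.p ≫ val = val
  right : val ≫ Y.p = val

namespace PerfHom

theorem val_injective {X Y : Perf k V} : Function.Injective (PerfHom.val (X := X) (Y := Y)) :=
  fun _ _ h => PerfHom.ext h

/-- Morphisms as a linear subspace of the space of matrices. -/
def sub (X Y : Perf k V) : Submodule k (X.mat ⟶ Y.mat) where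
  carrier := {f | X.p ≫ f = f ∧ f ≫ Y.p = f}
  add_mem' := fun {f g} hf hg => ⟨by simp [hf.1, hg.1], by simp [hf.2, hg.2]⟩
  zero_mem' := ⟨by simp, by simp⟩
  smul_mem' := fun a f hf => ⟨by simp [hf.1], by simp [hf.2]⟩

/-- Morphisms as elements of that subspace. -/
def equiv (X Y : Perf k V) : PerfHom X Y ≃ sub X Y where
  toFun f := ⟨f.val, f.left, f.right⟩
  invFun f := ⟨f.1, f.2.1, f.2.2⟩

end PerfHom

instance : Category (Perf k V) where
  Hom X Y := PerfHom X Y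
  id X := ⟨X.p, X.idem, X.idem⟩
  comp f g := ⟨f.val ≫ g.val, by rw [← Category.assoc, f.left], by rw [Category.assoc, g.right]⟩
  id_comp f := PerfHom.ext f.left
  comp_id f := PerfHom.ext f.right
  assoc f g h := PerfHom.ext (Category.assoc _ _ _)

instance (X Y : Perf k V) : AddCommGroup (X ⟶ Y) := (PerfHom.equiv X Y).addCommGroup

namespace Perf

@[ext]
theorem hom_ext {X Y : Perf k V} {f g : X ⟶ Y} (h : f.val = g.val) : f = g := PerfHom.ext h

theorem id_val (X : Perf k V) : PerfHom.val (𝟙 X) = X.p := rfl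

theorem comp_val {X Y Z : Perf k V} (f : X ⟶ Y) (g : Y ⟶ Z) : (f ≫ g).val = f.val ≫ g.val := rfl

theorem add_val {X Y : Perf k V} (f g : X ⟶ Y) : (f + g).val = f.val + g.val := rfl

theorem zero_val {X Y : Perf k V} : (0 : X ⟶ Y).val = 0 := rfl

end Perf

instance : Preadditive (Perf k V) where
  add_comp _ _ _ f f' g := by ext : 1; simp [Perf.comp_val, Perf.add_val]
  comp_add _ _ _ f g g' := by ext : 1; simp [Perf.comp_val, Perf.add_val]

instance (X Y : Perf k V) : Module k (X ⟶ Y) := (PerfHom.equiv X Y).module k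

theorem Perf.smul_val {X Y : Perf k V} (a : k) (f : X ⟶ Y) : (a • f).val = a • f.val := rfl

instance : Linear k (Perf k V) where
  smul_comp _ _ _ r f g := by ext : 1; simp [Perf.comp_val, Perf.smul_val]
  comp_smul _ _ _ f r g := by ext : 1; simp [Perf.comp_val, Perf.smul_val]

variable [CharP k 2]

theorem Perf.d_p (X : Perf k V) : d k X.p = X.δ ≫ X.p + X.p ≫ X.δ := eq_of_add k X.closed

/-- The twisted differential `f ↦ d f + f ∘ δ + δ ∘ f`. -/
def PerfHom.twD {X Y : Perf k V} (f : X ⟶ Y) : X ⟶ Y where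
  val := d k f.val + (X.δ ≫ f.val + f.val ≫ Y.δ)
  left := by
    have h2 : d k f.val = d k X.p ≫ f.val + X.p ≫ d k f.val := by rw [← d_comp, f.left]
    rw [X.d_p] at h2
    simp only [Preadditive.add_comp, Category.assoc, f.left] at h2
    have h4 : X.p ≫ f.val ≫ Y.δ = f.val ≫ Y.δ := by rw [← Category.assoc, f.left]
    conv_rhs => rw [h2]
    rw [Preadditive.comp_add, Preadditive.comp_add, h4, ← sub_eq_zero]
    abel_nf
    simp [two_zsmul_zero k]
  right := by
    have h2 : d k f.val = d k f.val ≫ Y.p + f.val ≫ d k Y.p := by rw [← d_comp, f.right]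
    have h3 : ∀ {Z} (g : Y.mat ⟶ Z), f.val ≫ Y.p ≫ g = f.val ≫ g := fun g => by
      rw [← Category.assoc, f.right]
    rw [Y.d_p] at h2
    simp only [Preadditive.comp_add, h3] at h2
    conv_rhs => rw [h2]
    simp only [Preadditive.add_comp, Category.assoc, f.right]
    rw [← sub_eq_zero]
    abel_nf
    simp [two_zsmul_zero k]

instance : DiffCategory k (Perf k V) where
  d :=
    { toFun := fun f => PerfHom.twD f
      map_add' := fun f g => by
        ext : 1
        simp only [PerfHom.twD, Perf.add_val, map_add, Preadditive.comp_add, Preadditive.add_comp]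
        abel
      map_smul' := fun a f => by
        ext : 1
        simp [PerfHom.twD, Perf.smul_val] }
  d_d {X Y} f := by
    ext : 1
    simp only [LinearMap.coe_mk, AddHom.coe_mk, PerfHom.twD, map_add, d_comp, d_d, X.d_δ, Y.d_δ,
      Preadditive.comp_add, Preadditive.add_comp, Category.assoc, Perf.zero_val]
    abel_nf
    simp [two_zsmul_zero k]
  d_comp {X Y Z} f g := by
    ext : 1
    simp only [LinearMap.coe_mk, AddHom.coe_mk, PerfHom.twD, Perf.add_val, Perf.comp_val, d_comp,
      Preadditive.comp_add, Preadditive.add_comp, Category.assoc]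
    rw [← sub_eq_zero]
    abel_nf
    simp [two_zsmul_zero k]

theorem Perf.d_val {X Y : Perf k V} (f : X ⟶ Y) :
    (d k f).val = d k f.val + (X.δ ≫ f.val + f.val ≫ Y.δ) := rfl

end Twisted

/-! ### Cones of twisted objects -/

section Cones

variable {V : Type u} [Category.{v} V] [Preadditive V]

/-- The concatenation of two finite families of objects. -/
def matSum (M N : Mat_ V) : Mat_ V := ⟨M.ι ⊕ N.ι, Sum.elim M.X N.X⟩

/-- Morphisms out of a concatenation. -/
def matDesc {M N K : Mat_ V} (f : M ⟶ K) (g : N ⟶ K) : matSum M N ⟶ K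
  | Sum.inl i, j => f i j
  | Sum.inr i, j => g i j

/-- Morphisms into a concatenation. -/
def matLift {M N K : Mat_ V} (f : K ⟶ M) (g : K ⟶ N) : K ⟶ matSum M N
  | i, Sum.inl j => f i j
  | i, Sum.inr j => g i j

theorem matLift_comp_matDesc {M N K L : Mat_ V} (f : K ⟶ M) (g : K ⟶ N) (f' : M ⟶ L)
    (g' : N ⟶ L) : matLift f g ≫ matDesc f' g' = f ≫ f' + g ≫ g' := by
  ext i j
  simp only [Mat_.comp_apply, Mat_.add_apply]
  exact Fintype.sum_sum_type _

theorem comp_matLift {M N K L : Mat_ V} (h : L ⟶ K) (f : K ⟶ M) (g : K ⟶ N) :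
    h ≫ matLift f g = matLift (h ≫ f) (h ≫ g) := by
  ext i j
  cases j <;> rfl

theorem matDesc_comp {M N K L : Mat_ V} (f : M ⟶ K) (g : N ⟶ K) (h : K ⟶ L) :
    matDesc f g ≫ h = matDesc (f ≫ h) (g ≫ h) := by
  ext i j
  cases i <;> rfl

theorem matDesc_add {M N K : Mat_ V} (f f' : M ⟶ K) (g g' : N ⟶ K) :
    matDesc f g + matDesc f' g' = matDesc (f + f') (g + g') := by
  ext i j
  cases i <;> rfl

theorem matLift_add {M N K : Mat_ V} (f f' : K ⟶ M) (g g' : K ⟶ N) :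
    matLift f g + matLift f' g' = matLift (f + f') (g + g') := by
  ext i j
  cases j <;> rfl

theorem matDesc_ext {M N K : Mat_ V} {f f' : M ⟶ K} {g g' : N ⟶ K} (h : f = f') (h' : g = g') :
    matDesc f g = matDesc f' g' := by rw [h, h']

theorem matLift_ext {M N K : Mat_ V} {f f' : K ⟶ M} {g g' : K ⟶ N} (h : f = f') (h' : g = g') :
    matLift f g = matLift f' g' := by rw [h, h']

theorem matDesc_zero {M N K : Mat_ V} : matDesc (0 : M ⟶ K) (0 : N ⟶ K) = 0 := by
  ext i j
  cases i <;> rfl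

theorem matLift_zero {M N K : Mat_ V} : matLift (0 : K ⟶ M) (0 : K ⟶ N) = 0 := by
  ext i j
  cases j <;> rfl

variable {k : Type w} [Field k] [Linear k V] [DiffCategory k V]

theorem d_matDesc {M N K : Mat_ V} (f : M ⟶ K) (g : N ⟶ K) :
    d k (matDesc f g) = matDesc (d k f) (d k g) := by
  ext i j
  cases i <;> rfl

theorem d_matLift {M N K : Mat_ V} (f : K ⟶ M) (g : K ⟶ N) :
    d k (matLift f g) = matLift (d k f) (d k g) := by
  ext i j
  cases j <;> rfl

variable [CharP k 2]

/-- The cone of a closed `f : X ⟶ Y`: the concatenation of `X` and `Y`, twisted by `f`, with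
idempotent the diagonal matrix of the idempotents of `X` and `Y`. -/
def Perf.coneObj {X Y : Perf k V} (f : X ⟶ Y) (hf : d k f = 0) : Perf k V where
  mat := matSum X.mat Y.mat
  nonempty := ⟨Sum.inl X.nonempty.some⟩
  δ := matDesc (matLift X.δ f.val) (matLift 0 Y.δ)
  d_δ := by
    have h : d k f.val = X.δ ≫ f.val + f.val ≫ Y.δ := eq_of_add k (congrArg PerfHom.val hf)
    rw [d_matDesc, d_matLift, d_matLift, matDesc_comp, matLift_comp_matDesc,
      matLift_comp_matDesc]
    refine matDesc_ext ?_ ?_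
    · simp only [comp_matLift, matLift_add, X.d_δ, h, Limits.comp_zero, add_zero]
    · simp only [comp_matLift, Y.d_δ, map_zero, Limits.comp_zero, Limits.zero_comp, zero_add]
  triangular := by
    obtain ⟨r, hr⟩ := X.triangular
    obtain ⟨s, hs⟩ := Y.triangular
    refine ⟨Sum.elim r (fun j => s j + (∑ i, r i + 1)), ?_⟩
    rintro (i | i) (j | j) h
    · exact hr i j h
    · exfalso
      have h1 : r i ≤ ∑ i, r i := Finset.single_le_sum (fun _ _ => Nat.zero_le _) (Finset.mem_univ i)
      simp only [Sum.elim_inl, Sum.elim_inr] at h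
      omega
    · rfl
    · refine hs i j ?_
      simp only [Sum.elim_inr] at h
      omega
  p := matDesc (matLift X.p 0) (matLift 0 Y.p)
  closed := by
    simp only [d_matDesc, d_matLift, matDesc_comp, matLift_comp_matDesc, comp_matLift,
      matLift_add, matDesc_add, map_zero, Limits.comp_zero, Limits.zero_comp, add_zero, zero_add]
    rw [← matDesc_zero]
    refine matDesc_ext ?_ ?_
    · rw [← matLift_zero]
      refine matLift_ext X.closed ?_
      rw [f.left, f.right, add_self k]
    · rw [← matLift_zero]
      exact matLift_ext rfl Y.closed
  idem := by
    simp only [matDesc_comp, matLift_comp_matDesc, comp_matLift, Limits.comp_zero, Limits.zero_comp, add_zero, zero_add, X.idem, Y.idem]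

/-- The cone of a closed morphism, with its structure maps. -/
def Perf.coneData {X Y : Perf k V} (f : X ⟶ Y) (hf : d k f = 0) : ConeData k f :=
  let δ : matSum X.mat Y.mat ⟶ matSum X.mat Y.mat :=
    matDesc (matLift X.δ f.val) (matLift 0 Y.δ)
  let p : matSum X.mat Y.mat ⟶ matSum X.mat Y.mat := matDesc (matLift X.p 0) (matLift 0 Y.p)
  let inl : X.mat ⟶ matSum X.mat Y.mat := matLift X.p 0
  let inr : Y.mat ⟶ matSum X.mat Y.mat := matLift 0 Y.p
  let fst : matSum X.mat Y.mat ⟶ X.mat := matDesc X.p 0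
  let snd : matSum X.mat Y.mat ⟶ Y.mat := matDesc 0 Y.p
  { obj := Perf.coneObj f hf
    inl := ⟨inl, by
      show X.p ≫ inl = inl
      simp [inl, comp_matLift, X.idem], by
      show inl ≫ p = inl
      simp [inl, p, matLift_comp_matDesc, comp_matLift, X.idem]⟩
    inr := ⟨inr, by
      show Y.p ≫ inr = inr
      simp [inr, comp_matLift, Y.idem], by
      show inr ≫ p = inr
      simp [inr, p, matLift_comp_matDesc, comp_matLift, Y.idem]⟩
    fst := ⟨fst, by
      show p ≫ fst = fst
      simp [fst, p, matDesc_comp, matLift_comp_matDesc, X.idem], by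
      show fst ≫ X.p = fst
      simp [fst, matDesc_comp, X.idem]⟩
    snd := ⟨snd, by
      show p ≫ snd = snd
      simp [snd, p, matDesc_comp, matLift_comp_matDesc, Y.idem], by
      show snd ≫ Y.p = snd
      simp [snd, matDesc_comp, Y.idem]⟩
    inl_fst := by
      ext : 1
      show inl ≫ fst = X.p
      simp [inl, fst, matLift_comp_matDesc, X.idem]
    inr_snd := by
      ext : 1
      show inr ≫ snd = Y.p
      simp [inr, snd, matLift_comp_matDesc, Y.idem]
    inl_snd := by
      ext : 1
      show inl ≫ snd = 0
      simp [inl, snd, matLift_comp_matDesc]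
    inr_fst := by
      ext : 1
      show inr ≫ fst = 0
      simp [inr, fst, matLift_comp_matDesc]
    total := by
      ext : 1
      show fst ≫ inl + snd ≫ inr = p
      simp only [inl, inr, fst, snd, p]
      rw [matDesc_comp, matDesc_comp, matDesc_add]
      simp [comp_matLift, X.idem, Y.idem]
    d_inl := by
      ext : 1
      show d k inl + (X.δ ≫ inl + inl ≫ δ) = f.val ≫ inr
      simp only [inl, inr, δ, d_matLift, comp_matLift, matLift_comp_matDesc, matLift_add, X.d_p,
        f.left, f.right]
      refine matLift_ext ?_ ?_
      · simp [add_self k]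
      · simp
    d_inr := by
      ext : 1
      show d k inr + (Y.δ ≫ inr + inr ≫ δ) = 0
      simp only [inr, δ, d_matLift, comp_matLift, matLift_comp_matDesc, matLift_add, Y.d_p]
      rw [← matLift_zero]
      refine matLift_ext ?_ ?_
      · simp
      · simp [add_self k]
    d_fst := by
      ext : 1
      show d k fst + (δ ≫ fst + fst ≫ X.δ) = 0
      simp only [fst, δ, d_matDesc, matDesc_comp, matLift_comp_matDesc, matDesc_add, X.d_p]
      rw [← matDesc_zero]
      refine matDesc_ext ?_ ?_
      · rw [← sub_eq_zero]
        abel_nf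
        simp [two_zsmul_zero k]
      · simp
    d_snd := by
      ext : 1
      show d k snd + (δ ≫ snd + snd ≫ Y.δ) = fst ≫ f.val
      simp only [fst, snd, δ, d_matDesc, matDesc_comp, matLift_comp_matDesc, matDesc_add, Y.d_p,
        f.left, f.right]
      refine matDesc_ext ?_ ?_
      · simp
      · rw [← sub_eq_zero]
        abel_nf
        simp [two_zsmul_zero k] }

instance : HasCones k (Perf k V) where
  cone f hf := Perf.coneData f hf

/-- The idempotent completion of the category of twisted objects is idempotent-complete. -/
theorem Perf.idempotentComplete : IdempotentComplete k (Perf k V) := by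
  intro X e he hee
  have h1 : d k e.val + (X.δ ≫ e.val + e.val ≫ X.δ) = 0 := congrArg PerfHom.val he
  have h2 : e.val ≫ e.val = e.val := congrArg PerfHom.val hee
  refine ⟨{ X with p := e.val, closed := h1, idem := h2 }, ⟨e.val, h2, e.right⟩,
    ⟨e.val, e.left, h2⟩, ?_, ?_, ?_, ?_⟩ <;> ext : 1
  exacts [h1, h1, h2, h2]

variable (k) in
/-- The embedding of `V` in the idempotent completion of the category of twisted objects. -/
def Perf.embedding : V ⥤ Perf k V where
  obj X :=
    { mat := (Mat_.embedding V).obj X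
      nonempty := ⟨PUnit.unit⟩
      δ := 0
      d_δ := by simp
      triangular := ⟨fun _ => 0, fun _ _ _ => rfl⟩
      p := 𝟙 _
      closed := by
        rw [d_id]
        simp
      idem := by simp }
  map f := ⟨(Mat_.embedding V).map f, Category.id_comp _, Category.comp_id _⟩
  map_id X := PerfHom.ext ((Mat_.embedding V).map_id X)
  map_comp f g := PerfHom.ext ((Mat_.embedding V).map_comp f g)

end Cones

/-! ### Extension of functors and natural transformations to the completion -/

section Extension

variable {V : Type u} [Category.{v} V] [Preadditive V]

/-- A functor applied to a finite family of objects. -/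
abbrev matObj (G : V ⥤ V) (M : Mat_ V) : Mat_ V := ⟨M.ι, fun i => G.obj (M.X i)⟩

/-- A functor applied to the entries of a matrix. -/
def matMap (G : V ⥤ V) {M N : Mat_ V} (f : M ⟶ N) : matObj G M ⟶ matObj G N :=
  fun i j => G.map (f i j)

/-- For a natural transformation `α`, the product of a matrix `f` with the diagonal matrix of
components of `α`. -/
def matTr {G H : V ⥤ V} (α : G ⟶ H) {M N : Mat_ V} (f : M ⟶ N) : matObj G M ⟶ matObj H N :=
  fun i j => G.map (f i j) ≫ α.app (N.X j)

theorem matTr_id (G : V ⥤ V) {M N : Mat_ V} (f : M ⟶ N) : matTr (𝟙 G) f = matMap G f := by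
  ext i j
  exact Category.comp_id _

variable (k : Type w) [Field k] [Linear k V] [DiffCategory k V]

theorem matMap_add (G : V ⥤ V) [IsDiff k G] {M N : Mat_ V} (f g : M ⟶ N) :
    matMap G (f + g) = matMap G f + matMap G g := by
  ext i j
  exact IsDiff.map_add (k := k) (f i j) (g i j)

theorem matMap_zero (G : V ⥤ V) [IsDiff k G] {M N : Mat_ V} :
    matMap G (0 : M ⟶ N) = 0 := by
  ext i j
  exact map_zero' k G _ _

theorem matMap_smul (G : V ⥤ V) [IsDiff k G] {M N : Mat_ V} (a : k) (f : M ⟶ N) :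
    matMap G (a • f) = a • matMap G f := by
  ext i j
  exact IsDiff.map_smul a (f i j)

theorem matMap_d (G : V ⥤ V) [IsDiff k G] {M N : Mat_ V} (f : M ⟶ N) :
    matMap G (d k f) = d k (matMap G f) := by
  ext i j
  exact IsDiff.map_d (f i j)

theorem matTr_comp {G H K : V ⥤ V} [IsDiff k G] (α : G ⟶ H) (β : H ⟶ K) {M N L : Mat_ V}
    (f : M ⟶ N) (g : N ⟶ L) : matTr α f ≫ matTr β g = matTr (α ≫ β) (f ≫ g) := by
  refine Mat_.hom_ext _ _ fun (i : M.ι) (j : L.ι) => ?_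
  show ∑ l : N.ι, (G.map (f i l) ≫ α.app (N.X l)) ≫ H.map (g l j) ≫ β.app (L.X j) =
    G.map (∑ l : N.ι, f i l ≫ g l j) ≫ (α ≫ β).app (L.X j)
  rw [ map_sum' k, Preadditive.sum_comp]
  refine Finset.sum_congr rfl fun l _ => ?_
  simp

theorem matMap_comp (G : V ⥤ V) [IsDiff k G] {M N L : Mat_ V} (f : M ⟶ N) (g : N ⟶ L) :
    matMap G (f ≫ g) = matMap G f ≫ matMap G g := by
  rw [← matTr_id, ← matTr_id, ← matTr_id, matTr_comp k, Category.comp_id]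

theorem matMap_comp_matTr {G H : V ⥤ V} [IsDiff k G] (α : G ⟶ H) {M N L : Mat_ V}
    (f : M ⟶ N) (g : N ⟶ L) : matMap G f ≫ matTr α g = matTr α (f ≫ g) := by
  rw [← matTr_id, matTr_comp k, Category.id_comp]

theorem matTr_comp_matMap {G H : V ⥤ V} [IsDiff k G] (α : G ⟶ H) {M N L : Mat_ V}
    (f : M ⟶ N) (g : N ⟶ L) : matTr α f ≫ matMap H g = matTr α (f ≫ g) := by
  rw [← matTr_id, matTr_comp k, Category.comp_id]

theorem matTr_add {G H : V ⥤ V} [IsDiff k G] (α : G ⟶ H) {M N : Mat_ V} (f g : M ⟶ N) :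
    matTr α (f + g) = matTr α f + matTr α g := by
  refine Mat_.hom_ext _ _ fun (i : M.ι) (j : N.ι) => ?_
  show G.map (f i j + g i j) ≫ α.app (N.X j) =
    G.map (f i j) ≫ α.app (N.X j) + G.map (g i j) ≫ α.app (N.X j)
  rw [IsDiff.map_add (k := k), Preadditive.add_comp]

/-- The product of a matrix `f` with the diagonal matrix of differentials of components of `α`. -/
def matTrD {G H : V ⥤ V} (α : G ⟶ H) {M N : Mat_ V} (f : M ⟶ N) : matObj G M ⟶ matObj H N :=
  fun i j => G.map (f i j) ≫ d k (α.app (N.X j))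

theorem d_matTr {G H : V ⥤ V} [IsDiff k G] (α : G ⟶ H) {M N : Mat_ V} (f : M ⟶ N) :
    d k (matTr α f) = matTr α (d k f) + matTrD k α f := by
  refine Mat_.hom_ext _ _ fun (i : M.ι) (j : N.ι) => ?_
  show d k (G.map (f i j) ≫ α.app (N.X j)) = G.map (d k (f i j)) ≫ α.app (N.X j) +
    G.map (f i j) ≫ d k (α.app (N.X j))
  rw [d_comp, IsDiff.map_d]

theorem matTr_zero {G H : V ⥤ V} [IsDiff k G] (α : G ⟶ H) {M N : Mat_ V} :
    matTr α (0 : M ⟶ N) = 0 := by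
  refine Mat_.hom_ext _ _ fun (i : M.ι) (j : N.ι) => ?_
  show G.map 0 ≫ α.app (N.X j) = 0
  rw [map_zero' k, Limits.zero_comp]

variable [CharP k 2]

/-- The extension of a differential endofunctor of `V` to the idempotent completion of the
category of twisted objects. -/
def Perf.functor (G : V ⥤ V) [IsDiff k G] : Perf k V ⥤ Perf k V where
  obj X :=
    { mat := matObj G X.mat
      nonempty := X.nonempty
      δ := matMap G X.δ
      d_δ := by rw [← matMap_d, X.d_δ, matMap_comp k]
      triangular := by
        obtain ⟨r, hr⟩ := X.triangular
        refine ⟨r, fun i j h => ?_⟩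
        show G.map (X.δ i j) = 0
        rw [hr i j h, map_zero' k]
      p := matMap G X.p
      closed := by
        rw [← matMap_d, ← matMap_comp k, ← matMap_comp k, ← matMap_add k, ← matMap_add k,
          X.closed, matMap_zero k]
      idem := by rw [← matMap_comp k, X.idem] }
  map f := ⟨matMap G f.val, by
    show matMap G _ ≫ matMap G f.val = _
    rw [← matMap_comp k, f.left], by
    show matMap G f.val ≫ matMap G _ = _
    rw [← matMap_comp k, f.right]⟩
  map_id X := rfl
  map_comp f g := PerfHom.ext (matMap_comp k G f.val g.val)

instance (G : V ⥤ V) [IsDiff k G] : IsDiff k (Perf.functor k G) where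
  map_add f g := PerfHom.ext (matMap_add k G f.val g.val)
  map_smul a f := PerfHom.ext (matMap_smul k G a f.val)
  map_d {X Y} f := by
    ext : 1
    show matMap G (d k f.val + (X.δ ≫ f.val + f.val ≫ Y.δ)) =
      d k (matMap G f.val) + (matMap G X.δ ≫ matMap G f.val + matMap G f.val ≫ matMap G Y.δ)
    rw [matMap_add k, matMap_add k, matMap_d, matMap_comp k, matMap_comp k]

/-- The extension of a natural transformation to the idempotent completion of the category of
twisted objects: its component at `(X, p)` is the diagonal matrix of its components, composed
with `p`. -/
def Perf.nat {G H : V ⥤ V} [IsDiff k G] [IsDiff k H] (α : G ⟶ H) :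
    Perf.functor k G ⟶ Perf.functor k H where
  app X := ⟨matTr α X.p, by
    show matMap G X.p ≫ matTr α X.p = _
    rw [matMap_comp_matTr k, X.idem], by
    show matTr α X.p ≫ matMap H X.p = _
    rw [matTr_comp_matMap k, X.idem]⟩
  naturality X Y f := by
    ext : 1
    show matMap G f.val ≫ matTr α Y.p = matTr α X.p ≫ matMap H f.val
    rw [matMap_comp_matTr k, matTr_comp_matMap k, f.left, f.right]

theorem Perf.d_nat_app {G H : V ⥤ V} [IsDiff k G] [IsDiff k H] (α : G ⟶ H) (X : Perf k V) :
    (d k ((Perf.nat k α).app X)).val = matTrD k α X.p := by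
  show d k (matTr α X.p) + (matMap G X.δ ≫ matTr α X.p + matTr α X.p ≫ matMap H X.δ) = _
  rw [matMap_comp_matTr k, matTr_comp_matMap k, d_matTr, ← matTr_add k, add_right_comm,
    ← matTr_add k, X.closed, matTr_zero k, zero_add]

theorem Perf.nat_closed {G H : V ⥤ V} [IsDiff k G] [IsDiff k H] {α : G ⟶ H}
    (h : NatClosed k α) : NatClosed k (Perf.nat k α) := by
  intro X
  ext : 1
  rw [Perf.d_nat_app]
  refine Mat_.hom_ext _ _ fun (i : X.mat.ι) (j : X.mat.ι) => ?_
  show G.map (X.p i j) ≫ d k (α.app (X.mat.X j)) = 0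
  rw [h, Limits.comp_zero]

/-- The extension of a `2`-representation. -/
theorem Perf.isTwoRep {E : V ⥤ V} [IsDiff k E] {τ : E ⋙ E ⟶ E ⋙ E} (h : IsTwoRep k E τ) :
    IsTwoRep k (Perf.functor k E)
      (Perf.nat k τ : Perf.functor k E ⋙ Perf.functor k E ⟶
        Perf.functor k E ⋙ Perf.functor k E) where
  isDiff := inferInstance
  d_tau X := by
    ext : 1
    refine (Perf.d_nat_app k τ X).trans ?_
    refine Mat_.hom_ext _ _ fun (i : X.mat.ι) (j : X.mat.ι) => ?_
    show (E ⋙ E).map (X.p i j) ≫ d k (τ.app (X.mat.X j)) = (E ⋙ E).map (X.p i j)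
    rw [h.d_tau]
    exact Category.comp_id _
  sq X := by
    ext : 1
    show matTr τ X.p ≫ matTr τ X.p = 0
    rw [matTr_comp k, X.idem]
    refine Mat_.hom_ext _ _ fun (i : X.mat.ι) (j : X.mat.ι) => ?_
    show (E ⋙ E).map (X.p i j) ≫ τ.app (X.mat.X j) ≫ τ.app (X.mat.X j) = 0
    rw [h.sq, Limits.comp_zero]
  braid X := by
    ext : 1
    have e1 : matMap E (matTr τ X.p) = matTr (Functor.whiskerRight τ E) X.p := by
      refine Mat_.hom_ext _ _ fun (i : X.mat.ι) (j : X.mat.ι) => ?_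
      exact E.map_comp _ _
    show matMap E (matTr τ X.p) ≫ matTr τ (matMap E X.p) ≫ matMap E (matTr τ X.p) =
      matTr τ (matMap E X.p) ≫ matMap E (matTr τ X.p) ≫ matTr τ (matMap E X.p)
    rw [e1]
    let a : E ⋙ E ⋙ E ⟶ E ⋙ E ⋙ E := Functor.whiskerRight τ E
    let b : E ⋙ E ⋙ E ⟶ E ⋙ E ⋙ E := Functor.whiskerLeft E τ
    have hab : a ≫ b ≫ a = b ≫ a ≫ b := by
      ext x
      exact h.braid x
    have key : matTr a X.p ≫ matTr b X.p ≫ matTr a X.p =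
        matTr b X.p ≫ matTr a X.p ≫ matTr b X.p := by
      simp only [matTr_comp k, X.idem, hab]
    exact key

end Extension

/-! ### Iterates, nil Hecke operators, permutation morphisms -/

section Iterates

variable {V : Type u} [Category.{v} V]

/-- The iterates `Eⁿ` of an endofunctor, with `Eⁿ⁺¹(x) = E(Eⁿ(x))`. -/
def pow (E : V ⥤ V) : ℕ → (V ⥤ V)
  | 0 => 𝟭 V
  | n + 1 => pow E n ⋙ E

/-- The endomorphism `T_{r+1} = E^r τ E^{n-r-2}` of `Eⁿ(x)`, for `r + 1 < n` (and the identity for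
other values of `r`). -/
def hecke {E : V ⥤ V} (τ : E ⋙ E ⟶ E ⋙ E) : (n r : ℕ) → (x : V) →
    ((pow E n).obj x ⟶ (pow E n).obj x)
  | 0, _, _ => 𝟙 _
  | 1, _, _ => 𝟙 _
  | n + 2, 0, x => τ.app ((pow E n).obj x)
  | n + 2, r + 1, x => E.map (hecke τ (n + 1) r x)

/-- `T_{(1 2 ⋯ r+1)} = T_1 ∘ ⋯ ∘ T_r` on `Eⁿ(x)`. -/
def heckeFront {E : V ⥤ V} (τ : E ⋙ E ⟶ E ⋙ E) (n : ℕ) : (r : ℕ) → (x : V) →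
    ((pow E n).obj x ⟶ (pow E n).obj x)
  | 0, _ => 𝟙 _
  | r + 1, x => hecke τ n r x ≫ heckeFront τ n r x

/-- `T_{(r+1+l ⋯ r+2 r+1)} = T_{r+l} ∘ ⋯ ∘ T_{r+1}` on `Eⁿ(x)`. -/
def heckeBack {E : V ⥤ V} (τ : E ⋙ E ⟶ E ⋙ E) (n : ℕ) : (r l : ℕ) → (x : V) →
    ((pow E n).obj x ⟶ (pow E n).obj x)
  | _, 0, _ => 𝟙 _
  | r, l + 1, x => hecke τ n r x ≫ heckeBack τ n (r + 1) l x

/-- The identification `E^i E^j = E^{i+j}`. -/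
def powAdd (E : V ⥤ V) (j : ℕ) : (i : ℕ) → (x : V) →
    ((pow E i).obj ((pow E j).obj x) ⟶ (pow E (j + i)).obj x)
  | 0, _ => 𝟙 _
  | i + 1, x => E.map (powAdd E j i x)

/-- For `s : A G ⟶ G A`, the morphism `(s A^{n-1}) ∘ (A s A^{n-2}) ∘ ⋯ ∘ (A^{n-1} s)` from
`Aⁿ G` to `G Aⁿ`, at `x`. -/
def slide {A G : V ⥤ V} (s : G ⋙ A ⟶ A ⋙ G) : (n : ℕ) → (x : V) →
    ((pow A n).obj (G.obj x) ⟶ G.obj ((pow A n).obj x))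
  | 0, _ => 𝟙 _
  | n + 1, x => A.map (slide s n x) ≫ s.app ((pow A n).obj x)

/-- For `s : A G ⟶ G A`, the morphism `(G^{j-1} s_i) ∘ ⋯ ∘ (G s_i G^{j-2}) ∘ (s_i G^{j-1})` from
`A^i G^j` to `G^j A^i`, at `x`, where `s_i : A^i G ⟶ G A^i` is as above. -/
def slidePow {A G : V ⥤ V} (s : G ⋙ A ⟶ A ⋙ G) (i : ℕ) : (j : ℕ) → (x : V) →
    ((pow A i).obj ((pow G j).obj x) ⟶ (pow G j).obj ((pow A i).obj x))
  | 0, _ => 𝟙 _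
  | j + 1, x => slide s i ((pow G j).obj x) ≫ G.map (slidePow s i j x)

/-- For `ε : F E ⟶ 1`, the morphism `Fⁿ ε : Fⁿ⁺¹ E ⟶ Fⁿ`, at `x`. -/
def counitPow {F E : V ⥤ V} (ε : E ⋙ F ⟶ 𝟭 V) : (n : ℕ) → (x : V) →
    ((pow F (n + 1)).obj (E.obj x) ⟶ (pow F n).obj x)
  | 0, x => ε.app x
  | n + 1, x => F.map (counitPow ε n x)

variable (k : Type w) [Field k] [Preadditive V] [Linear k V] [DiffCategory k V]

instance isDiff_pow (E : V ⥤ V) [IsDiff k E] : (n : ℕ) → IsDiff k (pow E n)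
  | 0 => isDiff_id k
  | n + 1 => haveI := isDiff_pow E n; isDiff_comp k (pow E n) E

end Iterates

/-! ### The diagonal category `Δ_σ` -/

section Diag

variable (k : Type w) [Field k] (V : Type u) [Category.{v} V] [Preadditive V] [Linear k V]
  [DiffCategory k V]

/-- Differential endofunctors `E₁`, `E₂` with endomorphisms `τ₁` of `E₁²` and `τ₂` of `E₂²` and
a closed morphism `σ : E₂E₁ ⟶ E₁E₂`. -/
structure SigmaData where
  E₁ : V ⥤ V
  E₂ : V ⥤ V
  τ₁ : E₁ ⋙ E₁ ⟶ E₁ ⋙ E₁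
  τ₂ : E₂ ⋙ E₂ ⟶ E₂ ⋙ E₂
  σ : E₁ ⋙ E₂ ⟶ E₂ ⋙ E₁
  isDiff₁ : IsDiff k E₁
  isDiff₂ : IsDiff k E₂
  σ_closed : NatClosed k σ

attribute [instance] SigmaData.isDiff₁ SigmaData.isDiff₂

variable {k V}

/-- The axioms under which the diagonal category `Δ_σ` is considered: `(E₁, τ₁)` and `(E₂, τ₂)`
are `2`-representations and `σ` intertwines `τ₁` and `τ₂`. -/
structure SigmaData.Compatible (S : SigmaData k V) : Prop where
  rep₁ : IsTwoRep k S.E₁ S.τ₁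
  rep₂ : IsTwoRep k S.E₂ S.τ₂
  comm₂ : ∀ x, S.E₂.map (S.σ.app x) ≫ S.σ.app (S.E₂.obj x) ≫ S.E₁.map (S.τ₂.app x) =
    S.τ₂.app (S.E₁.obj x) ≫ S.E₂.map (S.σ.app x) ≫ S.σ.app (S.E₂.obj x)
  comm₁ : ∀ x, S.σ.app (S.E₁.obj x) ≫ S.E₁.map (S.σ.app x) ≫ S.τ₁.app (S.E₂.obj x) =
    S.E₂.map (S.τ₁.app x) ≫ S.σ.app (S.E₁.obj x) ≫ S.E₁.map (S.σ.app x)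

variable (S : SigmaData k V)

/-- The conditions on `π : E₂(m) ⟶ E₁(m)` for `(m, π)` to be an object of `Δ_σ`. -/
structure IsDiagObj (m : V) (π : S.E₂.obj m ⟶ S.E₁.obj m) : Prop where
  closed : d k π = 0
  comm : S.E₂.map π ≫ S.σ.app m ≫ S.E₁.map π ≫ S.τ₁.app m =
    S.τ₂.app m ≫ S.E₂.map π ≫ S.σ.app m ≫ S.E₁.map π

/-- The objects `(m, π)` of `Δ_σ`. -/
structure DiagObj where
  m : V
  π : S.E₂.obj m ⟶ S.E₁.obj m
  isDiagObj : IsDiagObj S m π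

variable {S}

/-- The condition for `f : m ⟶ m'` to be a morphism `(m, π) ⟶ (m', π')` in `Δ_σ`. -/
def IsDiagHom {m m' : V} (π : S.E₂.obj m ⟶ S.E₁.obj m) (π' : S.E₂.obj m' ⟶ S.E₁.obj m')
    (f : m ⟶ m') : Prop :=
  π ≫ S.E₁.map f = S.E₂.map f ≫ π'

/-- The morphisms of `Δ_σ`. -/
@[ext]
structure DiagHom (X Y : DiagObj S) where
  val : X.m ⟶ Y.m
  isDiagHom : IsDiagHom X.π Y.π val

/-- Morphisms as a linear subspace of `Hom(m, m')`. -/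
def DiagHom.sub (X Y : DiagObj S) : Submodule k (X.m ⟶ Y.m) where
  carrier := {f | IsDiagHom X.π Y.π f}
  add_mem' {f g} hf hg := by
    show X.π ≫ S.E₁.map (f + g) = S.E₂.map (f + g) ≫ Y.π
    rw [IsDiff.map_add (k := k), IsDiff.map_add (k := k), Preadditive.comp_add,
      Preadditive.add_comp, hf, hg]
  zero_mem' := by
    show X.π ≫ S.E₁.map 0 = S.E₂.map 0 ≫ Y.π
    rw [map_zero' k, map_zero' k, Limits.comp_zero, Limits.zero_comp]
  smul_mem' a f hf := by
    show X.π ≫ S.E₁.map (a • f) = S.E₂.map (a • f) ≫ Y.π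
    rw [IsDiff.map_smul, IsDiff.map_smul, Linear.comp_smul, Linear.smul_comp, hf]

/-- Morphisms as elements of that subspace. -/
def DiagHom.equiv (X Y : DiagObj S) : DiagHom X Y ≃ DiagHom.sub X Y where
  toFun f := ⟨f.val, f.isDiagHom⟩
  invFun f := ⟨f.1, f.2⟩

instance : Category (DiagObj S) where
  Hom X Y := DiagHom X Y
  id X := ⟨𝟙 X.m, by simp [IsDiagHom]⟩
  comp {X Y Z} f g := ⟨f.val ≫ g.val, by
    show X.π ≫ S.E₁.map (f.val ≫ g.val) = S.E₂.map (f.val ≫ g.val) ≫ Z.π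
    rw [Functor.map_comp, Functor.map_comp, ← Category.assoc, f.isDiagHom, Category.assoc,
      g.isDiagHom, Category.assoc]⟩
  id_comp f := DiagHom.ext (Category.id_comp _)
  comp_id f := DiagHom.ext (Category.comp_id _)
  assoc f g h := DiagHom.ext (Category.assoc _ _ _)

instance (X Y : DiagObj S) : AddCommGroup (X ⟶ Y) := (DiagHom.equiv X Y).addCommGroup

instance : Preadditive (DiagObj S) where
  add_comp _ _ _ _ _ _ := DiagHom.ext (Preadditive.add_comp _ _ _ _ _ _)
  comp_add _ _ _ _ _ _ := DiagHom.ext (Preadditive.comp_add _ _ _ _ _ _)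

instance (X Y : DiagObj S) : Module k (X ⟶ Y) := (DiagHom.equiv X Y).module k

instance : Linear k (DiagObj S) where
  smul_comp _ _ _ _ _ _ := DiagHom.ext (Linear.smul_comp _ _ _ _ _ _)
  comp_smul _ _ _ _ _ _ := DiagHom.ext (Linear.comp_smul _ _ _ _ _ _)

/-- `Δ_σ` as a differential category, with the differential of `V` on morphisms. -/
instance : DiffCategory k (DiagObj S) where
  d {X Y} :=
    { toFun := fun f => ⟨d k f.val, by
        show X.π ≫ S.E₁.map (d k f.val) = S.E₂.map (d k f.val) ≫ Y.π
        have h := congrArg (fun g => d k g) (show X.π ≫ S.E₁.map f.val = _ from f.isDiagHom)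
        simp only [d_comp, X.isDiagObj.closed, Y.isDiagObj.closed, Limits.zero_comp,
          Limits.comp_zero, zero_add, add_zero] at h
        rw [IsDiff.map_d, IsDiff.map_d, h]⟩
      map_add' := fun f g => DiagHom.ext (map_add (d k) f.val g.val)
      map_smul' := fun a f => DiagHom.ext (map_smul (d k) a f.val) }
  d_d f := DiagHom.ext (d_d k f.val)
  d_comp f g := DiagHom.ext (d_comp k f.val g.val)

/-- For `π : E₂(m) ⟶ E₁(m)`, the cone `m' = E₂(m) ⊕ E₁(m)` of `π`. -/
def coneOf [HasCones k V] (m : V) (π : S.E₂.obj m ⟶ S.E₁.obj m) (hπ : d k π = 0) : ConeData k π :=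
  HasCones.cone π hπ

/-- The morphism `E₂(m') ⟶ E₁(m')` with matrix `(σ∘E₂π∘τ₂, σ; 0, τ₁∘E₁π∘σ)` where
`m' = E₂(m) ⊕ E₁(m)` is the cone of `π`. -/
def diagStepπ {m : V} {π : S.E₂.obj m ⟶ S.E₁.obj m} (c : ConeData k π) :
    S.E₂.obj c.obj ⟶ S.E₁.obj c.obj :=
  S.E₂.map c.fst ≫ (S.τ₂.app m ≫ S.E₂.map π ≫ S.σ.app m) ≫ S.E₁.map c.inl +
  S.E₂.map c.snd ≫ S.σ.app m ≫ S.E₁.map c.inl +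
  S.E₂.map c.snd ≫ (S.σ.app m ≫ S.E₁.map π ≫ S.τ₁.app m) ≫ S.E₁.map c.inr

/-- The diagonal morphism `(E₂(f), E₁(f))` between the cones of `π` and `π'`. -/
def diagMap {m m' : V} {π : S.E₂.obj m ⟶ S.E₁.obj m} {π' : S.E₂.obj m' ⟶ S.E₁.obj m'}
    (c : ConeData k π) (c' : ConeData k π') (f : m ⟶ m') : c.obj ⟶ c'.obj :=
  c.fst ≫ S.E₂.map f ≫ c'.inl + c.snd ≫ S.E₁.map f ≫ c'.inr

/-- The endomorphism `(τ₂, 0, 0, 0; 0, 0, σ⁻¹, 0; 0, 0, 0, 0; 0, 0, 0, τ₁)` of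
`m'' = E₂²(m) ⊕ E₂E₁(m) ⊕ E₁E₂(m) ⊕ E₁²(m)`, where `m'` is the cone of `π : E₂(m) ⟶ E₁(m)` and
`m''` the cone of `π' : E₂(m') ⟶ E₁(m')`. -/
def tauMatrix [∀ x, IsIso (S.σ.app x)] {m : V} {π : S.E₂.obj m ⟶ S.E₁.obj m} (c : ConeData k π)
    {π' : S.E₂.obj c.obj ⟶ S.E₁.obj c.obj} (c' : ConeData k π') : c'.obj ⟶ c'.obj :=
  c'.fst ≫ S.E₂.map c.fst ≫ S.τ₂.app m ≫ S.E₂.map c.inl ≫ c'.inl +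
  c'.snd ≫ S.E₁.map c.fst ≫ inv (S.σ.app m) ≫ S.E₂.map c.inr ≫ c'.inl +
  c'.snd ≫ S.E₁.map c.snd ≫ S.τ₁.app m ≫ S.E₁.map c.inr ≫ c'.inr

theorem diagMap_id {m : V} {π : S.E₂.obj m ⟶ S.E₁.obj m} (c : ConeData k π) :
    diagMap c c (𝟙 m) = 𝟙 _ := by
  simp [diagMap, c.total]

theorem diagMap_comp {m m' m'' : V} {π : S.E₂.obj m ⟶ S.E₁.obj m}
    {π' : S.E₂.obj m' ⟶ S.E₁.obj m'} {π'' : S.E₂.obj m'' ⟶ S.E₁.obj m''}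
    (c : ConeData k π) (c' : ConeData k π') (c'' : ConeData k π'') (f : m ⟶ m') (g : m' ⟶ m'') :
    diagMap c c'' (f ≫ g) = diagMap c c' f ≫ diagMap c' c'' g := by
  have h1 : ∀ {Z} (h : _ ⟶ Z), c'.inl ≫ c'.fst ≫ h = h := fun h => by
    rw [← Category.assoc, c'.inl_fst, Category.id_comp]
  have h2 : ∀ {Z} (h : _ ⟶ Z), c'.inr ≫ c'.snd ≫ h = h := fun h => by
    rw [← Category.assoc, c'.inr_snd, Category.id_comp]
  have h3 : ∀ {Z} (h : _ ⟶ Z), c'.inl ≫ c'.snd ≫ h = 0 := fun h => by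
    rw [← Category.assoc, c'.inl_snd, Limits.zero_comp]
  have h4 : ∀ {Z} (h : _ ⟶ Z), c'.inr ≫ c'.fst ≫ h = 0 := fun h => by
    rw [← Category.assoc, c'.inr_fst, Limits.zero_comp]
  simp [diagMap, h1, h2, h3, h4]

variable [HasCones k V]

variable (S) in
/-- The endofunctor `E` of `Δ_σ` is well defined. -/
structure DiagStepWellDefined : Prop where
  obj : ∀ X : DiagObj S,
    IsDiagObj S (coneOf X.m X.π X.isDiagObj.closed).obj
      (diagStepπ (coneOf X.m X.π X.isDiagObj.closed))
  map : ∀ {X Y : DiagObj S} (f : X ⟶ Y),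
    IsDiagHom (diagStepπ (coneOf X.m X.π X.isDiagObj.closed))
      (diagStepπ (coneOf Y.m Y.π Y.isDiagObj.closed))
      (diagMap (coneOf X.m X.π X.isDiagObj.closed) (coneOf Y.m Y.π Y.isDiagObj.closed) f.val)

/-- The endofunctor `E` of `Δ_σ`: on objects `E(m, π) = (m', π')`, where `m'` is the cone of `π`,
and on morphisms `E(f) = (E₂(f), E₁(f))`. -/
def diagStep (h : DiagStepWellDefined S) : DiagObj S ⥤ DiagObj S where
  obj X := ⟨_, _, h.obj X⟩
  map f := ⟨_, h.map f⟩
  map_id _ := DiagHom.ext (diagMap_id _)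
  map_comp _ _ := DiagHom.ext (diagMap_comp _ _ _ _ _)

end Diag

/-! ### The dual diagonal category `Δ_λ` -/

section Dual

variable (k : Type w) [Field k] (V : Type u) [Category.{v} V] [Preadditive V] [Linear k V]
  [DiffCategory k V]

/-- Two `2`-representations `(F₁, τF)` and `(E₂, τ₂)` on `V` and a closed morphism
`λ : F₁E₂ ⟶ E₂F₁` intertwining `τF` and `τ₂`. -/
structure LambdaSetup where
  F₁ : V ⥤ V
  E₂ : V ⥤ V
  τF : F₁ ⋙ F₁ ⟶ F₁ ⋙ F₁
  τ₂ : E₂ ⋙ E₂ ⟶ E₂ ⋙ E₂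
  repF : IsTwoRep k F₁ τF
  rep₂ : IsTwoRep k E₂ τ₂
  lam : E₂ ⋙ F₁ ⟶ F₁ ⋙ E₂
  lam_closed : NatClosed k lam
  commF : ∀ x, F₁.map (lam.app x) ≫ lam.app (F₁.obj x) ≫ E₂.map (τF.app x) =
    τF.app (E₂.obj x) ≫ F₁.map (lam.app x) ≫ lam.app (F₁.obj x)
  comm₂ : ∀ x, lam.app (E₂.obj x) ≫ E₂.map (lam.app x) ≫ τ₂.app (F₁.obj x) =
    F₁.map (τ₂.app x) ≫ lam.app (E₂.obj x) ≫ E₂.map (lam.app x)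

/-- The same together with a right adjoint `E₁` of `F₁` (in the sense of differential categories:
`E₁` is a differential functor, the unit and the counit are closed). -/
structure DualSetup extends LambdaSetup k V where
  E₁ : V ⥤ V
  isDiff₁ : IsDiff k E₁
  adj : F₁ ⊣ E₁
  unit_closed : NatClosed k adj.unit
  counit_closed : NatClosed k adj.counit

variable {k V}

instance (D : LambdaSetup k V) : IsDiff k D.F₁ := D.repF.isDiff

instance (D : LambdaSetup k V) : IsDiff k D.E₂ := D.rep₂.isDiff

instance (D : DualSetup k V) : IsDiff k D.E₁ := D.isDiff₁

section Category

variable (D : LambdaSetup k V)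

/-- The functor `E₂^i F₁^i`. -/
abbrev LambdaSetup.EF (i : ℕ) : V ⥤ V := pow D.F₁ i ⋙ pow D.E₂ i

/-- The morphism `μ_{i,j} = E₂^i λ_{i,j} F₁^j : E₂^i F₁^i E₂^j F₁^j ⟶ E₂^{i+j} F₁^{i+j}`. -/
def LambdaSetup.μ (i j : ℕ) (x : V) : (D.EF i).obj ((D.EF j).obj x) ⟶ (D.EF (j + i)).obj x :=
  (pow D.E₂ i).map (slidePow D.lam i j ((pow D.F₁ j).obj x)) ≫
    powAdd D.E₂ j i ((pow D.F₁ i).obj ((pow D.F₁ j).obj x)) ≫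
    (pow D.E₂ (j + i)).map (powAdd D.F₁ j i x)

/-- The conditions for `(m, (ς_i)_{i ≥ 1})` to be an object of `Δ_λ`; the family is extended by
`ς_0 = 1`. -/
structure IsDualObj (m : V) (ς : ∀ i, (D.EF i).obj m ⟶ m) : Prop where
  zero : ς 0 = 𝟙 m
  closed : ∀ i, 1 ≤ i → d k (ς i) = 0
  mul : ∀ i j, 1 ≤ i → 1 ≤ j → (D.EF i).map (ς j) ≫ ς i = D.μ i j m ≫ ς (j + i)
  equivariant : ∀ i r, r + 1 < i →
    hecke D.τ₂ i r ((pow D.F₁ i).obj m) ≫ ς i = (pow D.E₂ i).map (hecke D.τF i r m) ≫ ς i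

/-- The objects `(m, ς)` of `Δ_λ`. -/
structure DualObj where
  m : V
  ς : ∀ i, (D.EF i).obj m ⟶ m
  isDualObj : IsDualObj D m ς

variable {D}

/-- The condition for `f : m ⟶ m'` to be a morphism `(m, ς) ⟶ (m', ς')` in `Δ_λ`. -/
def IsDualHom {m m' : V} (ς : ∀ i, (D.EF i).obj m ⟶ m) (ς' : ∀ i, (D.EF i).obj m' ⟶ m') (f : m ⟶ m') : Prop :=
  ∀ i, 1 ≤ i → ς i ≫ f = (D.EF i).map f ≫ ς' i

/-- The morphisms of `Δ_λ`. -/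
@[ext]
structure DualHom (X Y : DualObj D) where
  val : X.m ⟶ Y.m
  isDualHom : IsDualHom X.ς Y.ς val

/-- Morphisms as a linear subspace of `Hom(m, m')`. -/
def DualHom.sub (X Y : DualObj D) : Submodule k (X.m ⟶ Y.m) where
  carrier := {f | IsDualHom X.ς Y.ς f}
  add_mem' {f g} hf hg i hi := by
    rw [IsDiff.map_add (k := k) (F := D.EF i), Preadditive.comp_add,
      Preadditive.add_comp, hf i hi, hg i hi]
  zero_mem' i hi := by
    rw [map_zero' k (D.EF i), Limits.comp_zero, Limits.zero_comp]
  smul_mem' a f hf i hi := by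
    rw [IsDiff.map_smul (F := D.EF i), Linear.comp_smul, Linear.smul_comp, hf i hi]

/-- Morphisms as elements of that subspace. -/
def DualHom.equiv (X Y : DualObj D) : DualHom X Y ≃ DualHom.sub X Y where
  toFun f := ⟨f.val, f.isDualHom⟩
  invFun f := ⟨f.1, f.2⟩

instance : Category (DualObj D) where
  Hom X Y := DualHom X Y
  id X := ⟨𝟙 X.m, fun i _ => by
    rw [(D.EF i).map_id, Category.comp_id, Category.id_comp]⟩
  comp {X Y Z} f g := ⟨f.val ≫ g.val, fun i hi => by
    rw [(D.EF i).map_comp, ← Category.assoc, f.isDualHom i hi, Category.assoc,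
      g.isDualHom i hi, Category.assoc]⟩
  id_comp f := DualHom.ext (Category.id_comp _)
  comp_id f := DualHom.ext (Category.comp_id _)
  assoc f g h := DualHom.ext (Category.assoc _ _ _)

instance (X Y : DualObj D) : AddCommGroup (X ⟶ Y) := (DualHom.equiv X Y).addCommGroup

instance : Preadditive (DualObj D) where
  add_comp _ _ _ _ _ _ := DualHom.ext (Preadditive.add_comp _ _ _ _ _ _)
  comp_add _ _ _ _ _ _ := DualHom.ext (Preadditive.comp_add _ _ _ _ _ _)

instance (X Y : DualObj D) : Module k (X ⟶ Y) := (DualHom.equiv X Y).module k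

instance : Linear k (DualObj D) where
  smul_comp _ _ _ _ _ _ := DualHom.ext (Linear.smul_comp _ _ _ _ _ _)
  comp_smul _ _ _ _ _ _ := DualHom.ext (Linear.comp_smul _ _ _ _ _ _)

/-- `Δ_λ` as a differential category, with the differential of `V` on morphisms. -/
instance : DiffCategory k (DualObj D) where
  d {X Y} :=
    { toFun := fun f => ⟨d k f.val, fun i hi => by
        have h := congrArg (fun g => d k g) (f.isDualHom i hi)
        simp only [d_comp, X.isDualObj.closed i hi, Y.isDualObj.closed i hi, Limits.zero_comp,
          Limits.comp_zero, zero_add, add_zero] at h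
        rw [IsDiff.map_d (F := D.EF i), h]⟩
      map_add' := fun f g => DualHom.ext (map_add (d k) f.val g.val)
      map_smul' := fun a f => DualHom.ext (map_smul (d k) a f.val) }
  d_d f := DualHom.ext (d_d k f.val)
  d_comp f g := DualHom.ext (d_comp k f.val g.val)

end Category

namespace DualSetup

variable (D : DualSetup k V)

/-- The endomorphism `τ₁` of `E₁²` corresponding by adjunction to the endomorphism `τF` of
`F₁²`. -/
def τ₁ : D.E₁ ⋙ D.E₁ ⟶ D.E₁ ⋙ D.E₁ :=
  conjugateEquiv (D.adj.comp D.adj) (D.adj.comp D.adj) D.τF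

/-- The morphism
`σ : E₂E₁ ⟶ E₁F₁E₂E₁ ⟶ E₁E₂F₁E₁ ⟶ E₁E₂` given by `E₁E₂ε ∘ E₁λE₁ ∘ ηE₂E₁`. -/
def σ : D.E₁ ⋙ D.E₂ ⟶ D.E₂ ⋙ D.E₁ where
  app x := D.adj.unit.app (D.E₂.obj (D.E₁.obj x)) ≫ D.E₁.map (D.lam.app (D.E₁.obj x)) ≫
    D.E₁.map (D.E₂.map (D.adj.counit.app x))
  naturality x y f := by
    have h1 := D.adj.unit.naturality (D.E₂.map (D.E₁.map f))
    have h2 := D.lam.naturality (D.E₁.map f)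
    have h3 := D.adj.counit.naturality f
    simp only [Functor.comp_obj, Functor.comp_map, Functor.id_obj, Functor.id_map,
      Category.assoc] at h1 h2 h3 ⊢
    rw [← Category.assoc, h1, Category.assoc]
    simp only [← Functor.map_comp]
    rw [← Category.assoc, h2, Category.assoc, ← Functor.map_comp, h3, Functor.map_comp]

/-- The morphism
`ρ : F₁E₁ ⟶ F₁E₁²F₁ ⟶ F₁E₁²F₁ ⟶ E₁F₁` given by `εE₁F₁ ∘ F₁τ₁F₁ ∘ F₁E₁η`. -/
def ρ : D.E₁ ⋙ D.F₁ ⟶ D.F₁ ⋙ D.E₁ where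
  app x := D.F₁.map (D.E₁.map (D.adj.unit.app x)) ≫ D.F₁.map (D.τ₁.app (D.F₁.obj x)) ≫
    D.adj.counit.app (D.E₁.obj (D.F₁.obj x))
  naturality x y f := by
    have h1 := D.adj.unit.naturality f
    have h2 := D.τ₁.naturality (D.F₁.map f)
    have h3 := D.adj.counit.naturality (D.E₁.map (D.F₁.map f))
    simp only [Functor.comp_obj, Functor.comp_map, Functor.id_obj, Functor.id_map,
      Category.assoc] at h1 h2 h3 ⊢
    rw [← h3]
    simp only [← Category.assoc, ← Functor.map_comp]
    rw [h1, Category.assoc (D.E₁.map (D.adj.unit.app x)), ← h2, ← Category.assoc,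
      ← Functor.map_comp]

theorem σ_closed : NatClosed k D.σ := by
  intro x
  exact d_comp_closed k (D.unit_closed _) (d_comp_closed k
    (d_map_closed k D.E₁ (D.lam_closed _))
    (d_map_closed k D.E₁ (d_map_closed k D.E₂ (D.counit_closed _))))

/-- The pairs `(E₁, τ₁)`, `(E₂, τ₂)` and the morphism `σ`. -/
def toSigma : SigmaData k V where
  E₁ := D.E₁
  E₂ := D.E₂
  τ₁ := D.τ₁
  τ₂ := D.τ₂
  σ := D.σ
  isDiff₁ := inferInstance
  isDiff₂ := inferInstance
  σ_closed := D.σ_closed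

/-- The morphism `π(ς) : E₂(m) ⟶ E₂E₁F₁(m) ⟶ E₁E₂F₁(m) ⟶ E₁(m)` given by
`E₁ς₁ ∘ σF₁ ∘ E₂η`. -/
def π {m : V} (ς : ∀ i, (D.EF i).obj m ⟶ m) : D.toSigma.E₂.obj m ⟶ D.toSigma.E₁.obj m :=
  D.E₂.map (D.adj.unit.app m) ≫ D.σ.app (D.F₁.obj m) ≫ D.E₁.map (ς 1)

theorem π_closed {m : V} {ς : ∀ i, (D.EF i).obj m ⟶ m} (h : IsDualObj D.toLambdaSetup m ς) :
    d k (D.π ς) = 0 := by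
  exact d_comp_closed k (d_map_closed k D.E₂ (D.unit_closed m)) (d_comp_closed k (D.σ_closed _)
    (d_map_closed k D.E₁ (h.closed 1 le_rfl)))

/-- The morphism `λ_{(1 ⋯ 2i+1)} : E₂^i F₁^i E₂ ⟶ E₂ E₂^i F₁^i`. -/
def cycle₂ (i : ℕ) (x : V) : (D.EF i).obj (D.E₂.obj x) ⟶ D.E₂.obj ((D.EF i).obj x) :=
  (pow D.E₂ i).map (slide D.lam i x) ≫ slide D.τ₂ i ((pow D.F₁ i).obj x)

/-- The morphism `λ_{(1 ⋯ 2i+1)} : E₂^i F₁^i E₁ ⟶ E₁ E₂^i F₁^i`. -/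
def cycle₁ (i : ℕ) (x : V) : (D.EF i).obj (D.E₁.obj x) ⟶ D.E₁.obj ((D.EF i).obj x) :=
  (pow D.E₂ i).map (slide D.ρ i x) ≫ slide D.σ i ((pow D.F₁ i).obj x)

/-- The entry `(ς'_i)_{12} : E₂^i F₁^i E₁(m) ⟶ E₂(m)`, that is
`∑_{r=1}^i E₂ς_{i-1} ∘ E₂^i F₁^{i-1}ε ∘ λ_{(1 ⋯ r)(2i ⋯ i+r)}`. -/
def stepOffDiag {m : V} (ς : ∀ i, (D.EF i).obj m ⟶ m) :
    (i : ℕ) → ((D.EF i).obj (D.E₁.obj m) ⟶ D.E₂.obj m)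
  | 0 => 0
  | n + 1 => ∑ r ∈ Finset.range (n + 1),
      heckeFront D.τ₂ (n + 1) r ((pow D.F₁ (n + 1)).obj (D.E₁.obj m)) ≫
        (pow D.E₂ (n + 1)).map (heckeBack D.τF (n + 1) r (n - r) (D.E₁.obj m)) ≫
        (pow D.E₂ (n + 1)).map (counitPow D.adj.counit n m) ≫ D.E₂.map (ς n)

/-- For `m' = E₂(m) ⊕ E₁(m)` the cone of `π(ς)`, the morphism `ς'_i : E₂^i F₁^i (m') ⟶ m'` with
matrix
`(E₂ς_i ∘ λ_{(1 ⋯ 2i+1)}, ∑_{r=1}^i E₂ς_{i-1} ∘ E₂^i F₁^{i-1}ε ∘ λ_{(1 ⋯ r)(2i ⋯ i+r)};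
0, E₁ς_i ∘ λ_{(1 ⋯ 2i+1)})`. -/
def stepς {m : V} (ς : ∀ i, (D.EF i).obj m ⟶ m) (c : ConeData k (D.π ς)) (i : ℕ) :
    (D.EF i).obj c.obj ⟶ c.obj :=
  (D.EF i).map c.fst ≫ (D.cycle₂ i m ≫ D.E₂.map (ς i)) ≫ c.inl +
  (D.EF i).map c.snd ≫ D.stepOffDiag ς i ≫ c.inl +
  (D.EF i).map c.snd ≫ (D.cycle₁ i m ≫ D.E₁.map (ς i)) ≫ c.inr

end DualSetup

variable (D : DualSetup k V) [HasCones k V]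

/-- The cone of `π(ς)` for an object `(m, ς)` of `Δ_λ`. -/
abbrev DualSetup.coneOf (X : DualObj D.toLambdaSetup) : ConeData k (D.π X.ς) :=
  DiffRep.coneOf (S := D.toSigma) X.m (D.π X.ς) (D.π_closed X.isDualObj)

/-- The endofunctor `E` of `Δ_λ` is well defined. -/
structure DualStepWellDefined : Prop where
  obj : ∀ X : DualObj D.toLambdaSetup,
    IsDualObj D.toLambdaSetup (D.coneOf X).obj (D.stepς X.ς (D.coneOf X))
  map : ∀ {X Y : DualObj D.toLambdaSetup} (f : X ⟶ Y),
    IsDualHom (D.stepς X.ς (D.coneOf X)) (D.stepς Y.ς (D.coneOf Y))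
      (diagMap (S := D.toSigma) (D.coneOf X) (D.coneOf Y) f.val)

/-- The functor `Γ : Δ_λ ⟶ Δ_σ` is well defined. -/
structure GammaWellDefined : Prop where
  obj : ∀ X : DualObj D.toLambdaSetup, IsDiagObj D.toSigma X.m (D.π X.ς)
  map : ∀ {X Y : DualObj D.toLambdaSetup} (f : X ⟶ Y), IsDiagHom (D.π X.ς) (D.π Y.ς) f.val

variable {D}

/-- The endofunctor `E` of `Δ_λ`: on objects `E(m, ς) = (m', ς')`, where `m'` is the cone of
`π(ς)`, and on morphisms `E(f) = (E₂(f), E₁(f))`. -/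
def dualStep (h : DualStepWellDefined D) : DualObj D.toLambdaSetup ⥤ DualObj D.toLambdaSetup where
  obj X := ⟨_, _, h.obj X⟩
  map f := ⟨_, h.map f⟩
  map_id _ := DualHom.ext (diagMap_id (S := D.toSigma) _)
  map_comp _ _ := DualHom.ext (diagMap_comp (S := D.toSigma) _ _ _ _ _)

/-- The functor `Γ : Δ_λ ⟶ Δ_σ`: on objects `Γ(m, ς) = (m, π(ς))`, and the identity on
morphisms. -/
def gamma (h : GammaWellDefined D) : DualObj D.toLambdaSetup ⥤ DiagObj D.toSigma where
  obj X := ⟨X.m, D.π X.ς, h.obj X⟩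
  map f := ⟨f.val, h.map f⟩
  map_id _ := rfl
  map_comp _ _ := rfl

end Dual

/-! ### Extension of the data to the completion -/

section ExtendSetup

variable {k : Type w} [Field k] [CharP k 2] {V : Type u} [Category.{v} V] [Preadditive V]
  [Linear k V] [DiffCategory k V]

/-- The extension of `(F₁, τF)`, `(E₂, τ₂)` and `λ` to the idempotent completion of the category
of twisted objects. -/
def LambdaSetup.extend (D : LambdaSetup k V) : LambdaSetup k (Perf k V) where
  F₁ := Perf.functor k D.F₁
  E₂ := Perf.functor k D.E₂
  τF := Perf.nat k D.τF
  τ₂ := Perf.nat k D.τ₂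
  repF := Perf.isTwoRep k D.repF
  rep₂ := Perf.isTwoRep k D.rep₂
  lam := Perf.nat k D.lam
  lam_closed := Perf.nat_closed k D.lam_closed
  commF X := by
    ext : 1
    let a : D.E₂ ⋙ D.F₁ ⋙ D.F₁ ⟶ D.F₁ ⋙ D.E₂ ⋙ D.F₁ := Functor.whiskerRight D.lam D.F₁
    let b : D.F₁ ⋙ D.E₂ ⋙ D.F₁ ⟶ D.F₁ ⋙ D.F₁ ⋙ D.E₂ := Functor.whiskerLeft D.F₁ D.lam
    let c : D.F₁ ⋙ D.F₁ ⋙ D.E₂ ⟶ D.F₁ ⋙ D.F₁ ⋙ D.E₂ := Functor.whiskerRight D.τF D.E₂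
    let e : D.E₂ ⋙ D.F₁ ⋙ D.F₁ ⟶ D.E₂ ⋙ D.F₁ ⋙ D.F₁ := Functor.whiskerLeft D.E₂ D.τF
    have h : a ≫ b ≫ c = e ≫ a ≫ b := by
      ext x
      exact D.commF x
    have key : matTr a X.p ≫ matTr b X.p ≫ matTr c X.p =
        matTr e X.p ≫ matTr a X.p ≫ matTr b X.p := by
      simp only [matTr_comp k, X.idem, h]
    have e1 : matMap D.F₁ (matTr D.lam X.p) = matTr a X.p := by
      refine Mat_.hom_ext _ _ fun (i : X.mat.ι) (j : X.mat.ι) => ?_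
      exact D.F₁.map_comp _ _
    have e2 : matMap D.E₂ (matTr D.τF X.p) = matTr c X.p := by
      refine Mat_.hom_ext _ _ fun (i : X.mat.ι) (j : X.mat.ι) => ?_
      exact D.E₂.map_comp _ _
    rw [← e1, ← e2] at key
    exact key
  comm₂ X := by
    ext : 1
    let a : D.E₂ ⋙ D.E₂ ⋙ D.F₁ ⟶ D.E₂ ⋙ D.F₁ ⋙ D.E₂ := Functor.whiskerLeft D.E₂ D.lam
    let b : D.E₂ ⋙ D.F₁ ⋙ D.E₂ ⟶ D.F₁ ⋙ D.E₂ ⋙ D.E₂ := Functor.whiskerRight D.lam D.E₂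
    let c : D.F₁ ⋙ D.E₂ ⋙ D.E₂ ⟶ D.F₁ ⋙ D.E₂ ⋙ D.E₂ := Functor.whiskerLeft D.F₁ D.τ₂
    let e : D.E₂ ⋙ D.E₂ ⋙ D.F₁ ⟶ D.E₂ ⋙ D.E₂ ⋙ D.F₁ := Functor.whiskerRight D.τ₂ D.F₁
    have h : a ≫ b ≫ c = e ≫ a ≫ b := by
      ext x
      exact D.comm₂ x
    have key : matTr a X.p ≫ matTr b X.p ≫ matTr c X.p =
        matTr e X.p ≫ matTr a X.p ≫ matTr b X.p := by
      simp only [matTr_comp k, X.idem, h]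
    have e1 : matMap D.E₂ (matTr D.lam X.p) = matTr b X.p := by
      refine Mat_.hom_ext _ _ fun (i : X.mat.ι) (j : X.mat.ι) => ?_
      exact D.E₂.map_comp _ _
    have e2 : matMap D.F₁ (matTr D.τ₂ X.p) = matTr e X.p := by
      refine Mat_.hom_ext _ _ fun (i : X.mat.ι) (j : X.mat.ι) => ?_
      exact D.F₁.map_comp _ _
    rw [← e1, ← e2] at key
    exact key

/-- The extension of an adjunction between differential functors. -/
def Perf.adj {F E : V ⥤ V} [IsDiff k F] [IsDiff k E] (adj : F ⊣ E) :
    Perf.functor k F ⊣ Perf.functor k E where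
  unit := (Perf.nat k adj.unit : Perf.functor k (𝟭 V) ⟶ Perf.functor k (F ⋙ E))
  counit := (Perf.nat k adj.counit : Perf.functor k (E ⋙ F) ⟶ Perf.functor k (𝟭 V))
  left_triangle_components X := by
    ext : 1
    let a : F ⟶ F ⋙ E ⋙ F := Functor.whiskerRight adj.unit F
    let b : F ⋙ E ⋙ F ⟶ F := Functor.whiskerLeft F adj.counit
    have h : a ≫ b = 𝟙 F := by
      ext x
      exact adj.left_triangle_components x
    have key : matTr a X.p ≫ matTr b X.p = matMap F X.p := by
      rw [matTr_comp k, X.idem, h, matTr_id]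
    have e1 : matMap F (matTr adj.unit X.p) = matTr a X.p := by
      refine Mat_.hom_ext _ _ fun (i : X.mat.ι) (j : X.mat.ι) => ?_
      exact F.map_comp _ _
    rw [← e1] at key
    exact key
  right_triangle_components X := by
    ext : 1
    let a : E ⟶ E ⋙ F ⋙ E := Functor.whiskerLeft E adj.unit
    let b : E ⋙ F ⋙ E ⟶ E := Functor.whiskerRight adj.counit E
    have h : a ≫ b = 𝟙 E := by
      ext x
      exact adj.right_triangle_components x
    have key : matTr a X.p ≫ matTr b X.p = matMap E X.p := by
      rw [matTr_comp k, X.idem, h, matTr_id]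
    have e1 : matMap E (matTr adj.counit X.p) = matTr b X.p := by
      refine Mat_.hom_ext _ _ fun (i : X.mat.ι) (j : X.mat.ι) => ?_
      exact E.map_comp _ _
    rw [← e1] at key
    exact key

/-- The extension of the data with a right adjoint. -/
def DualSetup.extend (D : DualSetup k V) : DualSetup k (Perf k V) where
  toLambdaSetup := D.toLambdaSetup.extend
  E₁ := Perf.functor k D.E₁
  isDiff₁ := inferInstance
  adj := Perf.adj D.adj
  unit_closed := Perf.nat_closed k D.unit_closed
  counit_closed := Perf.nat_closed k D.counit_closed

/-- The morphism `σ` of the extended data is the extension of the morphism `σ`. -/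
theorem DualSetup.extend_σ (D : DualSetup k V) :
    D.extend.σ = (Perf.nat k D.σ : Perf.functor k D.E₁ ⋙ Perf.functor k D.E₂ ⟶
      Perf.functor k D.E₂ ⋙ Perf.functor k D.E₁) := by
  ext X : 3
  let a : D.E₁ ⋙ D.E₂ ⟶ D.E₁ ⋙ D.E₂ ⋙ D.F₁ ⋙ D.E₁ :=
    Functor.whiskerLeft (D.E₁ ⋙ D.E₂) D.adj.unit
  let b : D.E₁ ⋙ D.E₂ ⋙ D.F₁ ⋙ D.E₁ ⟶ D.E₁ ⋙ D.F₁ ⋙ D.E₂ ⋙ D.E₁ :=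
    Functor.whiskerLeft D.E₁ (Functor.whiskerRight D.lam D.E₁)
  let c : D.E₁ ⋙ D.F₁ ⋙ D.E₂ ⋙ D.E₁ ⟶ D.E₂ ⋙ D.E₁ :=
    Functor.whiskerRight D.adj.counit (D.E₂ ⋙ D.E₁)
  have h : a ≫ b ≫ c = D.σ := by
    ext x
    rfl
  have key : matTr a X.p ≫ matTr b X.p ≫ matTr c X.p = matTr D.σ X.p := by
    simp only [matTr_comp k, X.idem, h]
  have e1 : matMap D.E₁ (matTr D.lam (matMap D.E₁ X.p)) = matTr b X.p := by
    refine Mat_.hom_ext _ _ fun (i : X.mat.ι) (j : X.mat.ι) => ?_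
    exact D.E₁.map_comp _ _
  have e2 : matMap D.E₁ (matMap D.E₂ (matTr D.adj.counit X.p)) = matTr c X.p := by
    refine Mat_.hom_ext _ _ fun (i : X.mat.ι) (j : X.mat.ι) => ?_
    exact (congrArg D.E₁.map (D.E₂.map_comp _ _)).trans (D.E₁.map_comp _ _)
  rw [← e1, ← e2] at key
  exact key

theorem Perf.nat_isIso {G H : V ⥤ V} [IsDiff k G] [IsDiff k H] (α : G ⟶ H) [IsIso α]
    (X : Perf k V) : IsIso ((Perf.nat k α).app X) := by
  refine ⟨(Perf.nat k (inv α)).app X, ?_, ?_⟩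
  · ext : 1
    show matTr α X.p ≫ matTr (inv α) X.p = matMap G X.p
    rw [matTr_comp k, X.idem, IsIso.hom_inv_id, matTr_id]
  · ext : 1
    show matTr (inv α) X.p ≫ matTr α X.p = matMap H X.p
    rw [matTr_comp k, X.idem, IsIso.inv_hom_id, matTr_id]

instance (D : DualSetup k V) [IsIso D.σ] (X : Perf k V) :
    IsIso (D.extend.toSigma.σ.app X) := by
  have h : D.extend.toSigma.σ = (Perf.nat k D.σ : Perf.functor k D.E₁ ⋙ Perf.functor k D.E₂ ⟶
      Perf.functor k D.E₂ ⋙ Perf.functor k D.E₁) := D.extend_σ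
  rw [h]
  exact Perf.nat_isIso D.σ X

end ExtendSetup

end

end DiffRep

open DiffRep

namespace DiffRep

attribute [reducible] pow

universe w v u v' u'

/-! ### Iterates of an endofunctor -/

section Iterates

variable {V : Type u} [Category.{v} V]

/-! All maps are read as strand diagrams: letters of a word are strands, and position 0 is the
leftmost (outermost) letter. `hecke` is a crossing, `slide` and `slidePow` carry a strand or a block
through a block, and `heckeCounit` contracts an `F₁`-strand with an `E₁` on the right.

Transposition. A morphism into `E₁` is determined by its transpose under `F₁ ⊣ E₁` (`adj_hom_ext`).
Up to counits, the transposes of `σ`, `τ₁`, `ρ` and `π(ς)` are `λ`, `τF`, `τF` and `ς₁ ∘ λ`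
(`σ_counit`, `τ₁_counit`, `ρ_counit`, `π_counit`). Hence part (0), and all Yang–Baxter relations
involving `E₁`, come from the relations assumed for `τF`, `τ₂` and `λ`.

The object `E(m, ς)`. Every entry of `ς'_i` carries the word `E₂^i F₁^i` past a letter and then
applies `ς`. On the diagonal (entries `a` on `E₂`, `b` on `E₁`) the word keeps its length. The
off-diagonal entry `c` sums over `r`: the `r`-th `E₂` is pulled to the front while the `r`-th `F₁`
is contracted with `E₁`. Multiplicativity holds because one of `i + j` strands lies in exactly one
of the two blocks (`wordMul_stepOffDiag`). Equivariance holds because `T_s` permutes the summands by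
a transposition, up to summands killed by `T_s² = 0` (`hecke_offTerm`). For closedness, `d` of a
product of crossings is the sum of the products with one crossing omitted. Since `ς` trades
crossings of `E₂` for crossings of `F₁`, this yields `d a = c ∘ E₂^i F₁^i π`, `d b = π ∘ c`, `d c =
0` and `π ∘ a = b ∘ E₂^i F₁^i π`, which is closedness of `ς'` for the differential twisted by `π`
(`coneς_closed`).

The operator `τ`. A morphism out of the double cone is determined by four columns. Naturality, `τ² =
0` and the braid relation hold for arbitrary cones. `d(τ) = 1` needs the second cone to be that of
`π'`, whose entry `σ` meets the entry `σ⁻¹` of `τ`. Compatibility of `τ` with the action reduces, in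
the column of `E₁²`, to an identity of double sums over pairs of strands
(`offSlide_offSlide_cross`).

Comparison. `dualπ_coneς` says `π(ς') = π'`; so `d(τ) = 1` also holds on `Δ_λ`, and `Γ` commutes
with the two endofunctors. Images of idempotents and cones in `Δ_λ` are inherited from the ambient
category: the action restricts to a retract and acts diagonally on a cone. -/

@[simp] theorem pow_obj_zero (E : V ⥤ V) (x : V) : (pow E 0).obj x = x := rfl

@[simp] theorem pow_obj_succ (E : V ⥤ V) (n : ℕ) (x : V) :
    (pow E (n + 1)).obj x = E.obj ((pow E n).obj x) := rfl

@[simp] theorem pow_map_zero (E : V ⥤ V) {x y : V} (f : x ⟶ y) : (pow E 0).map f = f := rfl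

@[simp] theorem pow_map_succ (E : V ⥤ V) (n : ℕ) {x y : V} (f : x ⟶ y) :
    (pow E (n + 1)).map f = E.map ((pow E n).map f) := rfl

/-- Naturality of a transformation between composites of two functors. -/
theorem cross_nat {A G H K : V ⥤ V} (s : G ⋙ A ⟶ H ⋙ K) {x y : V} (f : x ⟶ y) :
    A.map (G.map f) ≫ s.app y = s.app x ≫ K.map (H.map f) := s.naturality f

theorem counit_nat {F E : V ⥤ V} (ε : E ⋙ F ⟶ 𝟭 V) {x y : V} (f : x ⟶ y) :
    F.map (E.map f) ≫ ε.app y = ε.app x ≫ f := ε.naturality f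

/-! ### Nil Hecke operators on iterates -/

section Hecke

variable {E : V ⥤ V} (τ : E ⋙ E ⟶ E ⋙ E)

theorem hecke_one (r : ℕ) (x : V) : hecke τ 1 r x = 𝟙 _ := by
  cases r <;> rfl

theorem hecke_first (n : ℕ) (x : V) : hecke τ (n + 2) 0 x = τ.app ((pow E n).obj x) := rfl

/-- No bound on `r` is needed: out of range both sides are identities, by the default value of
`hecke`. -/
theorem hecke_succ (n r : ℕ) (x : V) : hecke τ (n + 1) (r + 1) x = E.map (hecke τ n r x) := by
  cases n with
  | zero => exact (E.map_id _).symm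
  | succ n => rfl

theorem hecke_nat (n r : ℕ) {x y : V} (f : x ⟶ y) :
    (pow E n).map f ≫ hecke τ n r y = hecke τ n r x ≫ (pow E n).map f := by
  induction n generalizing r with
  | zero => simp [hecke]
  | succ n ih =>
    cases r with
    | zero =>
      cases n with
      | zero => simp [hecke_one]
      | succ n => exact cross_nat τ _
    | succ r =>
      have h := congrArg E.map (ih r)
      rw [hecke_succ, hecke_succ]
      simpa using h

theorem heckeFront_one (r : ℕ) (x : V) : heckeFront τ 1 r x = 𝟙 _ := by
  induction r with
  | zero => rfl
  | succ r ih => rw [heckeFront, ih, hecke_one, Category.comp_id]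

/-- The strand is first brought to position 1 and crosses the leftmost strand last. This recursion
on the leftmost letter drives most of the inductions below. -/
theorem heckeFront_succ (n r : ℕ) (x : V) :
    heckeFront τ (n + 2) (r + 1) x =
      E.map (heckeFront τ (n + 1) r x) ≫ τ.app ((pow E n).obj x) := by
  induction r with
  | zero =>
    refine (Category.comp_id _).trans ?_
    refine (Category.id_comp _).symm.trans ?_
    exact congrArg (· ≫ τ.app ((pow E n).obj x)) (E.map_id _).symm
  | succ r ih =>
    rw [heckeFront, ih, hecke_succ, heckeFront]
    dsimp
    rw [E.map_comp, Category.assoc]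

theorem heckeFront_nat (n r : ℕ) {x y : V} (f : x ⟶ y) :
    (pow E n).map f ≫ heckeFront τ n r y = heckeFront τ n r x ≫ (pow E n).map f := by
  induction r with
  | zero => exact (Category.comp_id _).trans (Category.id_comp _).symm
  | succ r ih =>
    rw [heckeFront, heckeFront, ← Category.assoc, hecke_nat, Category.assoc, ih, Category.assoc]

/-- `T_{r+l} ≫ ⋯ ≫ T_{r+1}` on `Eⁿ(x)`, the operator opposite to `heckeBack`. -/
def heckeDown (τ : E ⋙ E ⟶ E ⋙ E) (n r : ℕ) : (l : ℕ) → (x : V) →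
    ((pow E n).obj x ⟶ (pow E n).obj x)
  | 0, _ => 𝟙 _
  | l + 1, x => hecke τ n (r + l) x ≫ heckeDown τ n r l x

theorem heckeBack_snoc (n r l : ℕ) (x : V) :
    heckeBack τ n r (l + 1) x = heckeBack τ n r l x ≫ hecke τ n (r + l) x := by
  induction l generalizing r with
  | zero => exact (Category.comp_id _).trans (Category.id_comp _).symm
  | succ l ih =>
    rw [heckeBack, ih (r + 1), heckeBack, Category.assoc, show r + 1 + l = r + (l + 1) by omega]

theorem heckeBack_succ (n r l : ℕ) (x : V) :
    heckeBack τ (n + 1) (r + 1) l x = E.map (heckeBack τ n r l x) := by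
  induction l generalizing r with
  | zero => exact (E.map_id _).symm
  | succ l ih => rw [heckeBack, heckeBack, E.map_comp, ← ih, hecke_succ]

/-- A nil Hecke operator to the right of the strand pulled to the front. -/
theorem hecke_heckeFront_right {r s : ℕ} (h : r ≤ s) (n : ℕ) (x : V) :
    hecke τ (n + 1) (s + 1) x ≫ heckeFront τ (n + 1) r x =
      heckeFront τ (n + 1) r x ≫ E.map (hecke τ n s x) := by
  induction r generalizing n s with
  | zero =>
    rw [hecke_succ]
    exact (Category.comp_id _).trans (Category.id_comp _).symm
  | succ r ih =>
    obtain ⟨s, rfl⟩ : ∃ t, s = t + 1 := ⟨s - 1, by omega⟩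
    cases n with
    | zero =>
      rw [heckeFront_one, hecke_one]
      exact congrArg (𝟙 _ ≫ ·) (E.map_id _).symm
    | succ n =>
      have h1 := congrArg E.map (ih (s := s) (by omega) n)
      -- The two crossings share no strand, so they commute by naturality of `τ`.
      have h2 := cross_nat τ (hecke τ n s x)
      rw [hecke_succ] at h1
      rw [hecke_succ, hecke_succ, heckeFront_succ]
      dsimp at *
      simp only [Functor.map_comp, Category.assoc] at *
      rw [reassoc_of% h1, h2]

variable {τ}

/-- A nil Hecke operator to the left of the strand pulled to the front. -/
theorem hecke_heckeFront_left
    (hb : ∀ x, E.map (τ.app x) ≫ τ.app (E.obj x) ≫ E.map (τ.app x) =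
      τ.app (E.obj x) ≫ E.map (τ.app x) ≫ τ.app (E.obj x))
    {r s : ℕ} (h : s + 2 ≤ r) (n : ℕ) (hn : r ≤ n) (x : V) :
    hecke τ (n + 1) s x ≫ heckeFront τ (n + 1) r x =
      heckeFront τ (n + 1) r x ≫ E.map (hecke τ n s x) := by
  obtain ⟨n, rfl⟩ : ∃ t, n = t + 2 := ⟨n - 2, by omega⟩
  induction s generalizing n r with
  | zero =>
    obtain ⟨r, rfl⟩ : ∃ t, r = t + 2 := ⟨r - 2, by omega⟩
    have h1 := cross_nat τ (heckeFront τ (n + 1) r x)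
    -- The braid relation is needed only here, where the pulled strand crosses the two strands of
    -- `T_s`; the other crossings pass by naturality.
    have h2 := hb ((pow E n).obj x)
    rw [hecke_first, hecke_first, heckeFront_succ, heckeFront_succ]
    dsimp at *
    simp only [Functor.map_comp, Category.assoc]
    rw [h2, ← reassoc_of% h1]
  | succ s ih =>
    obtain ⟨r, rfl⟩ : ∃ t, r = t + 1 := ⟨r - 1, by omega⟩
    rw [hecke_succ, hecke_succ, heckeFront_succ]
    cases n with
    | zero => omega
    | succ n =>
      have h1 := congrArg E.map (ih (r := r) (by omega) n (by omega))
      have h2 := cross_nat τ (hecke τ (n + 2) s x)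
      dsimp at *
      simp only [Functor.map_comp, Category.assoc] at *
      rw [reassoc_of% h1, h2]

/-- Two strands pulled to the front one after the other and then crossed. -/
theorem heckeFront_heckeFront_cross
    (hb : ∀ x, E.map (τ.app x) ≫ τ.app (E.obj x) ≫ E.map (τ.app x) =
      τ.app (E.obj x) ≫ E.map (τ.app x) ≫ τ.app (E.obj x))
    {r s : ℕ} (h : r ≤ s) (n : ℕ) (hn : s ≤ n) (x : V) :
    heckeFront τ (n + 2) r x ≫ E.map (heckeFront τ (n + 1) s x) ≫ τ.app ((pow E n).obj x) =
      heckeFront τ (n + 2) (s + 1) x ≫ E.map (heckeFront τ (n + 1) r x) := by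
  rw [heckeFront_succ]
  induction r generalizing n s with
  | zero =>
    refine (Category.id_comp _).trans ?_
    rw [heckeFront, E.map_id]
    exact (Category.comp_id _).symm
  | succ r ih =>
    obtain ⟨s, rfl⟩ : ∃ t, s = t + 1 := ⟨s - 1, by omega⟩
    obtain ⟨n, rfl⟩ : ∃ t, n = t + 1 := ⟨n - 1, by omega⟩
    have h1 := congrArg E.map (ih (s := s) (by omega) n (by omega))
    have h2 := cross_nat τ (heckeFront τ (n + 1) s x)
    have h3 := cross_nat τ (heckeFront τ (n + 1) r x)
    have h4 := hb ((pow E n).obj x)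
    rw [heckeFront_succ, heckeFront_succ, heckeFront_succ]
    dsimp at *
    simp only [Functor.map_comp, Category.assoc] at *
    rw [← reassoc_of% h2, ← h4, reassoc_of% h1, reassoc_of% h3]

end Hecke

end Iterates

section Slides

variable {V : Type u} [Category.{v} V]

/-! ### Moving a functor past an iterate -/

variable {A G H : V ⥤ V} (s : G ⋙ A ⟶ A ⋙ G)

theorem slide_nat (n : ℕ) {x y : V} (f : x ⟶ y) :
    (pow A n).map (G.map f) ≫ slide s n y = slide s n x ≫ G.map ((pow A n).map f) := by
  induction n with
  | zero => exact (Category.comp_id _).trans (Category.id_comp _).symm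
  | succ n ih =>
    have h1 := congrArg A.map ih
    have h2 := cross_nat s ((pow A n).map f)
    simp only [slide, Functor.map_comp] at *
    dsimp at *
    rw [reassoc_of% h1, h2, Category.assoc]

variable {s} in
-- A crossing of two adjacent strands of the block passes through `G` by `h`; the strands to its
-- left and right are handled by naturality.
theorem hecke_slide {τ : A ⋙ A ⟶ A ⋙ A}
    (h : ∀ x, A.map (s.app x) ≫ s.app (A.obj x) ≫ G.map (τ.app x) =
      τ.app (G.obj x) ≫ A.map (s.app x) ≫ s.app (A.obj x)) (n r : ℕ) (x : V) :
    hecke τ n r (G.obj x) ≫ slide s n x = slide s n x ≫ G.map (hecke τ n r x) := by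
  induction n generalizing r with
  | zero => simp [hecke]
  | succ n ih =>
    cases r with
    | succ r =>
      have h1 := congrArg A.map (ih r)
      have h2 := cross_nat s (hecke τ n r x)
      rw [hecke_succ, hecke_succ, slide]
      dsimp at *
      simp only [Functor.map_comp, Category.assoc] at *
      rw [reassoc_of% h1, h2]
    | zero =>
      cases n with
      | zero => simp [hecke_one]
      | succ n =>
        have h1 := h ((pow A n).obj x)
        have h2 := cross_nat τ (slide s n x)
        rw [hecke_first, hecke_first, slide, slide]
        dsimp at *
        simp only [Functor.map_comp, Category.assoc] at *
        rw [h1, ← reassoc_of% h2]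

variable {s} in
theorem heckeFront_slide {τ : A ⋙ A ⟶ A ⋙ A}
    (h : ∀ x, A.map (s.app x) ≫ s.app (A.obj x) ≫ G.map (τ.app x) =
      τ.app (G.obj x) ≫ A.map (s.app x) ≫ s.app (A.obj x)) (n r : ℕ) (x : V) :
    heckeFront τ n r (G.obj x) ≫ slide s n x = slide s n x ≫ G.map (heckeFront τ n r x) := by
  induction r with
  | zero => simp [heckeFront]
  | succ r ih =>
    rw [heckeFront, heckeFront, Category.assoc, ih, reassoc_of% hecke_slide h n r x, G.map_comp]

/-- Compatibility of the slides past `G` and `H` with a transformation `t : G H ⟶ H G`. -/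
theorem slide_cross {s : G ⋙ A ⟶ A ⋙ G} {s' : H ⋙ A ⟶ A ⋙ H} {t : H ⋙ G ⟶ G ⋙ H}
    (h : ∀ x, A.map (t.app x) ≫ s'.app (G.obj x) ≫ H.map (s.app x) =
      s.app (H.obj x) ≫ G.map (s'.app x) ≫ t.app (A.obj x)) (n : ℕ) (x : V) :
    (pow A n).map (t.app x) ≫ slide s' n (G.obj x) ≫ H.map (slide s n x) =
      slide s n (H.obj x) ≫ G.map (slide s' n x) ≫ t.app ((pow A n).obj x) := by
  induction n with
  | zero => simp [slide]
  | succ n ih =>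
    have h1 := congrArg A.map ih
    have h2 := h ((pow A n).obj x)
    have h3 := cross_nat s' (slide s n x)
    have h4 := cross_nat s (slide s' n x)
    simp only [slide]
    dsimp at *
    simp only [Functor.map_comp, Category.assoc] at *
    rw [← reassoc_of% h3, reassoc_of% h1, h2, reassoc_of% h4]

theorem slidePow_zero_left (j : ℕ) (x : V) : slidePow s 0 j x = 𝟙 _ := by
  induction j with
  | zero => rfl
  | succ j ih =>
    rw [slidePow, ih, slide]
    exact (Category.id_comp _).trans (G.map_id _)

theorem slidePow_nat (i j : ℕ) {x y : V} (f : x ⟶ y) :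
    (pow A i).map ((pow G j).map f) ≫ slidePow s i j y =
      slidePow s i j x ≫ (pow G j).map ((pow A i).map f) := by
  induction j with
  | zero => exact (Category.comp_id _).trans (Category.id_comp _).symm
  | succ j ih =>
    have h1 := congrArg G.map ih
    have h2 := slide_nat s i ((pow G j).map f)
    simp only [slidePow]
    dsimp at *
    simp only [Functor.map_comp, Category.assoc] at *
    rw [reassoc_of% h2, h1]

variable {s}

/-- Here the crossing belongs to the block that is crossed, not to the moving one. `slide_cross`
extends `h` from one strand `A` to `A^i`. -/
theorem slidePow_hecke {τ : G ⋙ G ⟶ G ⋙ G}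
    (h : ∀ x, A.map (τ.app x) ≫ s.app (G.obj x) ≫ G.map (s.app x) =
      s.app (G.obj x) ≫ G.map (s.app x) ≫ τ.app (A.obj x)) (i j r : ℕ) (x : V) :
    (pow A i).map (hecke τ j r x) ≫ slidePow s i j x =
      slidePow s i j x ≫ hecke τ j r ((pow A i).obj x) := by
  induction j generalizing r with
  | zero => simp [hecke]
  | succ j ih =>
    cases r with
    | succ r =>
      have h1 := congrArg G.map (ih r)
      have h2 := slide_nat s i (hecke τ j r x)
      simp only [slidePow, hecke_succ]
      dsimp at *
      simp only [Functor.map_comp, Category.assoc] at *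
      rw [reassoc_of% h2, h1]
    | zero =>
      cases j with
      | zero => simp [hecke_one]
      | succ j =>
        have h1 := slide_cross h i ((pow G j).obj x)
        have h2 := cross_nat τ (slidePow s i j x)
        rw [hecke_first, hecke_first]
        simp only [slidePow]
        dsimp at *
        simp only [Functor.map_comp, Category.assoc] at *
        rw [reassoc_of% h1, h2]

theorem slidePow_heckeFront {τ : G ⋙ G ⟶ G ⋙ G}
    (h : ∀ x, A.map (τ.app x) ≫ s.app (G.obj x) ≫ G.map (s.app x) =
      s.app (G.obj x) ≫ G.map (s.app x) ≫ τ.app (A.obj x)) (i j r : ℕ) (x : V) :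
    (pow A i).map (heckeFront τ j r x) ≫ slidePow s i j x =
      slidePow s i j x ≫ heckeFront τ j r ((pow A i).obj x) := by
  induction r with
  | zero => simp [heckeFront]
  | succ r ih =>
    rw [heckeFront, heckeFront, Functor.map_comp, Category.assoc, ih,
      reassoc_of% slidePow_hecke h i j r x]

/-- Moving `F^i A^j` past `G`, before or after moving `F^i` past `A^j`. -/
theorem slidePow_slide {F A G : V ⥤ V} {l : A ⋙ F ⟶ F ⋙ A} {sA : G ⋙ A ⟶ A ⋙ G}
    {sF : G ⋙ F ⟶ F ⋙ G}
    (h : ∀ x, F.map (sA.app x) ≫ sF.app (A.obj x) ≫ G.map (l.app x) =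
      l.app (G.obj x) ≫ A.map (sF.app x) ≫ sA.app (F.obj x)) (i j : ℕ) (x : V) :
    (pow F i).map (slide sA j x) ≫ slide sF i ((pow A j).obj x) ≫ G.map (slidePow l i j x) =
      slidePow l i j (G.obj x) ≫ (pow A j).map (slide sF i x) ≫ slide sA j ((pow F i).obj x) := by
  induction j with
  | zero => simp [slidePow, slide]
  | succ j ih =>
    have h1 := congrArg A.map ih
    have h2 := slide_nat l i (slide sA j x)
    -- The Yang–Baxter relation `h`, already extended to the whole block `F^i`, is applied to the
    -- leftmost `A`.
    have h3 := slide_cross h i ((pow A j).obj x)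
    have h4 := cross_nat sA (slidePow l i j x)
    simp only [slide, slidePow]
    dsimp at *
    simp only [Functor.map_comp, Category.assoc] at *
    rw [reassoc_of% h3, reassoc_of% h2, ← h4, reassoc_of% h1]

/-! ### Concatenation of iterates -/

/-- The identification of iterates with equal exponents. -/
def powCast (E : V ⥤ V) {a b : ℕ} (h : a = b) (x : V) : (pow E a).obj x ⟶ (pow E b).obj x :=
  eqToHom (by rw [h])

/-- The identification `E^i E^j = E^n` for `j + i = n`. -/
def powConcat (E : V ⥤ V) (i j n : ℕ) (h : j + i = n) (x : V) :
    (pow E i).obj ((pow E j).obj x) ⟶ (pow E n).obj x :=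
  powAdd E j i x ≫ powCast E h x

theorem powConcat_zero_left (E : V ⥤ V) (j : ℕ) (h : j + 0 = j) (x : V) :
    powConcat E 0 j j h x = 𝟙 _ := by
  simp [powConcat, powAdd, powCast]

theorem powConcat_succ_left (E : V ⥤ V) (i j n : ℕ) (h : j + (i + 1) = n + 1) (x : V) :
    powConcat E (i + 1) j (n + 1) h x = E.map (powConcat E i j n (by omega) x) := by
  obtain rfl : n = j + i := by omega
  simp only [powConcat, powAdd, powCast, Functor.map_comp, eqToHom_refl]
  dsimp
  rw [E.map_id]

theorem powConcat_zero_right (E : V ⥤ V) (i : ℕ) (h : 0 + i = i) (x : V) :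
    powConcat E i 0 i h x = 𝟙 _ := by
  induction i with
  | zero => exact powConcat_zero_left E 0 h x
  | succ i ih =>
    rw [powConcat_succ_left, ih (by omega)]
    exact E.map_id _

theorem powConcat_nat (E : V ⥤ V) (i j n : ℕ) (h : j + i = n) {x y : V} (f : x ⟶ y) :
    (pow E i).map ((pow E j).map f) ≫ powConcat E i j n h y =
      powConcat E i j n h x ≫ (pow E n).map f := by
  induction i generalizing n with
  | zero =>
    obtain rfl : j = n := by omega
    simp [powConcat_zero_left]
  | succ i ih =>
    obtain ⟨n, rfl⟩ : ∃ t, n = t + 1 := ⟨n - 1, by omega⟩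
    have h1 := congrArg E.map (ih n (by omega))
    simp only [powConcat_succ_left]
    dsimp at *
    simpa using h1

/-- The bound matters: for `i ≤ r + 1` the operator on `E^i` is the default identity, while the one
on `E^n` may be a genuine crossing. -/
theorem hecke_powConcat_left {E : V ⥤ V} (τ : E ⋙ E ⟶ E ⋙ E) (i j n r : ℕ) (h : j + i = n)
    (hr : r + 1 < i) (x : V) :
    hecke τ i r ((pow E j).obj x) ≫ powConcat E i j n h x =
      powConcat E i j n h x ≫ hecke τ n r x := by
  induction i generalizing n r with
  | zero => omega
  | succ i ih =>
    obtain ⟨n, rfl⟩ : ∃ t, n = t + 1 := ⟨n - 1, by omega⟩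
    cases r with
    | succ r =>
      have h1 := congrArg E.map (ih n r (by omega) (by omega))
      rw [powConcat_succ_left, hecke_succ, hecke_succ]
      dsimp at *
      simpa using h1
    | zero =>
      obtain ⟨i, rfl⟩ : ∃ t, i = t + 1 := ⟨i - 1, by omega⟩
      obtain ⟨n, rfl⟩ : ∃ t, n = t + 1 := ⟨n - 1, by omega⟩
      simp only [powConcat_succ_left, hecke_first]
      exact (cross_nat τ _).symm

/-- A strand of the left block reaches the front without meeting the right block. -/
theorem heckeFront_powConcat_left {E : V ⥤ V} (τ : E ⋙ E ⟶ E ⋙ E) (i j n r : ℕ)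
    (h : j + (i + 1) = n + 1) (hr : r ≤ i) (x : V) :
    heckeFront τ (i + 1) r ((pow E j).obj x) ≫ E.map (powConcat E i j n (by omega) x) =
      powConcat E (i + 1) j (n + 1) h x ≫ heckeFront τ (n + 1) r x := by
  rw [← powConcat_succ_left E i j n h]
  induction r with
  | zero => exact (Category.id_comp _).trans (Category.comp_id _).symm
  | succ r ih =>
    rw [heckeFront, heckeFront, Category.assoc, ih (by omega),
      reassoc_of% hecke_powConcat_left τ (i + 1) j (n + 1) r h (by omega) x]

/-- A strand of the right block goes to the front of its own block and then through the whole left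
block; in the concatenation it is strand `i + r`. -/
theorem powConcat_heckeFront_right {E : V ⥤ V} (τ : E ⋙ E ⟶ E ⋙ E) (i j n r : ℕ)
    (h : j + i = n) (x : V) :
    (pow E i).map (heckeFront τ (j + 1) r x) ≫ slide τ i ((pow E j).obj x) ≫
        E.map (powConcat E i j n h x) =
      powConcat E i (j + 1) (n + 1) (by omega) x ≫ heckeFront τ (n + 1) (i + r) x := by
  induction i generalizing n with
  | zero =>
    obtain rfl : j = n := by omega
    simp [powConcat_zero_left, slide]
  | succ i ih =>
    obtain ⟨n, rfl⟩ : ∃ t, n = t + 1 := ⟨n - 1, by omega⟩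
    have h1 := congrArg E.map (ih n (by omega))
    have h2 := cross_nat τ (powConcat E i j n (by omega) x)
    rw [powConcat_succ_left, powConcat_succ_left, show i + 1 + r = i + r + 1 by omega,
      heckeFront_succ, slide]
    dsimp at *
    simp only [Functor.map_comp, Category.assoc] at *
    rw [← h2, reassoc_of% h1]

theorem slide_powConcat {A G : V ⥤ V} (s : G ⋙ A ⟶ A ⋙ G) (i j n : ℕ) (h : j + i = n) (x : V) :
    (pow A i).map (slide s j x) ≫ slide s i ((pow A j).obj x) ≫ G.map (powConcat A i j n h x) =
      powConcat A i j n h (G.obj x) ≫ slide s n x := by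
  induction i generalizing n with
  | zero =>
    obtain rfl : j = n := by omega
    simp [powConcat_zero_left, slide]
  | succ i ih =>
    obtain ⟨n, rfl⟩ : ∃ t, n = t + 1 := ⟨n - 1, by omega⟩
    have h1 := congrArg A.map (ih n (by omega))
    have h2 := cross_nat s (powConcat A i j n (by omega) x)
    rw [powConcat_succ_left, powConcat_succ_left, slide, slide]
    dsimp at *
    simp only [Functor.map_comp, Category.assoc] at *
    rw [← h2, reassoc_of% h1]

end Slides

section Contraction

/-! ### Contracting a strand of an iterate with a functor on its right -/

variable {V : Type u} [Category.{v} V] {F E : V ⥤ V}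

/-- For `ε : F E ⟶ 1`, the morphism `Fⁿ⁺¹ E ⟶ Fⁿ` at `x` that moves the strand `r` to the right
and contracts it with `E`. -/
def heckeCounit (τ : F ⋙ F ⟶ F ⋙ F) (ε : E ⋙ F ⟶ 𝟭 V) : (n r : ℕ) → (x : V) →
    ((pow F (n + 1)).obj (E.obj x) ⟶ (pow F n).obj x)
  | 0, _, x => ε.app x
  | n + 1, 0, x => τ.app ((pow F n).obj (E.obj x)) ≫ F.map (heckeCounit τ ε n 0 x)
  | n + 1, r + 1, x => F.map (heckeCounit τ ε n r x)

variable {τ : F ⋙ F ⟶ F ⋙ F} {ε : E ⋙ F ⟶ 𝟭 V}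

theorem heckeCounit_zero (r : ℕ) (x : V) : heckeCounit τ ε 0 r x = ε.app x := by
  cases r <;> rfl

theorem heckeCounit_first (n : ℕ) (x : V) : heckeCounit τ ε (n + 1) 0 x =
    τ.app ((pow F n).obj (E.obj x)) ≫ F.map (heckeCounit τ ε n 0 x) := rfl

theorem heckeCounit_succ (n r : ℕ) (x : V) : heckeCounit τ ε (n + 1) (r + 1) x =
    F.map (heckeCounit τ ε n r x) := rfl

/-- Links the product of crossings in the definition of `stepOffDiag` with the recursive form, which
is suited to induction on the leftmost letter. -/
theorem heckeBack_counitPow {n r : ℕ} (h : r ≤ n) (x : V) :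
    heckeBack τ (n + 1) r (n - r) (E.obj x) ≫ counitPow ε n x = heckeCounit τ ε n r x := by
  induction n generalizing r with
  | zero =>
    obtain rfl : r = 0 := by omega
    exact Category.id_comp _
  | succ n ih =>
    cases r with
    | zero =>
      have h1 := congrArg F.map (ih (Nat.zero_le n))
      rw [Nat.sub_zero] at *
      rw [heckeBack, heckeBack_succ, hecke_first, counitPow, heckeCounit_first, ← h1]
      dsimp
      simp only [Functor.map_comp, Category.assoc]
    | succ r =>
      have h1 := congrArg F.map (ih (r := r) (by omega))
      rw [Nat.add_sub_add_right, heckeBack_succ, counitPow, heckeCounit_succ, ← h1]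
      dsimp
      simp only [Functor.map_comp]

theorem heckeCounit_nat (n r : ℕ) {x y : V} (f : x ⟶ y) :
    (pow F (n + 1)).map (E.map f) ≫ heckeCounit τ ε n r y =
      heckeCounit τ ε n r x ≫ (pow F n).map f := by
  induction n generalizing r with
  | zero =>
    rw [heckeCounit_zero, heckeCounit_zero]
    exact counit_nat ε f
  | succ n ih =>
    cases r with
    | zero =>
      have h1 := congrArg F.map (ih 0)
      have h2 := cross_nat τ ((pow F n).map (E.map f))
      rw [heckeCounit_first, heckeCounit_first]
      dsimp at *
      simp only [Functor.map_comp, Category.assoc] at *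
      rw [reassoc_of% h2, h1]
    | succ r =>
      have h1 := congrArg F.map (ih r)
      rw [heckeCounit_succ, heckeCounit_succ]
      dsimp at *
      simpa only [Functor.map_comp] using h1

/-- The crossed strands lie to the left of the contracted one and never meet it, so naturality
suffices and positions are kept. -/
theorem hecke_heckeCounit_left {n r s : ℕ} (h : s + 2 ≤ r) (hn : r ≤ n) (x : V) :
    hecke τ (n + 1) s (E.obj x) ≫ heckeCounit τ ε n r x =
      heckeCounit τ ε n r x ≫ hecke τ n s x := by
  induction s generalizing n r with
  | zero =>
    obtain ⟨r, rfl⟩ : ∃ t, r = t + 2 := ⟨r - 2, by omega⟩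
    obtain ⟨n, rfl⟩ : ∃ t, n = t + 2 := ⟨n - 2, by omega⟩
    exact (cross_nat τ (heckeCounit τ ε n r x)).symm
  | succ s ih =>
    obtain ⟨r, rfl⟩ : ∃ t, r = t + 1 := ⟨r - 1, by omega⟩
    obtain ⟨n, rfl⟩ : ∃ t, n = t + 1 := ⟨n - 1, by omega⟩
    have h1 := congrArg F.map (ih (n := n) (r := r) (by omega) (by omega))
    rw [heckeCounit_succ, hecke_succ, hecke_succ]
    dsimp at *
    simpa only [Functor.map_comp] using h1

/-- Moving strand `r` to the right begins with `T_r`, which puts it in position `r + 1`. -/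
theorem hecke_heckeCounit_succ {n r : ℕ} (h : r < n) (x : V) :
    hecke τ (n + 1) r (E.obj x) ≫ heckeCounit τ ε n (r + 1) x = heckeCounit τ ε n r x := by
  induction r generalizing n with
  | zero =>
    obtain ⟨n, rfl⟩ : ∃ t, n = t + 1 := ⟨n - 1, by omega⟩
    rfl
  | succ r ih =>
    obtain ⟨n, rfl⟩ : ∃ t, n = t + 1 := ⟨n - 1, by omega⟩
    have h1 := congrArg F.map (ih (n := n) (by omega))
    rw [heckeCounit_succ, heckeCounit_succ, hecke_succ]
    dsimp at *
    simpa only [Functor.map_comp] using h1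

/-- The contracted strand travels across both crossed strands, which costs one braid relation; its
disappearance lowers their positions by one. -/
theorem hecke_heckeCounit_right
    (hb : ∀ x, F.map (τ.app x) ≫ τ.app (F.obj x) ≫ F.map (τ.app x) =
      τ.app (F.obj x) ≫ F.map (τ.app x) ≫ τ.app (F.obj x))
    {n r s : ℕ} (h : r ≤ s) (hn : s + 1 < n) (x : V) :
    hecke τ (n + 1) (s + 1) (E.obj x) ≫ heckeCounit τ ε n r x =
      heckeCounit τ ε n r x ≫ hecke τ n s x := by
  induction n generalizing r s with
  | zero => omega
  | succ n ih =>
    cases r with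
    | succ r =>
      obtain ⟨s, rfl⟩ : ∃ t, s = t + 1 := ⟨s - 1, by omega⟩
      have h1 := congrArg F.map (ih (r := r) (s := s) (by omega) (by omega))
      rw [heckeCounit_succ, hecke_succ τ (n + 1) (s + 1), hecke_succ τ n s x]
      dsimp at *
      simpa only [Functor.map_comp] using h1
    | zero =>
      cases s with
      | succ s =>
        have h1 := congrArg F.map (ih (r := 0) (s := s) (by omega) (by omega))
        have h2 := cross_nat τ (hecke τ n s (E.obj x))
        rw [hecke_succ] at h1
        rw [heckeCounit_first, hecke_succ, hecke_succ, hecke_succ]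
        dsimp at *
        simp only [Functor.map_comp, Category.assoc] at *
        rw [reassoc_of% h2, h1]
      | zero =>
        obtain ⟨n, rfl⟩ : ∃ t, n = t + 1 := ⟨n - 1, by omega⟩
        have h1 := hb ((pow F n).obj (E.obj x))
        have h2 := cross_nat τ (heckeCounit τ ε n 0 x)
        rw [hecke_succ, hecke_first, hecke_first, heckeCounit_first, heckeCounit_first]
        dsimp at *
        simp only [Functor.map_comp, Category.assoc] at *
        rw [reassoc_of% h1, h2]

/-- Contracting two strands with `E E`, after a crossing of `E E`. -/
theorem heckeCounit_heckeCounit_cross {t : E ⋙ E ⟶ E ⋙ E}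
    (hb : ∀ x, F.map (τ.app x) ≫ τ.app (F.obj x) ≫ F.map (τ.app x) =
      τ.app (F.obj x) ≫ F.map (τ.app x) ≫ τ.app (F.obj x))
    (ht : ∀ x, F.map (F.map (t.app x)) ≫ F.map (ε.app (E.obj x)) ≫ ε.app x =
      τ.app (E.obj (E.obj x)) ≫ F.map (ε.app (E.obj x)) ≫ ε.app x)
    {r s : ℕ} (h : s ≤ r) (n : ℕ) (hn : r ≤ n) (x : V) :
    (pow F (n + 2)).map (t.app x) ≫ heckeCounit τ ε (n + 1) (r + 1) (E.obj x) ≫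
        heckeCounit τ ε n s x =
      heckeCounit τ ε (n + 1) s (E.obj x) ≫ heckeCounit τ ε n r x := by
  induction n generalizing r s with
  | zero =>
    obtain rfl : r = 0 := by omega
    obtain rfl : s = 0 := by omega
    have h1 := ht x
    simp only [heckeCounit]
    dsimp at *
    simp only [Category.assoc] at *
    exact h1
  | succ n ih =>
    cases s with
    | succ s =>
      obtain ⟨r, rfl⟩ : ∃ t, r = t + 1 := ⟨r - 1, by omega⟩
      have h1 := congrArg F.map (ih (r := r) (s := s) (by omega) (by omega))
      simp only [heckeCounit_succ, Functor.map_comp] at h1 ⊢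
      exact h1
    | zero =>
      cases r with
      | zero =>
        have h1 := congrArg F.map (ih (r := 0) (s := 0) (by omega) (by omega))
        have h2 := cross_nat τ (heckeCounit τ ε n 0 (E.obj x))
        -- Both contracted strands have to cross the same third strand, and they do so in opposite
        -- orders on the two sides.
        have h3 := hb ((pow F n).obj (E.obj (E.obj x)))
        have h4 := cross_nat τ ((pow F (n + 1)).map (t.app x))
        have h5 := congrArg F.map (cross_nat τ ((pow F n).map (t.app x)))
        have h6 := cross_nat τ (heckeCounit τ ε n 0 x)
        simp only [heckeCounit_succ, heckeCounit_first] at *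
        dsimp at *
        simp only [Functor.map_comp, Category.assoc] at *
        rw [reassoc_of% h2, reassoc_of% h5, reassoc_of% h4, h1, reassoc_of% h3]
      | succ r =>
        have h1 := congrArg F.map (ih (r := r) (s := 0) (by omega) (by omega))
        have h2 := cross_nat τ (heckeCounit τ ε n r (E.obj x))
        have h4 := cross_nat τ ((pow F (n + 1)).map (t.app x))
        simp only [heckeCounit_succ, heckeCounit_first] at *
        dsimp at *
        simp only [Functor.map_comp, Category.assoc] at *
        rw [reassoc_of% h2, reassoc_of% h4, h1]

/-- Contracting the first strand with `E` amounts to moving `E` past the other strands. -/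
theorem heckeCounit_eq_slide {ρ : E ⋙ F ⟶ F ⋙ E}
    (h : ∀ x, F.map (ρ.app x) ≫ ε.app (F.obj x) = τ.app (E.obj x) ≫ F.map (ε.app x))
    (n : ℕ) (x : V) :
    F.map (slide ρ n x) ≫ ε.app ((pow F n).obj x) = heckeCounit τ ε n 0 x := by
  induction n with
  | zero => simp [slide, heckeCounit]
  | succ n ih =>
    have h1 := congrArg F.map ih
    have h2 := h ((pow F n).obj x)
    have h3 := cross_nat τ (slide ρ n x)
    rw [heckeCounit_first, slide]
    dsimp at *
    simp only [Functor.map_comp, Category.assoc] at *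
    rw [h2, reassoc_of% h3, h1]

/-- A strand of the left block meets `E` on the far side of the right block. By
`heckeCounit_eq_slide`, one may instead bring `E` to the strand through the right block by `ρ`. -/
theorem heckeCounit_powConcat_left {ρ : E ⋙ F ⟶ F ⋙ E}
    (hρ : ∀ x, F.map (ρ.app x) ≫ ε.app (F.obj x) = τ.app (E.obj x) ≫ F.map (ε.app x))
    (i j n r : ℕ) (h : j + i = n) (hr : r ≤ i) (x : V) :
    (pow F (i + 1)).map (slide ρ j x) ≫ heckeCounit τ ε i r ((pow F j).obj x) ≫
        powConcat F i j n h x =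
      powConcat F (i + 1) j (n + 1) (by omega) (E.obj x) ≫ heckeCounit τ ε n r x := by
  induction i generalizing n r with
  | zero =>
    obtain rfl : j = n := by omega
    obtain rfl : r = 0 := by omega
    have h1 := heckeCounit_eq_slide hρ j x
    rw [powConcat_succ_left, powConcat_zero_left, powConcat_zero_left, ← h1]
    simp [heckeCounit]
  | succ i ih =>
    obtain ⟨n, rfl⟩ : ∃ t, n = t + 1 := ⟨n - 1, by omega⟩
    cases r with
    | zero =>
      have h1 := congrArg F.map (ih n 0 (by omega) (by omega))
      have h2 := cross_nat τ ((pow F i).map (slide ρ j x))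
      have h3 := cross_nat τ (powConcat F i j n (by omega) (E.obj x))
      simp only [powConcat_succ_left, heckeCounit_first] at *
      dsimp at *
      simp only [Functor.map_comp, Category.assoc] at *
      rw [reassoc_of% h2, h1, reassoc_of% h3]
    | succ r =>
      have h1 := congrArg F.map (ih n r (by omega) (by omega))
      simp only [powConcat_succ_left, heckeCounit_succ] at *
      dsimp at *
      simpa only [Functor.map_comp] using h1

/-- A strand of the right block is contracted inside that block, and the left block is a spectator.
-/
theorem powConcat_heckeCounit_right (i j n r : ℕ) (h : j + i = n) (x : V) :
    powConcat F i (j + 1) (n + 1) (by omega) (E.obj x) ≫ heckeCounit τ ε n (i + r) x =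
      (pow F i).map (heckeCounit τ ε j r x) ≫ powConcat F i j n h x := by
  induction i generalizing n with
  | zero =>
    obtain rfl : j = n := by omega
    simp [powConcat_zero_left]
  | succ i ih =>
    obtain ⟨n, rfl⟩ : ∃ t, n = t + 1 := ⟨n - 1, by omega⟩
    have h1 := congrArg F.map (ih n (by omega))
    rw [powConcat_succ_left, powConcat_succ_left, show i + 1 + r = i + r + 1 by omega,
      heckeCounit_succ]
    dsimp at *
    simpa only [Functor.map_comp] using h1

/-- Contractions commute with moving the iterate past a functor `A` on its right. -/
theorem heckeCounit_slide {A : V ⥤ V} {l : A ⋙ F ⟶ F ⋙ A} {σ : E ⋙ A ⟶ A ⋙ E}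
    (hl : ∀ x, F.map (l.app x) ≫ l.app (F.obj x) ≫ A.map (τ.app x) =
      τ.app (A.obj x) ≫ F.map (l.app x) ≫ l.app (F.obj x))
    (hσ : ∀ x, F.map (σ.app x) ≫ ε.app (A.obj x) = l.app (E.obj x) ≫ A.map (ε.app x))
    (n r : ℕ) (x : V) :
    (pow F (n + 1)).map (σ.app x) ≫ heckeCounit τ ε n r (A.obj x) ≫ slide l n x =
      slide l (n + 1) (E.obj x) ≫ A.map (heckeCounit τ ε n r x) := by
  induction n generalizing r with
  | zero =>
    have h1 := hσ x
    simp only [heckeCounit_zero, slide]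
    dsimp at *
    simpa using h1
  | succ n ih =>
    have h3 := cross_nat l (heckeCounit τ ε n 0 x)
    cases r with
    | zero =>
      have h1 := congrArg F.map (ih 0)
      have h2 := cross_nat τ ((pow F n).map (σ.app x))
      have h3 := cross_nat l (heckeCounit τ ε n 0 x)
      have h4 := hl ((pow F n).obj (E.obj x))
      have h5 := cross_nat τ (slide l n (E.obj x))
      rw [slide] at h1
      rw [heckeCounit_first, heckeCounit_first, slide, slide, slide]
      dsimp at *
      simp only [Functor.map_comp, Category.assoc] at *
      rw [reassoc_of% h2, reassoc_of% h1, h3, ← reassoc_of% h5, reassoc_of% h4]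
    | succ r =>
      have h1 := congrArg F.map (ih r)
      have h3 := cross_nat l (heckeCounit τ ε n r x)
      rw [slide] at h1
      rw [heckeCounit_succ, heckeCounit_succ, slide, slide, slide]
      dsimp at *
      simp only [Functor.map_comp, Category.assoc] at *
      rw [reassoc_of% h1, h3]

theorem heckeCounit_slidePow {A : V ⥤ V} {l : A ⋙ F ⟶ F ⋙ A} {σ : E ⋙ A ⟶ A ⋙ E}
    (hl : ∀ x, F.map (l.app x) ≫ l.app (F.obj x) ≫ A.map (τ.app x) =
      τ.app (A.obj x) ≫ F.map (l.app x) ≫ l.app (F.obj x))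
    (hσ : ∀ x, F.map (σ.app x) ≫ ε.app (A.obj x) = l.app (E.obj x) ≫ A.map (ε.app x))
    (n r j : ℕ) (x : V) :
    (pow F (n + 1)).map (slide σ j x) ≫ heckeCounit τ ε n r ((pow A j).obj x) ≫
        slidePow l n j x =
      slidePow l (n + 1) j (E.obj x) ≫ (pow A j).map (heckeCounit τ ε n r x) := by
  induction j with
  | zero => simp [slide, slidePow]
  | succ j ih =>
    have h1 := congrArg A.map ih
    have h2 := heckeCounit_slide hl hσ n r ((pow A j).obj x)
    have h3 := slide_nat l (n + 1) (slide σ j x)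
    rw [slidePow, slidePow, slide]
    dsimp at *
    simp only [Functor.map_comp, Category.assoc] at *
    rw [reassoc_of% h2, reassoc_of% h3, h1]

/-- Contractions of strands with `E` preceded by the unit of the adjunction. -/
theorem unit_heckeCounit {η : 𝟭 V ⟶ F ⋙ E}
    (h : ∀ x, F.map (η.app x) ≫ ε.app (F.obj x) = 𝟙 (F.obj x)) {n r : ℕ} (hr : r ≤ n) (x : V) :
    (pow F (n + 1)).map (η.app x) ≫ heckeCounit τ ε n r (F.obj x) ≫
        powConcat F n 1 (n + 1) (by omega) x =
      heckeBack τ (n + 1) r (n - r) x := by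
  induction n generalizing r with
  | zero =>
    obtain rfl : r = 0 := by omega
    have h1 := h x
    rw [powConcat_zero_left, heckeCounit_zero]
    dsimp at *
    rw [reassoc_of% h1]
    rfl
  | succ n ih =>
    cases r with
    | zero =>
      have h1 := congrArg F.map (ih (Nat.zero_le n))
      have h2 := cross_nat τ ((pow F n).map (η.app x))
      rw [Nat.sub_zero] at *
      rw [heckeBack, heckeBack_succ, hecke_first, heckeCounit_first, powConcat_succ_left, ← h1]
      dsimp at *
      simp only [Functor.map_comp, Category.assoc] at *
      rw [reassoc_of% h2]
    | succ r =>
      have h1 := congrArg F.map (ih (r := r) (by omega))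
      rw [Nat.add_sub_add_right, heckeBack_succ, heckeCounit_succ, powConcat_succ_left, ← h1]
      dsimp
      simp only [Functor.map_comp]

end Contraction

section Differential

/-! ### Differentials of nil Hecke operators and contractions -/

variable {k : Type w} [Field k] {V : Type u} [Category.{v} V] [Preadditive V] [Linear k V]
  [DiffCategory k V] {E : V ⥤ V} {τ : E ⋙ E ⟶ E ⋙ E}

theorem hecke_sq (h : IsTwoRep k E τ) {n r : ℕ} (hr : r + 1 < n) (x : V) :
    hecke τ n r x ≫ hecke τ n r x = 0 := by
  have := h.isDiff
  induction n generalizing r with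
  | zero => omega
  | succ n ih =>
    cases r with
    | zero =>
      obtain ⟨n, rfl⟩ : ∃ t, n = t + 1 := ⟨n - 1, by omega⟩
      exact h.sq _
    | succ r =>
      have h1 := congrArg E.map (ih (r := r) (by omega))
      rw [map_zero' k] at h1
      rw [hecke_succ]
      dsimp at *
      simpa using h1

theorem d_hecke (h : IsTwoRep k E τ) {n r : ℕ} (hr : r + 1 < n) (x : V) :
    d k (hecke τ n r x) = 𝟙 _ := by
  have := h.isDiff
  induction n generalizing r with
  | zero => omega
  | succ n ih =>
    cases r with
    | zero =>
      obtain ⟨n, rfl⟩ : ∃ t, n = t + 1 := ⟨n - 1, by omega⟩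
      exact h.d_tau _
    | succ r =>
      rw [hecke_succ]
      exact (IsDiff.map_d (k := k) (F := E) _).symm.trans
        ((congrArg E.map (ih (r := r) (by omega))).trans (E.map_id _))

theorem hecke_heckeFront_succ_zero (h : IsTwoRep k E τ) {n r : ℕ} (hr : r < n) (x : V) :
    hecke τ (n + 1) r x ≫ heckeFront τ (n + 1) (r + 1) x = 0 := by
  rw [heckeFront, ← Category.assoc, hecke_sq h (by omega), Limits.zero_comp]

/-- Leibniz rule with `d(T_s) = 1`: the `s`-th summand omits `T_s`. The crossings before the gap
have indices above `s`, so they commute with those after it and can be performed last. -/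
theorem d_heckeFront (h : IsTwoRep k E τ) {n r : ℕ} (hr : r ≤ n) (x : V) :
    d k (heckeFront τ (n + 1) r x) = ∑ s ∈ Finset.range r,
      heckeFront τ (n + 1) s x ≫ E.map (heckeDown τ n s (r - 1 - s) x) := by
  induction r with
  | zero => exact (d_id k _).trans (by simp)
  | succ r ih =>
    have h1 : heckeFront τ (n + 1) r x ≫ E.map (heckeDown τ n r (r + 1 - 1 - r) x) =
        heckeFront τ (n + 1) r x := by
      rw [show r + 1 - 1 - r = 0 by omega, heckeDown, E.map_id]
      exact Category.comp_id _
    rw [heckeFront, d_comp, d_hecke h (by omega), ih (by omega), Finset.sum_range_succ,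
      Category.id_comp, add_comm (heckeFront τ (n + 1) r x), h1, Preadditive.comp_sum]
    congr 1
    refine Finset.sum_congr rfl fun s hs => ?_
    rw [Finset.mem_range] at hs
    obtain ⟨l, rfl⟩ : ∃ t, r = s + t + 1 := ⟨r - s - 1, by omega⟩
    rw [show s + l + 1 + 1 - 1 - s = l + 1 by omega, show s + l + 1 - 1 - s = l by omega,
      heckeDown, reassoc_of% hecke_heckeFront_right τ (show s ≤ s + l by omega) n x, E.map_comp]

theorem hecke_heckeCounit_zero {F : V ⥤ V} {t : F ⋙ F ⟶ F ⋙ F} {ε : E ⋙ F ⟶ 𝟭 V} (h : IsTwoRep k F t) {n r : ℕ} (hr : r < n) (x : V) :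
    hecke t (n + 1) r (E.obj x) ≫ heckeCounit t ε n r x = 0 := by
  rw [← hecke_heckeCounit_succ hr, ← Category.assoc, hecke_sq h (by omega), Limits.zero_comp]

variable {F : V ⥤ V} [IsDiff k F] {t : F ⋙ F ⟶ F ⋙ F} {ε : E ⋙ F ⟶ 𝟭 V}

theorem heckeCounit_last_closed (hε : NatClosed k ε) (n : ℕ) (x : V) :
    d k (heckeCounit t ε n n x) = 0 := by
  induction n with
  | zero => exact hε x
  | succ n ih => exact d_map_closed k F ih

/-- Leibniz rule again: omitting `T_{s-1}` leaves the contraction of strand `s`, while strand `r`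
has travelled only to position `s - 1`. -/
theorem d_heckeCounit (h : IsTwoRep k F t) (hε : NatClosed k ε) {n r : ℕ} (hr : r ≤ n) (x : V) :
    d k (heckeCounit t ε n r x) = ∑ s ∈ Finset.Ico (r + 1) (n + 1),
      heckeCounit t ε n s x ≫ heckeBack t n r (s - 1 - r) x := by
  obtain ⟨l, hl⟩ : ∃ l, r + l = n := ⟨n - r, by omega⟩
  induction l generalizing r with
  | zero =>
    obtain rfl : r = n := by omega
    simpa using heckeCounit_last_closed hε r x
  | succ l ih =>
    have h1 : heckeCounit t ε n (r + 1) x ≫ heckeBack t n r (r + 1 - 1 - r) x =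
        heckeCounit t ε n (r + 1) x := by
      rw [show r + 1 - 1 - r = 0 by omega, heckeBack]
      exact Category.comp_id _
    rw [← hecke_heckeCounit_succ (by omega : r < n), d_comp, d_hecke h (by omega),
      ih (r := r + 1) (by omega) (by omega), Finset.sum_eq_sum_Ico_succ_bot (by omega : r + 1 < n + 1),
      Category.id_comp, h1, Preadditive.comp_sum]
    congr 1
    refine Finset.sum_congr rfl fun s hs => ?_
    rw [Finset.mem_Ico] at hs
    obtain ⟨q, rfl⟩ : ∃ q, s = r + 2 + q := ⟨s - r - 2, by omega⟩
    rw [show r + 2 + q - 1 - (r + 1) = q by omega, show r + 2 + q - 1 - r = q + 1 by omega,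
      heckeBack, reassoc_of% hecke_heckeCounit_left (τ := t) (ε := ε)
        (show r + 2 ≤ r + 2 + q by omega) (by omega : r + 2 + q ≤ n) x]

end Differential

section DualRelations

/-! ### Relations between `τF`, `τ₁`, `τ₂`, `λ`, `σ` and `ρ` -/

/-- The principle behind all identities with target `E₁`: they are checked after transposition,
where only `F₁`, the counit and the given data remain. -/
theorem adj_hom_ext {V : Type u} [Category.{v} V] {F E : V ⥤ V} (adj : F ⊣ E) {x y : V}
    {f g : x ⟶ E.obj y}
    (h : F.map f ≫ adj.counit.app y = F.map g ≫ adj.counit.app y) : f = g := by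
  apply (adj.homEquiv x y).symm.injective
  rw [adj.homEquiv_counit, adj.homEquiv_counit]
  exact h

variable {k : Type w} [Field k] {V : Type u} [Category.{v} V] [Preadditive V] [Linear k V]
  [DiffCategory k V]

namespace LambdaSetup

variable (D : LambdaSetup k V)

theorem commF' (x : V) : D.F₁.map (D.lam.app x) ≫ D.lam.app (D.F₁.obj x) ≫
      D.E₂.map (D.τF.app x) =
    D.τF.app (D.E₂.obj x) ≫ D.F₁.map (D.lam.app x) ≫ D.lam.app (D.F₁.obj x) := D.commF x

theorem comm₂' (x : V) : D.F₁.map (D.τ₂.app x) ≫ D.lam.app (D.E₂.obj x) ≫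
      D.E₂.map (D.lam.app x) =
    D.lam.app (D.E₂.obj x) ≫ D.E₂.map (D.lam.app x) ≫ D.τ₂.app (D.F₁.obj x) := (D.comm₂ x).symm

end LambdaSetup

namespace DualSetup

variable (D : DualSetup k V)

theorem left_triangle (x : V) :
    D.F₁.map (D.adj.unit.app x) ≫ D.adj.counit.app (D.F₁.obj x) = 𝟙 (D.F₁.obj x) :=
  D.adj.left_triangle_components x

/-- `σ` is the mate of `λ`; the unit in its definition is removed by a triangle identity. -/
theorem σ_counit (x : V) : D.F₁.map (D.σ.app x) ≫ D.adj.counit.app (D.E₂.obj x) =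
    D.lam.app (D.E₁.obj x) ≫ D.E₂.map (D.adj.counit.app x) := by
  have h1 := counit_nat D.adj.counit (D.lam.app (D.E₁.obj x) ≫ D.E₂.map (D.adj.counit.app x))
  have h2 := D.left_triangle (D.E₂.obj (D.E₁.obj x))
  simp only [σ]
  dsimp at *
  simp only [Functor.map_comp, Category.assoc] at *
  rw [h1, reassoc_of% h2]

theorem τ₁_counit (x : V) :
    D.F₁.map (D.F₁.map (D.τ₁.app x)) ≫ D.F₁.map (D.adj.counit.app (D.E₁.obj x)) ≫
        D.adj.counit.app x =
      D.τF.app (D.E₁.obj (D.E₁.obj x)) ≫ D.F₁.map (D.adj.counit.app (D.E₁.obj x)) ≫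
        D.adj.counit.app x := by
  have h := conjugateEquiv_counit (D.adj.comp D.adj) (D.adj.comp D.adj) D.τF x
  simp only [Adjunction.comp_counit_app] at h
  exact h

/-- `ρ` and `τ₁` come from the same `τF`: transposing one variable of `τF` gives `ρ`, transposing
both gives `τ₁`. -/
theorem ρ_counit (x : V) : D.F₁.map (D.ρ.app x) ≫ D.adj.counit.app (D.F₁.obj x) =
    D.τF.app (D.E₁.obj x) ≫ D.F₁.map (D.adj.counit.app x) := by
  have h1 := D.τ₁_counit (D.F₁.obj x)
  have h2 := cross_nat D.τF (D.E₁.map (D.adj.unit.app x))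
  have h3 := congrArg D.F₁.map (counit_nat D.adj.counit (D.adj.unit.app x))
  have h4 := D.left_triangle x
  simp only [ρ]
  dsimp at *
  simp only [Functor.map_comp, Category.assoc] at *
  rw [h1, reassoc_of% h2, reassoc_of% h3, h4, Category.comp_id]

/-- The intermediate transposition, from `τ₁` to `ρ`. It gives `E₁` the same relation to the pair
`(ρ, τ₁)` that `σ_counit` gives `E₂` to `(λ, σ)`, so `heckeCounit_slide` serves both. -/
theorem τ₁_counit_eq (x : V) : D.F₁.map (D.τ₁.app x) ≫ D.adj.counit.app (D.E₁.obj x) =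
    D.ρ.app (D.E₁.obj x) ≫ D.E₁.map (D.adj.counit.app x) := by
  have h1 := congrArg D.F₁.map (cross_nat D.τ₁ (D.adj.counit.app x))
  have h2 := counit_nat D.adj.counit (D.E₁.map (D.adj.counit.app x))
  have h3 : D.adj.unit.app (D.E₁.obj x) ≫ D.E₁.map (D.adj.counit.app x) = 𝟙 (D.E₁.obj x) :=
    D.adj.right_triangle_components x
  have h4 := congrArg (fun f => D.F₁.map (D.E₁.map f)) h3
  simp only [ρ]
  dsimp at *
  simp only [Functor.map_comp, Category.assoc] at *
  rw [← h2, ← reassoc_of% h1, reassoc_of% h4]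
  simp

/-- Morphisms to `E₁ E₁` are determined by their transposes. -/
theorem hom_ext₂ {x y : V} {f g : x ⟶ D.E₁.obj (D.E₁.obj y)}
    (h : D.F₁.map (D.F₁.map f) ≫ D.F₁.map (D.adj.counit.app (D.E₁.obj y)) ≫ D.adj.counit.app y =
      D.F₁.map (D.F₁.map g) ≫ D.F₁.map (D.adj.counit.app (D.E₁.obj y)) ≫ D.adj.counit.app y) :
    f = g := by
  refine adj_hom_ext D.adj (adj_hom_ext D.adj ?_)
  simpa using h

theorem rep₁ : IsTwoRep k D.E₁ D.τ₁ where
  isDiff := inferInstance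
  d_tau x := by
    refine D.hom_ext₂ ?_
    -- Differentiating the transposition formula replaces both `τ₁` and `τF` by identities, since
    -- the counit is closed.
    have h := congrArg (d k) (D.τ₁_counit x)
    dsimp at h ⊢
    simp only [d_comp, ← IsDiff.map_d (k := k) (F := D.F₁), D.counit_closed (D.E₁.obj x),
      D.counit_closed x, map_zero' k, D.repF.d_tau] at h
    simpa using h
  sq x := by
    refine D.hom_ext₂ ?_
    have h1 := D.τ₁_counit x
    have h2 := cross_nat D.τF (D.τ₁.app x)
    have h3 := D.repF.sq (D.E₁.obj (D.E₁.obj x))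
    dsimp at *
    simp only [Functor.map_comp, Category.assoc, map_zero' k, Limits.zero_comp] at *
    rw [h1, reassoc_of% h2, h1, reassoc_of% h3, Limits.zero_comp]
  braid x := by
    refine adj_hom_ext D.adj (D.hom_ext₂ ?_)
    have a1 := D.τ₁_counit x
    have a2 := congrArg D.F₁.map (D.τ₁_counit (D.E₁.obj x))
    have a3 := congrArg (fun f => D.F₁.map (D.F₁.map f)) (counit_nat D.adj.counit (D.τ₁.app x))
    have a4 := cross_nat D.τF (D.adj.counit.app (D.E₁.obj (D.E₁.obj x)))
    have b1 := cross_nat D.τF (D.F₁.map (D.τ₁.app (D.E₁.obj x)))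
    have b2 := congrArg D.F₁.map (cross_nat D.τF (D.E₁.map (D.τ₁.app x)))
    have b3 := cross_nat D.τF (D.F₁.map (D.E₁.map (D.τ₁.app x)))
    have b4 := congrArg D.F₁.map (cross_nat D.τF (D.τ₁.app (D.E₁.obj x)))
    have b5 := D.repF.braid (D.E₁.obj (D.E₁.obj (D.E₁.obj x)))
    dsimp at *
    simp only [Functor.map_comp, Category.assoc] at *
    -- Transposition exchanges the two positions: `E₁τ₁` becomes `τF F₁` here, and `τ₁E₁` becomes
    -- `F₁τF` in `a2`. The braid relation is symmetric under this exchange.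
    have c1 : D.F₁.map (D.F₁.map (D.F₁.map (D.E₁.map (D.τ₁.app x)))) ≫
          D.F₁.map (D.F₁.map (D.adj.counit.app (D.E₁.obj (D.E₁.obj x)))) ≫
            D.F₁.map (D.adj.counit.app (D.E₁.obj x)) ≫ D.adj.counit.app x =
        D.τF.app (D.F₁.obj (D.E₁.obj (D.E₁.obj (D.E₁.obj x)))) ≫
          D.F₁.map (D.F₁.map (D.adj.counit.app (D.E₁.obj (D.E₁.obj x)))) ≫
            D.F₁.map (D.adj.counit.app (D.E₁.obj x)) ≫ D.adj.counit.app x := by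
      rw [reassoc_of% a3, a1, reassoc_of% a4]
    rw [reassoc_of% a2, c1, reassoc_of% b1, reassoc_of% a2, reassoc_of% b3, reassoc_of% b2,
      c1, reassoc_of% b4, reassoc_of% b1, reassoc_of% a2, reassoc_of% b5]

/-! ### Compatibility of `σ` and `ρ` with the endomorphisms -/

theorem τ₂_σ (x : V) : D.E₂.map (D.σ.app x) ≫ D.σ.app (D.E₂.obj x) ≫ D.E₁.map (D.τ₂.app x) =
    D.τ₂.app (D.E₁.obj x) ≫ D.E₂.map (D.σ.app x) ≫ D.σ.app (D.E₂.obj x) := by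
  refine adj_hom_ext D.adj ?_
  have a1 := D.σ_counit (D.E₂.obj x)
  have a2 := congrArg D.E₂.map (D.σ_counit x)
  have a3 := counit_nat D.adj.counit (D.τ₂.app x)
  have a4 := cross_nat D.lam (D.σ.app x)
  have a5 := cross_nat D.τ₂ (D.adj.counit.app x)
  have a6 := D.comm₂ (D.E₁.obj x)
  dsimp at *
  simp only [Functor.map_comp, Category.assoc] at *
  rw [a3, reassoc_of% a1, reassoc_of% a4, reassoc_of% a2, a1, reassoc_of% a4, a2, a5,
    reassoc_of% a6]

theorem σ_τ₁ (x : V) : D.E₂.map (D.τ₁.app x) ≫ D.σ.app (D.E₁.obj x) ≫ D.E₁.map (D.σ.app x) =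
    D.σ.app (D.E₁.obj x) ≫ D.E₁.map (D.σ.app x) ≫ D.τ₁.app (D.E₂.obj x) := by
  refine D.hom_ext₂ ?_
  have a1 := D.σ_counit x
  have a2 := congrArg D.F₁.map (D.σ_counit (D.E₁.obj x))
  have a3 := congrArg D.F₁.map (counit_nat D.adj.counit (D.σ.app x))
  have a4 := D.τ₁_counit (D.E₂.obj x)
  have a5 := cross_nat D.τF (D.σ.app (D.E₁.obj x))
  have a6 := cross_nat D.τF (D.E₁.map (D.σ.app x))
  have a7 := cross_nat D.lam (D.adj.counit.app (D.E₁.obj x))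
  have a8 := congrArg D.F₁.map (cross_nat D.lam (D.τ₁.app x))
  have a9 := cross_nat D.lam (D.F₁.map (D.τ₁.app x))
  have b1 := congrArg D.E₂.map (D.τ₁_counit x)
  have b2 := D.commF (D.E₁.obj (D.E₁.obj x))
  dsimp at *
  simp only [Functor.map_comp, Category.assoc] at *
  rw [a4, reassoc_of% a3, reassoc_of% a2, a1, reassoc_of% a6, reassoc_of% a5, reassoc_of% a3,
    reassoc_of% a2, a1, reassoc_of% a7, reassoc_of% a8, reassoc_of% a9, b1, reassoc_of% b2]

theorem τF_ρ (x : V) : D.F₁.map (D.ρ.app x) ≫ D.ρ.app (D.F₁.obj x) ≫ D.E₁.map (D.τF.app x) =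
    D.τF.app (D.E₁.obj x) ≫ D.F₁.map (D.ρ.app x) ≫ D.ρ.app (D.F₁.obj x) := by
  refine adj_hom_ext D.adj ?_
  have a1 := D.ρ_counit (D.F₁.obj x)
  have a2 := congrArg D.F₁.map (D.ρ_counit x)
  have a3 := counit_nat D.adj.counit (D.τF.app x)
  have a4 := cross_nat D.τF (D.ρ.app x)
  have a5 := cross_nat D.τF (D.adj.counit.app x)
  have a6 := D.repF.braid (D.E₁.obj x)
  dsimp at *
  simp only [Functor.map_comp, Category.assoc] at *
  rw [a3, reassoc_of% a1, reassoc_of% a4, reassoc_of% a2, a5, a1, reassoc_of% a4, a2,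
    reassoc_of% a6]

/-- The Yang–Baxter relation for the word `F₁E₂E₁`; its transpose is the compatibility of `λ` with
`τF`. -/
theorem lam_σ_ρ (x : V) :
    D.F₁.map (D.σ.app x) ≫ D.ρ.app (D.E₂.obj x) ≫ D.E₁.map (D.lam.app x) =
      D.lam.app (D.E₁.obj x) ≫ D.E₂.map (D.ρ.app x) ≫ D.σ.app (D.F₁.obj x) := by
  refine adj_hom_ext D.adj ?_
  have a1 := D.ρ_counit (D.E₂.obj x)
  have a2 := D.σ_counit (D.F₁.obj x)
  have a3 := counit_nat D.adj.counit (D.lam.app x)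
  have a4 := cross_nat D.τF (D.σ.app x)
  have a5 := congrArg D.F₁.map (D.σ_counit x)
  have a6 := cross_nat D.lam (D.adj.counit.app x)
  have a7 := cross_nat D.lam (D.ρ.app x)
  have a8 := congrArg D.E₂.map (D.ρ_counit x)
  have a9 := D.commF (D.E₁.obj x)
  dsimp at *
  simp only [Functor.map_comp, Category.assoc] at *
  rw [a3, reassoc_of% a1, reassoc_of% a4, reassoc_of% a5, a6, a2, reassoc_of% a7, a8,
    reassoc_of% a9]

/-- One transposition turns `τ₁` into `ρ`, and the claim into `τF_ρ`, which is itself a transposed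
braid relation. -/
theorem ρ_τ₁ (x : V) : D.F₁.map (D.τ₁.app x) ≫ D.ρ.app (D.E₁.obj x) ≫ D.E₁.map (D.ρ.app x) =
    D.ρ.app (D.E₁.obj x) ≫ D.E₁.map (D.ρ.app x) ≫ D.τ₁.app (D.F₁.obj x) := by
  refine adj_hom_ext D.adj ?_
  have a1 := D.ρ_counit (D.E₁.obj x)
  have a2 := counit_nat D.adj.counit (D.ρ.app x)
  have a3 := cross_nat D.τF (D.τ₁.app x)
  have a4 := congrArg D.F₁.map (D.τ₁_counit_eq x)
  have a5 := D.τ₁_counit_eq (D.F₁.obj x)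
  have a6 := cross_nat D.ρ (D.adj.counit.app x)
  have a7 := cross_nat D.ρ (D.ρ.app x)
  have a8 := congrArg D.E₁.map (D.ρ_counit x)
  have a9 := D.τF_ρ (D.E₁.obj x)
  dsimp at *
  simp only [Functor.map_comp, Category.assoc] at *
  rw [a2, reassoc_of% a1, reassoc_of% a3, reassoc_of% a4, a6, a5, reassoc_of% a7, a8,
    reassoc_of% a9]

theorem compatible : D.toSigma.Compatible where
  rep₁ := D.rep₁
  rep₂ := D.rep₂
  comm₂ := D.τ₂_σ
  comm₁ x := (D.σ_τ₁ x).symm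

end DualSetup

end DualRelations

section ConeMatrices

variable {k : Type w} [Field k] {V : Type u} [Category.{v} V] [Preadditive V] [Linear k V]
  [DiffCategory k V]

/-! ### Morphisms out of cones -/

namespace ConeData

variable {A B : V} {f : A ⟶ B} (c : ConeData k f)

theorem inl_fst' {z : V} (h : A ⟶ z) : c.inl ≫ c.fst ≫ h = h := by
  rw [← Category.assoc, c.inl_fst, Category.id_comp]

theorem inr_snd' {z : V} (h : B ⟶ z) : c.inr ≫ c.snd ≫ h = h := by
  rw [← Category.assoc, c.inr_snd, Category.id_comp]

theorem inl_snd' {z : V} (h : B ⟶ z) : c.inl ≫ c.snd ≫ h = 0 := by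
  rw [← Category.assoc, c.inl_snd, Limits.zero_comp]

theorem inr_fst' {z : V} (h : A ⟶ z) : c.inr ≫ c.fst ≫ h = 0 := by
  rw [← Category.assoc, c.inr_fst, Limits.zero_comp]

theorem hom_ext {z : V} {g h : c.obj ⟶ z} (hl : c.inl ≫ g = c.inl ≫ h)
    (hr : c.inr ≫ g = c.inr ≫ h) : g = h := by
  rw [← Category.id_comp g, ← Category.id_comp h, ← c.total, Preadditive.add_comp,
    Preadditive.add_comp, Category.assoc, Category.assoc, Category.assoc, Category.assoc, hl, hr]

variable {V' : Type u'} [Category.{v'} V'] [Preadditive V'] [Linear k V'] [DiffCategory k V']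
  (G : V ⥤ V') [IsDiff k G]

theorem map_inl_fst {z : V'} (h : G.obj A ⟶ z) : G.map c.inl ≫ G.map c.fst ≫ h = h := by
  rw [← Category.assoc, ← G.map_comp, c.inl_fst, G.map_id, Category.id_comp]

theorem map_inr_snd {z : V'} (h : G.obj B ⟶ z) : G.map c.inr ≫ G.map c.snd ≫ h = h := by
  rw [← Category.assoc, ← G.map_comp, c.inr_snd, G.map_id, Category.id_comp]

theorem map_inl_snd {z : V'} (h : G.obj B ⟶ z) : G.map c.inl ≫ G.map c.snd ≫ h = 0 := by
  rw [← Category.assoc, ← G.map_comp, c.inl_snd, map_zero' k, Limits.zero_comp]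

theorem map_inr_fst {z : V'} (h : G.obj A ⟶ z) : G.map c.inr ≫ G.map c.fst ≫ h = 0 := by
  rw [← Category.assoc, ← G.map_comp, c.inr_fst, map_zero' k, Limits.zero_comp]

theorem map_hom_ext {z : V'} {g h : G.obj c.obj ⟶ z} (hl : G.map c.inl ≫ g = G.map c.inl ≫ h)
    (hr : G.map c.inr ≫ g = G.map c.inr ≫ h) : g = h := by
  rw [← Category.id_comp g, ← Category.id_comp h, ← G.map_id, ← c.total,
    IsDiff.map_add (k := k), G.map_comp, G.map_comp, Preadditive.add_comp,
    Preadditive.add_comp, Category.assoc, Category.assoc, Category.assoc, Category.assoc, hl, hr]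

theorem d_map_inl : d k (G.map c.inl) = G.map f ≫ G.map c.inr := by
  rw [← IsDiff.map_d, c.d_inl, G.map_comp]

theorem d_map_inr : d k (G.map c.inr) = 0 := by
  rw [← IsDiff.map_d, c.d_inr, map_zero' k]

end ConeData

/-! ### Columns of `π'`, of `E(f)` and of `τ` -/

section Sigma

variable {S : SigmaData k V} {m : V} {π : S.E₂.obj m ⟶ S.E₁.obj m} (c : ConeData k π)

theorem inl_diagStepπ : S.E₂.map c.inl ≫ diagStepπ c =
    S.τ₂.app m ≫ S.E₂.map π ≫ S.σ.app m ≫ S.E₁.map c.inl := by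
  simp only [diagStepπ, Preadditive.comp_add, c.map_inl_fst, c.map_inl_snd, Category.assoc,
    add_zero]

theorem inr_diagStepπ : S.E₂.map c.inr ≫ diagStepπ c =
    S.σ.app m ≫ S.E₁.map c.inl + S.σ.app m ≫ S.E₁.map π ≫ S.τ₁.app m ≫ S.E₁.map c.inr := by
  simp only [diagStepπ, Preadditive.comp_add, c.map_inr_fst, c.map_inr_snd, Category.assoc,
    zero_add]

variable {m' : V} {π' : S.E₂.obj m' ⟶ S.E₁.obj m'} (c' : ConeData k π')

theorem inl_diagMap (f : m ⟶ m') : c.inl ≫ diagMap c c' f = S.E₂.map f ≫ c'.inl := by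
  simp only [diagMap, Preadditive.comp_add, c.inl_fst', c.inl_snd', add_zero]

theorem inr_diagMap (f : m ⟶ m') : c.inr ≫ diagMap c c' f = S.E₁.map f ≫ c'.inr := by
  simp only [diagMap, Preadditive.comp_add, c.inr_fst', c.inr_snd', zero_add]

theorem diagMap_add (f g : m ⟶ m') : diagMap c c' (f + g) = diagMap c c' f + diagMap c c' g := by
  simp only [diagMap, IsDiff.map_add (k := k), Preadditive.comp_add, Preadditive.add_comp]
  abel

theorem diagMap_smul (a : k) (f : m ⟶ m') : diagMap c c' (a • f) = a • diagMap c c' f := by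
  simp only [diagMap, IsDiff.map_smul, Linear.comp_smul, Linear.smul_comp, smul_add]

/-- The twists of the two cones contribute `E₁f ∘ π` and `π' ∘ E₂f`, which cancel in characteristic
2 because `f` is a morphism. -/
theorem d_diagMap [CharP k 2] {f : m ⟶ m'} (hf : IsDiagHom π π' f) :
    diagMap c c' (d k f) = d k (diagMap c c' f) := by
  have h : π ≫ S.E₁.map f = S.E₂.map f ≫ π' := hf
  simp only [diagMap, map_add, d_comp, c.d_fst, c.d_snd, c'.d_inl, c'.d_inr, Limits.zero_comp,
    Limits.comp_zero, zero_add, add_zero, IsDiff.map_d (k := k), Preadditive.comp_add, Category.assoc,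
    reassoc_of% h]
  rw [add_assoc, ← add_assoc (c.fst ≫ S.E₂.map f ≫ _), add_self k, zero_add]

/-! ### The operator `τ` on a double cone -/

section Tau

variable [∀ x, IsIso (S.σ.app x)] {π₁ : S.E₂.obj c.obj ⟶ S.E₁.obj c.obj} (c₁ : ConeData k π₁)

theorem inl_inl_tauMatrix : S.E₂.map c.inl ≫ c₁.inl ≫ tauMatrix c c₁ =
    S.τ₂.app m ≫ S.E₂.map c.inl ≫ c₁.inl := by
  simp only [tauMatrix, Preadditive.comp_add, c₁.inl_fst', c₁.inl_snd', c.map_inl_fst,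
    add_zero]

theorem inr_inl_tauMatrix : S.E₂.map c.inr ≫ c₁.inl ≫ tauMatrix c c₁ = 0 := by
  simp only [tauMatrix, Preadditive.comp_add, c₁.inl_fst', c₁.inl_snd', c.map_inr_fst,
    add_zero]

theorem inl_inr_tauMatrix : S.E₁.map c.inl ≫ c₁.inr ≫ tauMatrix c c₁ =
    inv (S.σ.app m) ≫ S.E₂.map c.inr ≫ c₁.inl := by
  simp only [tauMatrix, Preadditive.comp_add, c₁.inr_fst', c₁.inr_snd', c.map_inl_fst,
    c.map_inl_snd, add_zero, zero_add]

theorem inr_inr_tauMatrix : S.E₁.map c.inr ≫ c₁.inr ≫ tauMatrix c c₁ =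
    S.τ₁.app m ≫ S.E₁.map c.inr ≫ c₁.inr := by
  simp only [tauMatrix, Preadditive.comp_add, c₁.inr_fst', c₁.inr_snd', c.map_inr_fst,
    c.map_inr_snd, zero_add]

variable {c c₁} in
-- The four columns of a matrix on `E₂² ⊕ E₂E₁ ⊕ E₁E₂ ⊕ E₁²`.
theorem hom_ext_step {z : V} {g h : c₁.obj ⟶ z}
    (h₁ : S.E₂.map c.inl ≫ c₁.inl ≫ g = S.E₂.map c.inl ≫ c₁.inl ≫ h)
    (h₂ : S.E₂.map c.inr ≫ c₁.inl ≫ g = S.E₂.map c.inr ≫ c₁.inl ≫ h)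
    (h₃ : S.E₁.map c.inl ≫ c₁.inr ≫ g = S.E₁.map c.inl ≫ c₁.inr ≫ h)
    (h₄ : S.E₁.map c.inr ≫ c₁.inr ≫ g = S.E₁.map c.inr ≫ c₁.inr ≫ h) : g = h :=
  c₁.hom_ext (c.map_hom_ext S.E₂ h₁ h₂) (c.map_hom_ext S.E₁ h₃ h₄)

variable {c c₁} in
theorem map_hom_ext_step (G : V ⥤ V) [IsDiff k G] {z : V} {g h : G.obj c₁.obj ⟶ z}
    (h₁ : G.map (S.E₂.map c.inl) ≫ G.map c₁.inl ≫ g = G.map (S.E₂.map c.inl) ≫ G.map c₁.inl ≫ h)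
    (h₂ : G.map (S.E₂.map c.inr) ≫ G.map c₁.inl ≫ g = G.map (S.E₂.map c.inr) ≫ G.map c₁.inl ≫ h)
    (h₃ : G.map (S.E₁.map c.inl) ≫ G.map c₁.inr ≫ g = G.map (S.E₁.map c.inl) ≫ G.map c₁.inr ≫ h)
    (h₄ : G.map (S.E₁.map c.inr) ≫ G.map c₁.inr ≫ g = G.map (S.E₁.map c.inr) ≫ G.map c₁.inr ≫ h) :
    g = h :=
  c₁.map_hom_ext G (c.map_hom_ext (S.E₂ ⋙ G) h₁ h₂) (c.map_hom_ext (S.E₁ ⋙ G) h₃ h₄)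

/-- No condition relates `π₁` and `π₁'`: only naturality of `τ₁`, `τ₂` and `σ` is used. This freedom
allows the same statement to serve `Δ_σ`, `Δ_λ` and the comparison between them. -/
theorem tauMatrix_nat {π₁' : S.E₂.obj c'.obj ⟶ S.E₁.obj c'.obj} (c₁' : ConeData k π₁')
    (f : m ⟶ m') :
    diagMap c₁ c₁' (diagMap c c' f) ≫ tauMatrix c' c₁' =
      tauMatrix c c₁ ≫ diagMap c₁ c₁' (diagMap c c' f) := by
  have e₁ := inl_diagMap c₁ c₁' (diagMap c c' f)
  have e₂ := inr_diagMap c₁ c₁' (diagMap c c' f)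
  have a₁ := congrArg S.E₂.map (inl_diagMap c c' f)
  have a₂ := congrArg S.E₂.map (inr_diagMap c c' f)
  have a₃ := congrArg S.E₁.map (inl_diagMap c c' f)
  have a₄ := congrArg S.E₁.map (inr_diagMap c c' f)
  have b₁ := inl_inl_tauMatrix c c₁
  have b₂ := inr_inl_tauMatrix c c₁
  have b₃ := inl_inr_tauMatrix c c₁
  have b₄ := inr_inr_tauMatrix c c₁
  have b₁' := inl_inl_tauMatrix c' c₁'
  have b₂' := inr_inl_tauMatrix c' c₁'
  have b₃' := inl_inr_tauMatrix c' c₁'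
  have b₄' := inr_inr_tauMatrix c' c₁'
  have n₁ := cross_nat S.τ₁ f
  have n₂ := cross_nat S.τ₂ f
  have n₃ := cross_nat S.σ f
  dsimp at *
  simp only [Functor.map_comp] at *
  refine hom_ext_step ?_ ?_ ?_ ?_
  · rw [reassoc_of% e₁, reassoc_of% a₁, b₁', reassoc_of% b₁, e₁, reassoc_of% a₁, reassoc_of% n₂]
  · rw [reassoc_of% e₁, reassoc_of% a₂, b₂', reassoc_of% b₂, Limits.comp_zero, Limits.zero_comp]
  · rw [reassoc_of% e₂, reassoc_of% a₃, b₃', reassoc_of% b₃, e₁, reassoc_of% a₂,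
      IsIso.eq_inv_comp, ← reassoc_of% n₃, IsIso.hom_inv_id_assoc]
  · rw [reassoc_of% e₂, reassoc_of% a₄, b₄', reassoc_of% b₄, e₂, reassoc_of% a₄, reassoc_of% n₁]

/-- The entry `σ⁻¹` lands in `E₂E₁`, whose column is zero; the other two entries square to zero. -/
theorem tauMatrix_sq (hS : S.Compatible) : tauMatrix c c₁ ≫ tauMatrix c c₁ = 0 := by
  have b₁ := inl_inl_tauMatrix c c₁
  have b₂ := inr_inl_tauMatrix c c₁
  have b₃ := inl_inr_tauMatrix c c₁
  have b₄ := inr_inr_tauMatrix c c₁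
  have n₁ := hS.rep₁.sq m
  have n₂ := hS.rep₂.sq m
  dsimp at *
  refine hom_ext_step ?_ ?_ ?_ ?_ <;> simp only [Limits.comp_zero]
  · rw [reassoc_of% b₁, b₁, reassoc_of% n₂, Limits.zero_comp]
  · rw [reassoc_of% b₂, Limits.zero_comp]
  · rw [reassoc_of% b₃, b₂, Limits.comp_zero]
  · rw [reassoc_of% b₄, b₄, reassoc_of% n₁, Limits.zero_comp]

theorem tauMatrix_braid (hS : S.Compatible) {π₂ : S.E₂.obj c₁.obj ⟶ S.E₁.obj c₁.obj}
    (c₂ : ConeData k π₂) :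
    diagMap c₂ c₂ (tauMatrix c c₁) ≫ tauMatrix c₁ c₂ ≫ diagMap c₂ c₂ (tauMatrix c c₁) =
      tauMatrix c₁ c₂ ≫ diagMap c₂ c₂ (tauMatrix c c₁) ≫ tauMatrix c₁ c₂ := by
  have e₁ := inl_diagMap c₂ c₂ (tauMatrix c c₁)
  have e₂ := inr_diagMap c₂ c₂ (tauMatrix c c₁)
  have a₁ := congrArg S.E₂.map (inl_inl_tauMatrix c c₁)
  have a₂ := congrArg S.E₂.map (inr_inl_tauMatrix c c₁)
  have a₃ := congrArg S.E₂.map (inl_inr_tauMatrix c c₁)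
  have a₄ := congrArg S.E₂.map (inr_inr_tauMatrix c c₁)
  have a₅ := congrArg S.E₁.map (inl_inl_tauMatrix c c₁)
  have a₆ := congrArg S.E₁.map (inr_inl_tauMatrix c c₁)
  have a₇ := congrArg S.E₁.map (inl_inr_tauMatrix c c₁)
  have a₈ := congrArg S.E₁.map (inr_inr_tauMatrix c c₁)
  have b₁ := inl_inl_tauMatrix c₁ c₂
  have b₂ := inr_inl_tauMatrix c₁ c₂
  have b₃ := inl_inr_tauMatrix c₁ c₂
  have b₄ := inr_inr_tauMatrix c₁ c₂
  have n₁ := cross_nat S.τ₂ c.inl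
  have n₂ := cross_nat S.τ₂ c.inr
  have n₃ := cross_nat S.τ₁ c.inl
  have n₄ := cross_nat S.τ₁ c.inr
  have n₅ : S.E₁.map (S.E₂.map c.inl) ≫ inv (S.σ.app c.obj) =
      inv (S.σ.app (S.E₂.obj m)) ≫ S.E₂.map (S.E₁.map c.inl) := by
    rw [IsIso.eq_inv_comp, ← Category.assoc, IsIso.comp_inv_eq]
    exact (cross_nat S.σ c.inl).symm
  have n₆ : S.E₁.map (S.E₂.map c.inr) ≫ inv (S.σ.app c.obj) =
      inv (S.σ.app (S.E₁.obj m)) ≫ S.E₂.map (S.E₁.map c.inr) := by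
    rw [IsIso.eq_inv_comp, ← Category.assoc, IsIso.comp_inv_eq]
    exact (cross_nat S.σ c.inr).symm
  have r₁ := hS.rep₁.braid m
  have r₂ := hS.rep₂.braid m
  have r₃ := hS.comm₂ m
  have r₄ := hS.comm₁ m
  dsimp at *
  simp only [Functor.map_comp, map_zero' k, Functor.map_inv] at *
  -- The eight columns are the words of length three in `E₂` and `E₁`. Both sides vanish on
  -- `E₂E₂E₁`, `E₂E₁E₂`, `E₂E₁E₁` and `E₁E₂E₁`; `E₂³` and `E₁³` give the braid relations, `E₁E₂E₂`
  -- and `E₁E₁E₂` the compatibilities of `σ` with `τ₂` and `τ₁`.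
  refine c₂.hom_ext (map_hom_ext_step (c := c) (c₁ := c₁) S.E₂ ?_ ?_ ?_ ?_)
    (map_hom_ext_step (c := c) (c₁ := c₁) S.E₁ ?_ ?_ ?_ ?_)
  · rw [reassoc_of% e₁, reassoc_of% a₁, reassoc_of% b₁, reassoc_of% n₁, e₁, reassoc_of% a₁]
    rw [reassoc_of% b₁, reassoc_of% n₁, reassoc_of% e₁, reassoc_of% a₁, b₁, reassoc_of% n₁]
    rw [reassoc_of% r₂]
  · rw [reassoc_of% e₁, reassoc_of% a₂]
    rw [reassoc_of% b₁, reassoc_of% n₂, reassoc_of% e₁, reassoc_of% a₂]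
    simp only [Limits.zero_comp, Limits.comp_zero]
  · rw [reassoc_of% e₁, reassoc_of% a₃, reassoc_of% b₁, reassoc_of% n₂, e₁, reassoc_of% a₂]
    rw [reassoc_of% b₂]
    simp only [Limits.zero_comp, Limits.comp_zero]
  · rw [reassoc_of% e₁, reassoc_of% a₄, reassoc_of% b₂]
    rw [reassoc_of% b₂]
    simp only [Limits.zero_comp, Limits.comp_zero]
  · rw [reassoc_of% e₂, reassoc_of% a₅, reassoc_of% b₃, reassoc_of% n₅, e₁, reassoc_of% a₃]
    rw [reassoc_of% b₃, reassoc_of% n₅, reassoc_of% e₁, reassoc_of% a₃, b₁, reassoc_of% n₂]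
    -- Composing with the isomorphisms `σ` clears the inverses, and what remains is `comm₂`.
    rw [← cancel_epi (S.σ.app (S.E₂.obj m)), ← cancel_epi (S.E₂.map (S.σ.app m))]
    simp only [IsIso.hom_inv_id_assoc, reassoc_of% r₃]
  · rw [reassoc_of% e₂, reassoc_of% a₆]
    rw [reassoc_of% b₃, reassoc_of% n₆, reassoc_of% e₁, reassoc_of% a₄, b₂]
    simp only [Limits.zero_comp, Limits.comp_zero]
  · rw [reassoc_of% e₂, reassoc_of% a₇, reassoc_of% b₃, reassoc_of% n₆, e₁, reassoc_of% a₄]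
    rw [reassoc_of% b₄, reassoc_of% n₃, reassoc_of% e₂, reassoc_of% a₇, b₃, reassoc_of% n₆]
    rw [← cancel_epi (S.E₁.map (S.σ.app m)), ← cancel_epi (S.σ.app (S.E₁.obj m))]
    simp only [IsIso.hom_inv_id_assoc, reassoc_of% r₄]
  · rw [reassoc_of% e₂, reassoc_of% a₈, reassoc_of% b₄, reassoc_of% n₄, e₂, reassoc_of% a₈]
    rw [reassoc_of% b₄, reassoc_of% n₄, reassoc_of% e₂, reassoc_of% a₈, b₄, reassoc_of% n₄]
    rw [reassoc_of% r₁]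

/-! ### The morphism `π'` -/

/-- The shape of `π'` is used here. On `E₂E₁` and `E₁E₂` the identity comes from composing the entry
`σ` of the twist with the entry `σ⁻¹` of `τ`; on `E₂²` and `E₁²` it comes from `d(τ₂) = 1` and
`d(τ₁) = 1`. The remaining terms cancel or contain a square of `τ₁` or `τ₂`. -/
theorem d_tauMatrix_diagStepπ [CharP k 2] (hS : S.Compatible) (c₁ : ConeData k (diagStepπ c)) :
    d k (tauMatrix c c₁) = 𝟙 _ := by
  have e₁ := congrArg (d k) (inl_inl_tauMatrix c c₁)
  have e₂ := congrArg (d k) (inr_inl_tauMatrix c c₁)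
  have e₃ := congrArg (d k) (inl_inr_tauMatrix c c₁)
  have e₄ := congrArg (d k) (inr_inr_tauMatrix c c₁)
  have b₂ := inr_inl_tauMatrix c c₁
  have b₃ := inl_inr_tauMatrix c c₁
  have b₄ := inr_inr_tauMatrix c c₁
  have p₁ := inl_diagStepπ c
  have p₂ := inr_diagStepπ c
  have r₁ := hS.rep₁.sq m
  have r₂ := hS.rep₂.sq m
  -- The inverse of a closed isomorphism is closed.
  have hi : d k (inv (S.σ.app m)) = 0 := by
    have h := congrArg (d k) (IsIso.hom_inv_id (S.σ.app m))
    rw [d_comp, S.σ_closed, d_id, Limits.zero_comp, zero_add] at h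
    exact (cancel_epi (S.σ.app m)).1 (h.trans Limits.comp_zero.symm)
  simp only [d_comp, c.d_map_inl, c.d_map_inr, hS.rep₁.d_tau, hS.rep₂.d_tau, hi,
    c₁.d_inl, c₁.d_inr, Limits.zero_comp, Limits.comp_zero, add_zero, zero_add,
    Preadditive.comp_add, Preadditive.add_comp, Category.assoc, map_zero,
    reassoc_of% p₁, reassoc_of% p₂] at e₁ e₂ e₃ e₄
  dsimp at *
  simp only [Category.id_comp] at *
  refine hom_ext_step ?_ ?_ ?_ ?_ <;> rw [Category.comp_id]
  · rw [b₂, b₃, reassoc_of% r₂, Limits.comp_zero, Limits.zero_comp, zero_add, add_zero,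
      IsIso.hom_inv_id_assoc, add_comm (S.E₂.map c.inl ≫ c₁.inl)] at e₁
    exact add_left_cancel e₁
  · rw [b₃, b₄, reassoc_of% r₁, Limits.zero_comp, Limits.comp_zero, Limits.comp_zero, add_zero,
      IsIso.hom_inv_id_assoc] at e₂
    exact (eq_of_add k e₂).symm
  · rw [b₄, IsIso.inv_hom_id_assoc, IsIso.inv_hom_id_assoc, add_comm (S.E₁.map c.inl ≫ c₁.inr)]
      at e₃
    exact add_left_cancel e₃
  · exact e₄

end Tau

/-- In the column of `E₂²`, `d(τ₂) = 1` produces the term that cancels the entry `σ`, and the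
remaining terms are the commutation condition on `π`. In the column of `E₂E₁`, `d(τ₁) = 1` cancels
the twist of the cone. -/
theorem diagStepπ_closed [CharP k 2] (hS : S.Compatible) (h : IsDiagObj S m π) :
    d k (diagStepπ c) = 0 := by
  have e₁ := congrArg (d k) (inl_diagStepπ c)
  have e₂ := congrArg (d k) (inr_diagStepπ c)
  have p₂ := inr_diagStepπ c
  have h₂ := h.comm
  have hπ : ∀ (G : V ⥤ V) [IsDiff k G], d k (G.map π) = 0 := fun G _ => d_map_closed k G h.closed
  simp only [d_comp, map_add, hS.rep₁.d_tau, hS.rep₂.d_tau, hπ,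
    S.σ_closed m, c.d_map_inl, c.d_map_inr, Limits.zero_comp, Limits.comp_zero, add_zero, zero_add,
    Preadditive.comp_add, Preadditive.add_comp, Category.assoc] at e₁ e₂
  dsimp at *
  simp only [Category.id_comp] at *
  refine c.map_hom_ext S.E₂ ?_ ?_ <;> rw [Limits.comp_zero]
  · rw [p₂, ← reassoc_of% h₂, Preadditive.comp_add] at e₁
    exact add_eq_left.mp e₁
  · rw [add_self k] at e₂
    exact e₂

/-- On `E₂³` the two sides differ by Yang–Baxter moves and the condition on `π`. On `E₂²E₁` one term
on each side contains `τ₁²` or `τ₂²` and vanishes; the others match in the same way. -/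
theorem diagStepπ_comm (hS : S.Compatible) (h : IsDiagObj S m π) :
    S.E₂.map (diagStepπ c) ≫ S.σ.app c.obj ≫ S.E₁.map (diagStepπ c) ≫ S.τ₁.app c.obj =
      S.τ₂.app c.obj ≫ S.E₂.map (diagStepπ c) ≫ S.σ.app c.obj ≫ S.E₁.map (diagStepπ c) := by
  have p₁ := congrArg S.E₂.map (inl_diagStepπ c)
  have p₂ := congrArg S.E₂.map (inr_diagStepπ c)
  have q₁ := congrArg S.E₁.map (inl_diagStepπ c)
  have q₂ := congrArg S.E₁.map (inr_diagStepπ c)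
  have n₁ := cross_nat S.σ c.inl
  have n₂ := cross_nat S.σ c.inr
  have n₃ := cross_nat S.τ₁ c.inl
  have n₄ := cross_nat S.τ₁ c.inr
  have n₅ := cross_nat S.τ₂ c.inl
  have n₆ := cross_nat S.τ₂ c.inr
  have n₇ := cross_nat S.σ π
  have n₈ := cross_nat S.τ₁ π
  have n₉ := cross_nat S.τ₂ π
  have r₁ := hS.rep₁.braid m
  have r₂ := hS.rep₂.braid m
  have r₃ := hS.comm₁ m
  have r₄ := hS.comm₂ m
  have r₅ := hS.rep₁.sq (S.E₂.obj m)
  have r₆ := hS.rep₂.sq (S.E₁.obj m)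
  have h₁ := congrArg S.E₁.map h.comm
  have h₂ := congrArg S.E₂.map h.comm
  dsimp at *
  simp only [Functor.map_comp, IsDiff.map_add (k := k)] at *
  refine c.map_hom_ext (S.E₂ ⋙ S.E₂) ?_ ?_ <;> dsimp
  · rw [reassoc_of% p₁, reassoc_of% n₁, reassoc_of% q₁, n₃, reassoc_of% r₄, reassoc_of% n₉,
      ← reassoc_of% n₇, reassoc_of% r₃, reassoc_of% h₂, reassoc_of% r₂, reassoc_of% n₅,
      reassoc_of% p₁, reassoc_of% n₁, q₁, reassoc_of% r₄, reassoc_of% n₉, ← reassoc_of% n₇]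
  · simp only [reassoc_of% p₂, reassoc_of% n₆, Preadditive.add_comp, Preadditive.comp_add,
      Category.assoc, reassoc_of% n₁, reassoc_of% n₂, q₁, q₂, reassoc_of% q₁, reassoc_of% q₂, n₃, n₄,
      reassoc_of% r₄, reassoc_of% r₆, Limits.zero_comp, ← reassoc_of% r₃, reassoc_of% r₅,
      Limits.comp_zero, zero_add, add_zero]
    simp only [reassoc_of% n₇, ← reassoc_of% n₈, ← reassoc_of% r₄]
    rw [← reassoc_of% h₁, reassoc_of% r₁]

theorem diagMap_isDiagHom {f : m ⟶ m'} (h : IsDiagHom π π' f) :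
    IsDiagHom (diagStepπ c) (diagStepπ c') (diagMap c c' f) := by
  have h₁ : π ≫ S.E₁.map f = S.E₂.map f ≫ π' := h
  have p₁ := inl_diagStepπ c
  have p₂ := inr_diagStepπ c
  have p₁' := inl_diagStepπ c'
  have p₂' := inr_diagStepπ c'
  have a₁ := congrArg S.E₂.map (inl_diagMap c c' f)
  have a₂ := congrArg S.E₂.map (inr_diagMap c c' f)
  have a₃ := congrArg S.E₁.map (inl_diagMap c c' f)
  have a₄ := congrArg S.E₁.map (inr_diagMap c c' f)
  have n₁ := cross_nat S.τ₁ f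
  have n₂ := cross_nat S.τ₂ f
  have n₃ := cross_nat S.σ f
  have h₂ := congrArg S.E₁.map h₁
  have h₃ := congrArg S.E₂.map h₁
  show diagStepπ c ≫ S.E₁.map _ = S.E₂.map _ ≫ diagStepπ c'
  dsimp at *
  simp only [Functor.map_comp] at *
  refine c.map_hom_ext S.E₂ ?_ ?_
  · rw [reassoc_of% p₁, reassoc_of% a₁, p₁', a₃, reassoc_of% n₂, ← reassoc_of% h₃, reassoc_of% n₃]
  · simp only [reassoc_of% p₂, reassoc_of% a₂, p₂', a₃, a₄, Preadditive.comp_add,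
      Preadditive.add_comp, Category.assoc, reassoc_of% n₃, ← reassoc_of% h₂, reassoc_of% n₁]

theorem tauMatrix_isDiagHom [∀ x, IsIso (S.σ.app x)] (hS : S.Compatible)
    (c₁ : ConeData k (diagStepπ c)) :
    IsDiagHom (diagStepπ c₁) (diagStepπ c₁) (tauMatrix c c₁) := by
  have a₁ := congrArg S.E₂.map (inl_inl_tauMatrix c c₁)
  have a₂ := congrArg S.E₂.map (inr_inl_tauMatrix c c₁)
  have a₃ := congrArg S.E₂.map (inl_inr_tauMatrix c c₁)
  have a₄ := congrArg S.E₂.map (inr_inr_tauMatrix c c₁)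
  have a₅ := congrArg S.E₁.map (inl_inl_tauMatrix c c₁)
  have a₆ := congrArg S.E₁.map (inr_inl_tauMatrix c c₁)
  have a₇ := congrArg S.E₁.map (inl_inr_tauMatrix c c₁)
  have a₈ := congrArg S.E₁.map (inr_inr_tauMatrix c c₁)
  have b₁ := inl_diagStepπ c₁
  have b₂ := inr_diagStepπ c₁
  have p₁ := congrArg S.E₂.map (inl_diagStepπ c)
  have p₂ := congrArg S.E₂.map (inr_diagStepπ c)
  have q₁ := congrArg S.E₁.map (inl_diagStepπ c)
  have q₂ := congrArg S.E₁.map (inr_diagStepπ c)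
  have n₁ := cross_nat S.σ c.inl
  have n₂ := cross_nat S.σ c.inr
  have n₃ := cross_nat S.τ₁ c.inl
  have n₄ := cross_nat S.τ₁ c.inr
  have n₅ := cross_nat S.τ₂ c.inl
  have n₆ := cross_nat S.τ₂ c.inr
  have n₇ := cross_nat S.σ π
  have n₈ := cross_nat S.τ₁ π
  have n₉ := cross_nat S.τ₂ π
  have r₁ := hS.rep₁.braid m
  have r₂ := hS.rep₂.braid m
  have r₃ := hS.comm₁ m
  have r₄ := hS.comm₂ m
  have r₅ := hS.rep₁.sq (S.E₂.obj m)
  have r₆ := hS.rep₂.sq (S.E₁.obj m)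
  show diagStepπ c₁ ≫ S.E₁.map _ = S.E₂.map _ ≫ diagStepπ c₁
  dsimp at *
  simp only [Functor.map_comp, IsDiff.map_add (k := k), map_zero' k,
    Functor.map_inv] at *
  -- `l₁` to `l₄` are the columns of the second iterate of `π'`, each expanded in terms of `m` only.
  have l₁ : S.E₂.map (S.E₂.map c.inl) ≫ S.E₂.map c₁.inl ≫ diagStepπ c₁ =
    S.τ₂.app (S.E₂.obj m) ≫ S.E₂.map (S.τ₂.app m) ≫ S.E₂.map (S.E₂.map π) ≫ S.E₂.map (S.σ.app m) ≫
      S.σ.app (S.E₂.obj m) ≫ S.E₁.map (S.E₂.map c.inl) ≫ S.E₁.map c₁.inl := by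
    rw [b₁, reassoc_of% n₅, reassoc_of% p₁, reassoc_of% n₁]
  have l₂ : S.E₂.map (S.E₂.map c.inr) ≫ S.E₂.map c₁.inl ≫ diagStepπ c₁ =
    S.τ₂.app (S.E₁.obj m) ≫ S.E₂.map (S.σ.app m) ≫
      S.σ.app (S.E₂.obj m) ≫ S.E₁.map (S.E₂.map c.inl) ≫ S.E₁.map c₁.inl +
    S.τ₂.app (S.E₁.obj m) ≫ S.E₂.map (S.σ.app m) ≫ S.E₂.map (S.E₁.map π) ≫
      S.E₂.map (S.τ₁.app m) ≫
      S.σ.app (S.E₁.obj m) ≫ S.E₁.map (S.E₂.map c.inr) ≫ S.E₁.map c₁.inl := by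
    rw [b₁, reassoc_of% n₆, reassoc_of% p₂]
    simp only [Preadditive.add_comp, Preadditive.comp_add, Category.assoc, reassoc_of% n₁,
      reassoc_of% n₂]
  have l₃ : S.E₂.map (S.E₁.map c.inl) ≫ S.E₂.map c₁.inr ≫ diagStepπ c₁ =
      S.σ.app (S.E₂.obj m) ≫ S.E₁.map (S.E₂.map c.inl) ≫ S.E₁.map c₁.inl +
    S.σ.app (S.E₂.obj m) ≫ S.E₁.map (S.τ₂.app m) ≫ S.E₁.map (S.E₂.map π) ≫
      S.E₁.map (S.σ.app m) ≫ S.τ₁.app (S.E₂.obj m) ≫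
      S.E₁.map (S.E₁.map c.inl) ≫ S.E₁.map c₁.inr := by
    rw [b₂]
    simp only [Preadditive.comp_add, reassoc_of% n₁, reassoc_of% q₁, reassoc_of% n₃]
  have l₄ : S.E₂.map (S.E₁.map c.inr) ≫ S.E₂.map c₁.inr ≫ diagStepπ c₁ =
      S.σ.app (S.E₁.obj m) ≫ S.E₁.map (S.E₂.map c.inr) ≫ S.E₁.map c₁.inl +
    (S.σ.app (S.E₁.obj m) ≫ S.E₁.map (S.σ.app m) ≫ S.τ₁.app (S.E₂.obj m) ≫
      S.E₁.map (S.E₁.map c.inl) ≫ S.E₁.map c₁.inr +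
    S.σ.app (S.E₁.obj m) ≫ S.E₁.map (S.σ.app m) ≫ S.E₁.map (S.E₁.map π) ≫
      S.E₁.map (S.τ₁.app m) ≫ S.τ₁.app (S.E₁.obj m) ≫
      S.E₁.map (S.E₁.map c.inr) ≫ S.E₁.map c₁.inr) := by
    rw [b₂]
    simp only [Preadditive.add_comp, Preadditive.comp_add, Category.assoc, reassoc_of% n₂,
      reassoc_of% q₂, reassoc_of% n₃, reassoc_of% n₄]
  refine map_hom_ext_step S.E₂ ?_ ?_ ?_ ?_
  · rw [reassoc_of% l₁, a₅, reassoc_of% a₁, l₁, reassoc_of% r₄, reassoc_of% n₉, reassoc_of% r₂]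
  · simp only [reassoc_of% l₂, a₅, a₆, reassoc_of% a₂, Preadditive.add_comp, Category.assoc,
      reassoc_of% r₄, reassoc_of% r₆, Limits.zero_comp, Limits.comp_zero, add_zero]
  -- Composing with the invertible `E₂σ` removes the `σ⁻¹` in this column of `τ`.
  · rw [← cancel_epi (S.E₂.map (S.σ.app m)), reassoc_of% a₃, IsIso.hom_inv_id_assoc, l₂]
    simp only [reassoc_of% l₃, a₅, a₇, Preadditive.add_comp, Preadditive.comp_add, Category.assoc,
      reassoc_of% r₄]
    rw [← reassoc_of% n₇, reassoc_of% r₃, IsIso.hom_inv_id_assoc]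
  · simp only [reassoc_of% l₄, a₆, a₇, a₈, reassoc_of% a₄, l₄, Preadditive.add_comp,
      Preadditive.comp_add, Category.assoc, Limits.comp_zero, zero_add]
    rw [reassoc_of% r₃, IsIso.hom_inv_id_assoc]
    simp only [← reassoc_of% r₃, reassoc_of% r₅, ← reassoc_of% n₈, reassoc_of% r₁,
      Limits.zero_comp, Limits.comp_zero, zero_add]

theorem isDiagObj_diagStepπ [CharP k 2] (hS : S.Compatible) (h : IsDiagObj S m π) :
    IsDiagObj S c.obj (diagStepπ c) :=
  ⟨diagStepπ_closed c hS h, diagStepπ_comm c hS h⟩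

/-! ### The `2`-representation on `Δ_σ` -/

variable [HasCones k V]

theorem diagStepWellDefined [CharP k 2] (hS : S.Compatible) : DiagStepWellDefined S where
  obj X := isDiagObj_diagStepπ _ hS X.isDiagObj
  map f := diagMap_isDiagHom _ _ f.isDiagHom

variable [∀ x, IsIso (S.σ.app x)]

/-- The endomorphism `τ` of the square of the endofunctor of `Δ_σ`. -/
noncomputable def diagTau (hS : S.Compatible) (h : DiagStepWellDefined S) :
    diagStep h ⋙ diagStep h ⟶ diagStep h ⋙ diagStep h where
  app X := ⟨tauMatrix _ _, tauMatrix_isDiagHom _ hS _⟩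
  naturality _ _ f := DiagHom.ext (tauMatrix_nat _ _ _ _ f.val)

theorem isTwoRep_diagTau [CharP k 2] (hS : S.Compatible) (h : DiagStepWellDefined S) :
    IsTwoRep k (diagStep h) (diagTau hS h) where
  isDiff :=
    { map_add := fun f g => DiagHom.ext (diagMap_add _ _ f.val g.val)
      map_smul := fun a f => DiagHom.ext (diagMap_smul _ _ a f.val)
      map_d := fun f => DiagHom.ext (d_diagMap _ _ f.isDiagHom) }
  d_tau _ := DiagHom.ext (d_tauMatrix_diagStepπ _ hS _)
  sq _ := DiagHom.ext (tauMatrix_sq _ _ hS)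
  braid _ := DiagHom.ext (tauMatrix_braid _ _ hS _)

end Sigma
end ConeMatrices

section Words

/-! ### Words `Aⁿ Fⁿ` -/

variable {V : Type u} [Category.{v} V] {F A G H : V ⥤ V}

theorem slide_one (s : G ⋙ A ⟶ A ⋙ G) (x : V) : slide s 1 x = s.app x := by
  simp [slide]

theorem powConcat_one_left (E : V ⥤ V) (n : ℕ) (h : n + 1 = n + 1) (x : V) :
    powConcat E 1 n (n + 1) h x = 𝟙 _ := by
  rw [powConcat_succ_left, powConcat_zero_left]
  exact E.map_id _

/-- Sliding `E` through its own iterate is pulling the last strand to the front, which makes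
`d_heckeFront` and the equivariance of `ς` applicable. -/
theorem slide_eq_heckeFront {E : V ⥤ V} (τ : E ⋙ E ⟶ E ⋙ E) (n : ℕ) (x : V) :
    slide τ n x = powConcat E n 1 (n + 1) (by omega) x ≫ heckeFront τ (n + 1) n x := by
  have h := powConcat_heckeFront_right τ n 0 n 0 (by omega) x
  rw [powConcat_zero_right, E.map_id] at h
  simpa [heckeFront_one] using h

/-- The morphism `Fⁱ Aⁿ ⟶ Aⁿ Fⁱ` for `i = 1`. -/
def push (l : A ⋙ F ⟶ F ⋙ A) : (n : ℕ) → (x : V) →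
    (F.obj ((pow A n).obj x) ⟶ (pow A n).obj (F.obj x))
  | 0, _ => 𝟙 _
  | n + 1, x => l.app ((pow A n).obj x) ≫ A.map (push l n x)

theorem slidePow_one_left (l : A ⋙ F ⟶ F ⋙ A) (n : ℕ) (x : V) :
    slidePow l 1 n x = push l n x := by
  induction n with
  | zero => rfl
  | succ n ih =>
    show slide l 1 _ ≫ A.map (slidePow l 1 n x) = _
    rw [ih, slide_one]
    rfl

theorem slidePow_one_right (l : A ⋙ F ⟶ F ⋙ A) (n : ℕ) (x : V) :
    slidePow l n 1 x = slide l n x := by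
  show slide l n _ ≫ A.map (𝟙 _) = _
  rw [A.map_id]
  exact Category.comp_id _

theorem push_nat (l : A ⋙ F ⟶ F ⋙ A) (n : ℕ) {x y : V} (f : x ⟶ y) :
    F.map ((pow A n).map f) ≫ push l n y = push l n x ≫ (pow A n).map (F.map f) := by
  have h := slidePow_nat l 1 n f
  rw [slidePow_one_left, slidePow_one_left] at h
  exact h

theorem push_powConcat (l : A ⋙ F ⟶ F ⋙ A) (n : ℕ) (x : V) :
    push l n (A.obj x) ≫ (pow A n).map (l.app x) ≫
        powConcat A n 1 (n + 1) (by omega) (F.obj x) =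
      F.map (powConcat A n 1 (n + 1) (by omega) x) ≫ push l (n + 1) x := by
  induction n with
  | zero =>
    simp [push, powConcat_zero_left]
  | succ n ih =>
    have h := cross_nat l (powConcat A n 1 (n + 1) (by omega) x)
    have h2 := congrArg A.map ih
    rw [powConcat_succ_left, powConcat_succ_left]
    show (l.app _ ≫ A.map (push l n _)) ≫ A.map ((pow A n).map (l.app x)) ≫ _ =
      F.map (A.map _) ≫ l.app _ ≫ A.map (push l (n + 1) x)
    dsimp at *
    simp only [Functor.map_comp, Category.assoc] at *
    rw [h2, reassoc_of% h]

/-- The morphism `Aⁿ Fⁿ G ⟶ G Aⁿ Fⁿ` at `x`. -/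
def wordSlide (sF : G ⋙ F ⟶ F ⋙ G) (sA : G ⋙ A ⟶ A ⋙ G) (n : ℕ) (x : V) :
    (pow A n).obj ((pow F n).obj (G.obj x)) ⟶ G.obj ((pow A n).obj ((pow F n).obj x)) :=
  (pow A n).map (slide sF n x) ≫ slide sA n ((pow F n).obj x)

section

variable (sF : G ⋙ F ⟶ F ⋙ G) (sA : G ⋙ A ⟶ A ⋙ G)

theorem wordSlide_nat (n : ℕ) {x y : V} (f : x ⟶ y) :
    (pow A n).map ((pow F n).map (G.map f)) ≫ wordSlide sF sA n y =
      wordSlide sF sA n x ≫ G.map ((pow A n).map ((pow F n).map f)) := by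
  have h1 := congrArg (pow A n).map (slide_nat sF n f)
  have h2 := slide_nat sA n ((pow F n).map f)
  simp only [Functor.map_comp] at h1
  simp only [wordSlide, Category.assoc]
  rw [reassoc_of% h1, h2]

end

variable {sF : G ⋙ F ⟶ F ⋙ G} {sA : G ⋙ A ⟶ A ⋙ G}

theorem hecke_wordSlide_left {τ : A ⋙ A ⟶ A ⋙ A}
    (h : ∀ x, A.map (sA.app x) ≫ sA.app (A.obj x) ≫ G.map (τ.app x) =
      τ.app (G.obj x) ≫ A.map (sA.app x) ≫ sA.app (A.obj x)) (n r : ℕ) (x : V) :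
    hecke τ n r ((pow F n).obj (G.obj x)) ≫ wordSlide sF sA n x =
      wordSlide sF sA n x ≫ G.map (hecke τ n r ((pow F n).obj x)) := by
  have h1 := hecke_nat τ n r (slide sF n x)
  have h2 := hecke_slide h n r ((pow F n).obj x)
  simp only [wordSlide, Category.assoc]
  rw [← reassoc_of% h1, h2]

theorem hecke_wordSlide_right {τ : F ⋙ F ⟶ F ⋙ F}
    (h : ∀ x, F.map (sF.app x) ≫ sF.app (F.obj x) ≫ G.map (τ.app x) =
      τ.app (G.obj x) ≫ F.map (sF.app x) ≫ sF.app (F.obj x)) (n r : ℕ) (x : V) :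
    (pow A n).map (hecke τ n r (G.obj x)) ≫ wordSlide sF sA n x =
      wordSlide sF sA n x ≫ G.map ((pow A n).map (hecke τ n r x)) := by
  have h1 := slide_nat sA n (hecke τ n r x)
  have h2 := congrArg (pow A n).map (hecke_slide h n r x)
  simp only [Functor.map_comp] at h2
  simp only [wordSlide, Category.assoc]
  rw [reassoc_of% h2, h1]

theorem wordSlide_cross {sF' : H ⋙ F ⟶ F ⋙ H} {sA' : H ⋙ A ⟶ A ⋙ H} {t : H ⋙ G ⟶ G ⋙ H}
    (hF : ∀ x, F.map (t.app x) ≫ sF'.app (G.obj x) ≫ H.map (sF.app x) =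
      sF.app (H.obj x) ≫ G.map (sF'.app x) ≫ t.app (F.obj x))
    (hA : ∀ x, A.map (t.app x) ≫ sA'.app (G.obj x) ≫ H.map (sA.app x) =
      sA.app (H.obj x) ≫ G.map (sA'.app x) ≫ t.app (A.obj x)) (n : ℕ) (x : V) :
    (pow A n).map ((pow F n).map (t.app x)) ≫ wordSlide sF' sA' n (G.obj x) ≫
        H.map (wordSlide sF sA n x) =
      wordSlide sF sA n (H.obj x) ≫ G.map (wordSlide sF' sA' n x) ≫
        t.app ((pow A n).obj ((pow F n).obj x)) := by
  have h1 := congrArg (pow A n).map (slide_cross hF n x)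
  have h2 := slide_cross hA n ((pow F n).obj x)
  have h3 := slide_nat sA' n (slide sF n x)
  have h4 := slide_nat sA n (slide sF' n x)
  simp only [Functor.map_comp] at h1
  simp only [wordSlide, Functor.map_comp, Category.assoc]
  rw [← reassoc_of% h3, reassoc_of% h1, h2, reassoc_of% h4]

/-- The morphism `Aⁱ Fⁱ Aʲ Fʲ ⟶ Aⁿ Fⁿ` for `j + i = n`. -/
def wordMul (l : A ⋙ F ⟶ F ⋙ A) (i j n : ℕ) (h : j + i = n) (x : V) :
    (pow A i).obj ((pow F i).obj ((pow A j).obj ((pow F j).obj x))) ⟶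
      (pow A n).obj ((pow F n).obj x) :=
  (pow A i).map (slidePow l i j ((pow F j).obj x)) ≫
    powConcat A i j n h ((pow F i).obj ((pow F j).obj x)) ≫
    (pow A n).map (powConcat F i j n h x)

theorem wordMul_zero_left (l : A ⋙ F ⟶ F ⋙ A) (n : ℕ) (h : n + 0 = n) (x : V) :
    wordMul l 0 n n h x = 𝟙 _ := by
  rw [wordMul, powConcat_zero_left, powConcat_zero_left, slidePow_zero_left,
    CategoryTheory.Functor.map_id, CategoryTheory.Functor.map_id]
  simp

theorem wordMul_zero_right (l : A ⋙ F ⟶ F ⋙ A) (n : ℕ) (h : 0 + n = n) (x : V) :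
    wordMul l n 0 n h x = 𝟙 _ := by
  rw [wordMul, powConcat_zero_right, powConcat_zero_right, CategoryTheory.Functor.map_id]
  show (pow A n).map (𝟙 _) ≫ _ = _
  rw [CategoryTheory.Functor.map_id]
  simp

theorem wordMul_nat (l : A ⋙ F ⟶ F ⋙ A) (i j n : ℕ) (h : j + i = n) {x y : V} (f : x ⟶ y) :
    (pow A i).map ((pow F i).map ((pow A j).map ((pow F j).map f))) ≫ wordMul l i j n h y =
      wordMul l i j n h x ≫ (pow A n).map ((pow F n).map f) := by
  have h1 := congrArg (pow A i).map (slidePow_nat l i j ((pow F j).map f))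
  have h2 := powConcat_nat A i j n h ((pow F i).map ((pow F j).map f))
  have h3 := congrArg (pow A n).map (powConcat_nat F i j n h f)
  simp only [Functor.map_comp] at h1 h3
  simp only [wordMul, Category.assoc]
  rw [reassoc_of% h1, reassoc_of% h2, h3]

/-- A strand `G` may pass two words separately or their product; `hl` is the Yang–Baxter relation
for `F`, `A`, `G`. -/
theorem wordMul_wordSlide {l : A ⋙ F ⟶ F ⋙ A}
    (hl : ∀ x, F.map (sA.app x) ≫ sF.app (A.obj x) ≫ G.map (l.app x) =
      l.app (G.obj x) ≫ A.map (sF.app x) ≫ sA.app (F.obj x)) (i j n : ℕ) (h : j + i = n) (x : V) :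
    (pow A i).map ((pow F i).map (wordSlide sF sA j x)) ≫
        wordSlide sF sA i ((pow A j).obj ((pow F j).obj x)) ≫ G.map (wordMul l i j n h x) =
      wordMul l i j n h (G.obj x) ≫ wordSlide sF sA n x := by
  have h1 := congrArg (pow A i).map (slidePow_slide hl i j ((pow F j).obj x))
  have h2 := slide_nat sA i (slidePow l i j ((pow F j).obj x))
  have h3 := congrArg (pow A i).map (slidePow_nat l i j (slide sF j x))
  have h4 := slide_powConcat sA i j n h ((pow F i).obj ((pow F j).obj x))
  have h5 := slide_nat sA n (powConcat F i j n h x)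
  have h6 := congrArg (pow A n).map (slide_powConcat sF i j n h x)
  have h7 := powConcat_nat A i j n h (slide sF i ((pow F j).obj x))
  have h8 := powConcat_nat A i j n h ((pow F i).map (slide sF j x))
  simp only [Functor.map_comp] at *
  simp only [wordMul, wordSlide, Functor.map_comp, Category.assoc]
  rw [← reassoc_of% h2, reassoc_of% h1, reassoc_of% h4, ← h5, reassoc_of% h3, reassoc_of% h7,
    reassoc_of% h8, reassoc_of% h6]

end Words

section DualObjects

variable {k : Type w} [Field k] {V : Type u} [Category.{v} V] [Preadditive V] [Linear k V]
  [DiffCategory k V]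

/-! ### Consequences of the axioms of `Δ_λ` -/

theorem LambdaSetup.μ_eq (D : LambdaSetup k V) (i j : ℕ) (x : V) :
    D.μ i j x = wordMul D.lam i j (j + i) rfl x := by
  simp only [wordMul, LambdaSetup.μ, powConcat, powCast, eqToHom_refl]
  simp

namespace IsDualObj

variable {D : LambdaSetup k V} {m : V} {ς : ∀ i, (D.EF i).obj m ⟶ m} (h : IsDualObj D m ς)
include h

/-- The convention `ς 0 = 𝟙` extends multiplicativity to `i = 0` and `j = 0`, which is needed
because the off-diagonal entry involves `ς_{i-1}`. -/
theorem wordMul_comp (i j n : ℕ) (hn : j + i = n) :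
    (pow D.E₂ i).map ((pow D.F₁ i).map (ς j)) ≫ ς i = wordMul D.lam i j n hn m ≫ ς n := by
  rcases Nat.eq_zero_or_pos i with rfl | hi
  · obtain rfl : n = j := by omega
    rw [wordMul_zero_left, h.zero]
    simp
  rcases Nat.eq_zero_or_pos j with rfl | hj
  · obtain rfl : n = i := by omega
    rw [wordMul_zero_right, h.zero]
    simp
  · subst hn
    have h1 := h.mul i j hi hj
    rw [← D.μ_eq]
    exact h1

theorem push_comp (n : ℕ) :
    D.E₂.map (D.F₁.map (ς n)) ≫ ς 1 =
      D.E₂.map (push D.lam n ((pow D.F₁ n).obj m)) ≫ ς (n + 1) := by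
  have h1 := h.wordMul_comp 1 n (n + 1) rfl
  rw [wordMul, powConcat_one_left, powConcat_one_left, slidePow_one_left,
      CategoryTheory.Functor.map_id] at h1
  simpa using h1

theorem slide_comp (n : ℕ) :
    (pow D.E₂ n).map ((pow D.F₁ n).map (ς 1)) ≫ ς n =
      (pow D.E₂ n).map (slide D.lam n (D.F₁.obj m)) ≫
        powConcat D.E₂ n 1 (n + 1) (by omega) ((pow D.F₁ n).obj (D.F₁.obj m)) ≫
        (pow D.E₂ (n + 1)).map (powConcat D.F₁ n 1 (n + 1) (by omega) m) ≫ ς (n + 1) := by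
  have h1 := h.wordMul_comp n 1 (n + 1) (by omega)
  rw [wordMul, slidePow_one_right] at h1
  simpa using h1

/-- Equivariance used one crossing at a time. Trading operators on `E₂ⁿ` for operators on `F₁ⁿ`
reverses their order, hence `heckeDown` against `heckeBack`. -/
theorem heckeDown_comp (n r l : ℕ) (hn : r + l < n) :
    heckeDown D.τ₂ n r l ((pow D.F₁ n).obj m) ≫ ς n =
      (pow D.E₂ n).map (heckeBack D.τF n r l m) ≫ ς n := by
  induction l with
  | zero => simp [heckeDown, heckeBack]
  | succ l ih =>
    have h1 := h.equivariant n (r + l) hn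
    have h2 := hecke_nat D.τ₂ n (r + l) (heckeBack D.τF n r l m)
    rw [heckeBack_snoc, Functor.map_comp]
    simp only [heckeDown, Category.assoc]
    rw [ih (by omega), ← reassoc_of% h2, h1]

theorem heckeFront_comp (n r : ℕ) (hn : r < n) :
    heckeFront D.τ₂ n r ((pow D.F₁ n).obj m) ≫ ς n =
      (pow D.E₂ n).map (heckeBack D.τF n 0 r m) ≫ ς n := by
  have e : ∀ r, heckeFront D.τ₂ n r ((pow D.F₁ n).obj m) =
      heckeDown D.τ₂ n 0 r ((pow D.F₁ n).obj m) := by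
    intro r
    induction r with
    | zero => rfl
    | succ r ih => rw [heckeFront, heckeDown, ih, Nat.zero_add]
  rw [e, h.heckeDown_comp n 0 r (by omega)]

end IsDualObj

end DualObjects

section OffDiagonal

variable {k : Type w} [Field k] {V : Type u} [Category.{v} V] [Preadditive V] [Linear k V]
  [DiffCategory k V]

/-! ### The off-diagonal entry -/

namespace DualSetup

variable (D : DualSetup k V)

/-- The summand `E₂ⁿ⁺¹ F₁ⁿ⁺¹ E₁ ⟶ E₂ E₂ⁿ F₁ⁿ` of the off-diagonal entry, at `x`. -/
def offTerm (n r : ℕ) (x : V) :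
    (pow D.E₂ (n + 1)).obj ((pow D.F₁ (n + 1)).obj (D.E₁.obj x)) ⟶
      D.E₂.obj ((pow D.E₂ n).obj ((pow D.F₁ n).obj x)) :=
  heckeFront D.τ₂ (n + 1) r ((pow D.F₁ (n + 1)).obj (D.E₁.obj x)) ≫
    D.E₂.map ((pow D.E₂ n).map (heckeCounit D.τF D.adj.counit n r x))

/-- The sum over `r` of the summands of the off-diagonal entry. -/
def offSlide (n : ℕ) (x : V) :
    (pow D.E₂ (n + 1)).obj ((pow D.F₁ (n + 1)).obj (D.E₁.obj x)) ⟶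
      D.E₂.obj ((pow D.E₂ n).obj ((pow D.F₁ n).obj x)) :=
  ∑ r ∈ Finset.range (n + 1), D.offTerm n r x

/-- Puts the off-diagonal entry in the shape of the diagonal ones: a map that carries the word past
a letter, here losing one `E₂` and one `F₁`, followed by `ς`. -/
theorem stepOffDiag_succ {m : V} (ς : ∀ i, (D.EF i).obj m ⟶ m) (n : ℕ) :
    D.stepOffDiag ς (n + 1) = D.offSlide n m ≫ D.E₂.map (ς n) := by
  rw [offSlide, Preadditive.sum_comp]
  refine Finset.sum_congr rfl fun r hr => ?_
  rw [offTerm, ← heckeBack_counitPow (Finset.mem_range_succ_iff.1 hr)]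
  simp

theorem offTerm_nat (n r : ℕ) {x y : V} (f : x ⟶ y) :
    (pow D.E₂ (n + 1)).map ((pow D.F₁ (n + 1)).map (D.E₁.map f)) ≫ D.offTerm n r y =
      D.offTerm n r x ≫ D.E₂.map ((pow D.E₂ n).map ((pow D.F₁ n).map f)) := by
  have h1 := heckeFront_nat D.τ₂ (n + 1) r ((pow D.F₁ (n + 1)).map (D.E₁.map f))
  have h2 := congrArg (fun g => D.E₂.map ((pow D.E₂ n).map g))
    (heckeCounit_nat (τ := D.τF) (ε := D.adj.counit) n r f)
  simp only [offTerm]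
  dsimp at *
  simp only [Functor.map_comp, Category.assoc] at *
  rw [reassoc_of% h1, h2]

theorem offSlide_nat (n : ℕ) {x y : V} (f : x ⟶ y) :
    (pow D.E₂ (n + 1)).map ((pow D.F₁ (n + 1)).map (D.E₁.map f)) ≫ D.offSlide n y =
      D.offSlide n x ≫ D.E₂.map ((pow D.E₂ n).map ((pow D.F₁ n).map f)) := by
  simp only [offSlide, Preadditive.comp_sum, Preadditive.sum_comp, D.offTerm_nat]

/-- The chosen strand lies in the first block: `E₁` passes the second block by `ρ` and `σ`, and is
then contracted in the first. -/
theorem wordMul_offTerm_left (p j n r : ℕ) (h : j + p = n) (hr : r ≤ p) (x : V) :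
    wordMul D.lam (p + 1) j (n + 1) (by omega) (D.E₁.obj x) ≫ D.offTerm n r x =
      (pow D.E₂ (p + 1)).map ((pow D.F₁ (p + 1)).map (wordSlide D.ρ D.σ j x)) ≫
        D.offTerm p r ((pow D.E₂ j).obj ((pow D.F₁ j).obj x)) ≫
        D.E₂.map (wordMul D.lam p j n h x) := by
  have h1 := heckeFront_powConcat_left D.τ₂ p j n r (by omega) hr
    ((pow D.F₁ (p + 1)).obj ((pow D.F₁ j).obj (D.E₁.obj x)))
  have h2 := heckeCounit_powConcat_left (τ := D.τF) D.ρ_counit p j n r h hr x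
  have h3 := heckeCounit_slidePow D.commF' D.σ_counit p r j ((pow D.F₁ j).obj x)
  have h4 := slidePow_nat D.lam (p + 1) j (slide D.ρ j x)
  have h5 := heckeFront_nat D.τ₂ (n + 1) r (powConcat D.F₁ (p + 1) j (n + 1) (by omega) (D.E₁.obj x))
  have h6 := heckeFront_nat D.τ₂ (p + 1) r (slidePow D.lam (p + 1) j ((pow D.F₁ j).obj (D.E₁.obj x)))
  have h7 := heckeFront_nat D.τ₂ (p + 1) r ((pow D.F₁ (p + 1)).map (wordSlide D.ρ D.σ j x))
  have h8 := powConcat_nat D.E₂ p j n h ((pow D.F₁ (p + 1)).map (slide D.ρ j x))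
  have h9 := powConcat_nat D.E₂ p j n h (heckeCounit D.τF D.adj.counit p r ((pow D.F₁ j).obj x))
  have k2 := congrArg (fun g => D.E₂.map ((pow D.E₂ n).map g)) h2
  have k3 := congrArg (fun g => D.E₂.map ((pow D.E₂ p).map g)) h3
  have k4 := congrArg (fun g => D.E₂.map ((pow D.E₂ p).map g)) h4
  have k8 := congrArg D.E₂.map h8
  have k9 := congrArg D.E₂.map h9
  simp only [offTerm, wordMul, wordSlide] at *
  dsimp at *
  simp only [Functor.map_comp, Category.assoc] at *
  rw [reassoc_of% h5, ← reassoc_of% h1, reassoc_of% h6,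
    ← k2, ← reassoc_of% k8, ← reassoc_of% k9, ← reassoc_of% k4, reassoc_of% h7, reassoc_of% k3]

/-- The chosen strand lies in the second block: the contraction takes place there, and the `E₂`
released by it passes the first block by `λ` and `τ₂`. -/
theorem wordMul_offTerm_right (i q n t : ℕ) (h : q + i = n) (x : V) :
    wordMul D.lam i (q + 1) (n + 1) (by omega) (D.E₁.obj x) ≫ D.offTerm n (i + t) x =
      (pow D.E₂ i).map ((pow D.F₁ i).map (D.offTerm q t x)) ≫
        wordSlide D.lam D.τ₂ i ((pow D.E₂ q).obj ((pow D.F₁ q).obj x)) ≫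
        D.E₂.map (wordMul D.lam i q n h x) := by
  have h1 := powConcat_heckeFront_right D.τ₂ i q n t (by omega)
    ((pow D.F₁ i).obj ((pow D.F₁ (q + 1)).obj (D.E₁.obj x)))
  have h2 := powConcat_heckeCounit_right (τ := D.τF) (ε := D.adj.counit) i q n t h x
  have h3 := slidePow_heckeFront D.comm₂' i (q + 1) t ((pow D.F₁ (q + 1)).obj (D.E₁.obj x))
  have h4 := slide_nat D.lam i ((pow D.E₂ q).map (heckeCounit D.τF D.adj.counit q t x))
  have h5 := heckeFront_nat D.τ₂ (n + 1) (i + t)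
    (powConcat D.F₁ i (q + 1) (n + 1) (by omega) (D.E₁.obj x))
  have h6 := slide_nat D.τ₂ i (slidePow D.lam i q ((pow D.F₁ (q + 1)).obj (D.E₁.obj x)))
  have h7 := slide_nat D.τ₂ i
    ((pow D.F₁ i).map ((pow D.E₂ q).map (heckeCounit D.τF D.adj.counit q t x)))
  have h8 := slidePow_nat D.lam i q (heckeCounit D.τF D.adj.counit q t x)
  have h9 := powConcat_nat D.E₂ i q n h ((pow D.F₁ i).map (heckeCounit D.τF D.adj.counit q t x))
  have k2 := congrArg (fun g => D.E₂.map ((pow D.E₂ n).map g)) h2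
  have k3 := congrArg (pow D.E₂ i).map h3
  have k4 := congrArg (pow D.E₂ i).map h4
  have k8 := congrArg (fun g => D.E₂.map ((pow D.E₂ i).map g)) h8
  have k9 := congrArg D.E₂.map h9
  simp only [offTerm, wordMul, wordSlide] at *
  dsimp [slidePow] at *
  simp only [Functor.map_comp, Category.assoc] at *
  rw [reassoc_of% h5, ← reassoc_of% h1, k2, ← reassoc_of% k3, reassoc_of% h6, reassoc_of% k4,
    reassoc_of% h7, reassoc_of% k8, reassoc_of% k9]

/-- Relates the two orders in which a word passes `E₂` and is contracted with `E₁`: exchanging these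
letters by `σ` costs a crossing `τ₂` of the two resulting `E₂`. -/
theorem wordSlide_offTerm₂ (n r : ℕ) (x : V) :
    wordSlide D.lam D.τ₂ (n + 1) (D.E₁.obj x) ≫ D.E₂.map (D.offTerm n r x) =
      (pow D.E₂ (n + 1)).map ((pow D.F₁ (n + 1)).map (D.σ.app x)) ≫
        D.offTerm n r (D.E₂.obj x) ≫ D.E₂.map (wordSlide D.lam D.τ₂ n x) ≫
        D.τ₂.app ((pow D.E₂ n).obj ((pow D.F₁ n).obj x)) := by
  have h1 := heckeFront_slide D.rep₂.braid (n + 1) r ((pow D.F₁ (n + 1)).obj (D.E₁.obj x))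
  have h2 := heckeCounit_slide D.commF' D.σ_counit n r x
  have h3 := heckeFront_nat D.τ₂ (n + 1) r (slide D.lam (n + 1) (D.E₁.obj x))
  have h4 := heckeFront_nat D.τ₂ (n + 1) r ((pow D.F₁ (n + 1)).map (D.σ.app x))
  have h5 := slide_nat D.τ₂ (n + 1) (heckeCounit D.τF D.adj.counit n r x)
  have k2 := congrArg (fun g => D.E₂.map ((pow D.E₂ n).map g)) h2
  simp only [offTerm, wordSlide] at *
  dsimp [slide] at *
  simp only [Functor.map_comp, Category.assoc] at *
  rw [← reassoc_of% h1, reassoc_of% h3, ← h5, ← reassoc_of% k2, reassoc_of% h4]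

/-- The analogue with `E₁` in place of `E₂`: `(ρ, σ, τ₁)` replaces `(λ, τ₂, σ)`. -/
theorem wordSlide_offTerm₁ (n r : ℕ) (x : V) :
    wordSlide D.ρ D.σ (n + 1) (D.E₁.obj x) ≫ D.E₁.map (D.offTerm n r x) =
      (pow D.E₂ (n + 1)).map ((pow D.F₁ (n + 1)).map (D.τ₁.app x)) ≫
        D.offTerm n r (D.E₁.obj x) ≫ D.E₂.map (wordSlide D.ρ D.σ n x) ≫
        D.σ.app ((pow D.E₂ n).obj ((pow D.F₁ n).obj x)) := by
  have h1 := heckeFront_slide D.τ₂_σ (n + 1) r ((pow D.F₁ (n + 1)).obj (D.E₁.obj x))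
  have h2 := heckeCounit_slide D.τF_ρ D.τ₁_counit_eq n r x
  have h3 := heckeFront_nat D.τ₂ (n + 1) r (slide D.ρ (n + 1) (D.E₁.obj x))
  have h4 := heckeFront_nat D.τ₂ (n + 1) r ((pow D.F₁ (n + 1)).map (D.τ₁.app x))
  have h5 := slide_nat D.σ (n + 1) (heckeCounit D.τF D.adj.counit n r x)
  have k2 := congrArg (fun g => D.E₂.map ((pow D.E₂ n).map g)) h2
  simp only [offTerm, wordSlide] at *
  dsimp [slide] at *
  simp only [Functor.map_comp, Category.assoc] at *
  rw [← reassoc_of% h1, reassoc_of% h3, ← h5, ← reassoc_of% k2, reassoc_of% h4]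

end DualSetup
end OffDiagonal

/-- `(r, s)` records the removal of strand `r` and then of strand `s` among the remaining ones.
Removing the same two strands in the other order turns `(r, s)` with `r ≤ s` into `(s + 1, r)`. -/
theorem sum_eq_sum_swap_succ {M : Type v} [AddCommMonoid M] (n : ℕ) (f g : ℕ → ℕ → M)
    (hf : ∀ r s, r ≤ s → s ≤ n → f r s = 0) (hg : ∀ r s, r ≤ s → s ≤ n → g (s + 1) r = 0)
    (hfg : ∀ r s, r ≤ s → s ≤ n → f (s + 1) r = g r s) :
    ∑ r ∈ Finset.range (n + 2), ∑ s ∈ Finset.range (n + 1), f r s =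
      ∑ r ∈ Finset.range (n + 2), ∑ s ∈ Finset.range (n + 1), g r s := by
  rw [Finset.sum_range_succ' _ (n + 1), Finset.sum_range_succ _ (n + 1),
    Finset.sum_eq_zero (f := fun s => f 0 s) fun s hs =>
      hf 0 s (Nat.zero_le _) (Finset.mem_range_succ_iff.1 hs),
    Finset.sum_eq_zero (f := fun s => g (n + 1) s) fun s hs =>
      hg s n (Finset.mem_range_succ_iff.1 hs) le_rfl, Finset.sum_comm]
  -- The row `r = 0` of `f` and the row `r = n + 1` of `g` vanish; the remaining squares agree after
  -- transposition.
  refine congrArg (· + 0) (Finset.sum_congr rfl fun s hs => Finset.sum_congr rfl fun r hr => ?_)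
  rw [Finset.mem_range_succ_iff] at hs hr
  rcases le_or_gt s r with h | h
  · exact hfg s r h hr
  · obtain ⟨t, rfl⟩ : ∃ t, s = t + 1 := ⟨s - 1, by omega⟩
    rw [hf (r + 1) (t + 1) h hs, hg r t (by omega) (by omega)]

/-! ### Products of two off-diagonal terms -/

section OffDiagonalCross

variable {k : Type w} [Field k] {V : Type u} [Category.{v} V] [Preadditive V] [Linear k V]
  [DiffCategory k V]

namespace DualSetup

variable (D : DualSetup k V)

/-- Normal form: all crossings of `E₂` first, then both contractions. The two families of strands
can then be treated independently. -/
theorem offTerm_offTerm (n r s : ℕ) (x : V) :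
    D.offTerm (n + 1) r (D.E₁.obj x) ≫ D.E₂.map (D.offTerm n s x) =
      (heckeFront D.τ₂ (n + 2) r ((pow D.F₁ (n + 2)).obj (D.E₁.obj (D.E₁.obj x))) ≫
        D.E₂.map (heckeFront D.τ₂ (n + 1) s ((pow D.F₁ (n + 2)).obj (D.E₁.obj (D.E₁.obj x))))) ≫
      D.E₂.map (D.E₂.map ((pow D.E₂ n).map (heckeCounit D.τF D.adj.counit (n + 1) r (D.E₁.obj x) ≫
        heckeCounit D.τF D.adj.counit n s x))) := by
  have h1 := congrArg D.E₂.map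
    (heckeFront_nat D.τ₂ (n + 1) s (heckeCounit D.τF D.adj.counit (n + 1) r (D.E₁.obj x)))
  simp only [offTerm] at *
  dsimp at *
  simp only [Functor.map_comp, Category.assoc] at *
  rw [reassoc_of% h1]

/-- Summands of the off-diagonal entry taken in both orders. -/
theorem offTerm_offTerm_cross {r s : ℕ} (h : r ≤ s) (n : ℕ) (hn : s ≤ n) (x : V) :
    (pow D.E₂ (n + 2)).map ((pow D.F₁ (n + 2)).map (D.τ₁.app x)) ≫
        D.offTerm (n + 1) (s + 1) (D.E₁.obj x) ≫ D.E₂.map (D.offTerm n r x) =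
      D.offTerm (n + 1) r (D.E₁.obj x) ≫ D.E₂.map (D.offTerm n s x) ≫
        D.τ₂.app ((pow D.E₂ n).obj ((pow D.F₁ n).obj x)) := by
  have h1 := heckeFront_heckeFront_cross D.rep₂.braid h n hn
    ((pow D.F₁ (n + 2)).obj (D.E₁.obj (D.E₁.obj x)))
  have h2 := heckeCounit_heckeCounit_cross D.repF.braid D.τ₁_counit h n hn x
  have h3 := heckeFront_nat D.τ₂ (n + 2) (s + 1) ((pow D.F₁ (n + 2)).map (D.τ₁.app x))
  have h4 := congrArg D.E₂.map
    (heckeFront_nat D.τ₂ (n + 1) r ((pow D.F₁ (n + 2)).map (D.τ₁.app x)))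
  have h5 := cross_nat D.τ₂ ((pow D.E₂ n).map (heckeCounit D.τF D.adj.counit (n + 1) r (D.E₁.obj x) ≫
        heckeCounit D.τF D.adj.counit n s x))
  have k2 := congrArg (fun g => D.E₂.map (D.E₂.map ((pow D.E₂ n).map g))) h2
  have e1 := D.offTerm_offTerm n r s x
  have e2 := D.offTerm_offTerm n (s + 1) r x
  simp only [reassoc_of% e1, e2]
  dsimp at *
  simp only [Functor.map_comp, Category.assoc] at *
  rw [reassoc_of% h3, reassoc_of% h4, k2, h5, reassoc_of% h1]

/-- For `r ≤ s` the two contractions already contain a factor `τ₁` by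
`heckeCounit_heckeCounit_cross`, so a further one gives `τ₁² = 0`. -/
theorem offTerm_offTerm_left {r s : ℕ} (h : r ≤ s) (n : ℕ) (hn : s ≤ n) (x : V) :
    (pow D.E₂ (n + 2)).map ((pow D.F₁ (n + 2)).map (D.τ₁.app x)) ≫
        D.offTerm (n + 1) r (D.E₁.obj x) ≫ D.E₂.map (D.offTerm n s x) = 0 := by
  have h2 := heckeCounit_heckeCounit_cross D.repF.braid D.τ₁_counit h n hn x
  have h3 := heckeFront_nat D.τ₂ (n + 2) r ((pow D.F₁ (n + 2)).map (D.τ₁.app x))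
  have h4 := congrArg D.E₂.map
    (heckeFront_nat D.τ₂ (n + 1) s ((pow D.F₁ (n + 2)).map (D.τ₁.app x)))
  have k2 := congrArg (fun g => D.E₂.map (D.E₂.map ((pow D.E₂ n).map g))) h2
  have hz : (pow D.F₁ (n + 2)).map (D.τ₁.app x) ≫ (pow D.F₁ (n + 2)).map (D.τ₁.app x) = 0 := by
    rw [← CategoryTheory.Functor.map_comp, D.rep₁.sq, map_zero' k]
  have k5 := congrArg (fun g => D.E₂.map (D.E₂.map ((pow D.E₂ n).map g))) hz
  have e1 := D.offTerm_offTerm n r s x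
  rw [e1]
  simp only [map_zero' k] at k5
  dsimp at *
  simp only [Functor.map_comp, Category.assoc] at *
  rw [reassoc_of% h3, reassoc_of% h4, ← k2, reassoc_of% k5]
  simp only [Limits.zero_comp, Limits.comp_zero]

/-- In this order the two pulls already end with a crossing `τ₂` by `heckeFront_heckeFront_cross`,
so a further one gives `τ₂² = 0`. -/
theorem offTerm_offTerm_right {r s : ℕ} (h : r ≤ s) (n : ℕ) (hn : s ≤ n) (x : V) :
    D.offTerm (n + 1) (s + 1) (D.E₁.obj x) ≫ D.E₂.map (D.offTerm n r x) ≫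
        D.τ₂.app ((pow D.E₂ n).obj ((pow D.F₁ n).obj x)) = 0 := by
  have h1 := heckeFront_heckeFront_cross D.rep₂.braid h n hn
    ((pow D.F₁ (n + 2)).obj (D.E₁.obj (D.E₁.obj x)))
  have h5 := cross_nat D.τ₂ ((pow D.E₂ n).map
    (heckeCounit D.τF D.adj.counit (n + 1) (s + 1) (D.E₁.obj x) ≫
      heckeCounit D.τF D.adj.counit n r x))
  have h6 := D.rep₂.sq ((pow D.E₂ n).obj ((pow D.F₁ (n + 2)).obj (D.E₁.obj (D.E₁.obj x))))
  have e1 := D.offTerm_offTerm n (s + 1) r x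
  rw [reassoc_of% e1]
  dsimp at *
  simp only [Functor.map_comp, Category.assoc] at *
  rw [h5, ← reassoc_of% h1, reassoc_of% h6]
  simp only [Limits.zero_comp, Limits.comp_zero]

theorem offSlide_offSlide_cross (n : ℕ) (x : V) :
    (pow D.E₂ (n + 2)).map ((pow D.F₁ (n + 2)).map (D.τ₁.app x)) ≫
        D.offSlide (n + 1) (D.E₁.obj x) ≫ D.E₂.map (D.offSlide n x) =
      D.offSlide (n + 1) (D.E₁.obj x) ≫ D.E₂.map (D.offSlide n x) ≫
        D.τ₂.app ((pow D.E₂ n).obj ((pow D.F₁ n).obj x)) := by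
  have h := sum_eq_sum_swap_succ n
    (fun r s => (pow D.E₂ (n + 2)).map ((pow D.F₁ (n + 2)).map (D.τ₁.app x)) ≫
        D.offTerm (n + 1) r (D.E₁.obj x) ≫ D.E₂.map (D.offTerm n s x))
    (fun r s => D.offTerm (n + 1) r (D.E₁.obj x) ≫ D.E₂.map (D.offTerm n s x) ≫
        D.τ₂.app ((pow D.E₂ n).obj ((pow D.F₁ n).obj x)))
    (fun r s h hn => D.offTerm_offTerm_left h n hn x)
    (fun r s h hn => D.offTerm_offTerm_right h n hn x)
    (fun r s h hn => D.offTerm_offTerm_cross h n hn x)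
  simp only [offSlide, map_sum' k, Preadditive.sum_comp, Preadditive.comp_sum]
  -- Makes the longer range the outer one, as in `sum_eq_sum_swap_succ`.
  simp only [Finset.sum_comm (s := Finset.range (n + 1))]
  exact h

/-! ### Transposes -/

theorem slide_σ_counit (n : ℕ) (x : V) :
    D.F₁.map (slide D.σ n x) ≫ D.adj.counit.app ((pow D.E₂ n).obj x) =
      push D.lam n (D.E₁.obj x) ≫ (pow D.E₂ n).map (D.adj.counit.app x) := by
  induction n with
  | zero =>
    simp [push, slide]
  | succ n ih =>
    have h1 := D.σ_counit ((pow D.E₂ n).obj x)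
    have h2 := congrArg D.E₂.map ih
    have h3 := cross_nat D.lam (slide D.σ n x)
    dsimp [push, slide] at *
    simp only [Functor.map_comp, Category.assoc] at *
    rw [h1, reassoc_of% h3, h2]

/-- Instead of bringing `E₁` to the front of the word and contracting it with `F₁`, this `F₁` moves
through `E₂ⁿ` by `λ` and becomes strand 0 of the contraction. -/
theorem wordSlide_counit (n : ℕ) (x : V) :
    D.F₁.map (wordSlide D.ρ D.σ n x) ≫ D.adj.counit.app ((pow D.E₂ n).obj ((pow D.F₁ n).obj x)) =
      push D.lam n ((pow D.F₁ n).obj (D.E₁.obj x)) ≫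
        (pow D.E₂ n).map (heckeCounit D.τF D.adj.counit n 0 x) := by
  have h1 := D.slide_σ_counit n ((pow D.F₁ n).obj x)
  have h2 := push_nat D.lam n (slide D.ρ n x)
  have h3 := congrArg (pow D.E₂ n).map (heckeCounit_eq_slide (τ := D.τF) D.ρ_counit n x)
  simp only [wordSlide] at *
  dsimp at *
  simp only [Functor.map_comp, Category.assoc] at *
  rw [h1, reassoc_of% h2, h3]

/-- The incoming `F₁` becomes strand 0 of its block, hence the shift from `r` to `r + 1` in the
contraction. -/
theorem push_offTerm (n r : ℕ) (x : V) :
    D.F₁.map (D.offTerm n r x) ≫ push D.lam (n + 1) ((pow D.F₁ n).obj x) =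
      push D.lam (n + 1) ((pow D.F₁ (n + 1)).obj (D.E₁.obj x)) ≫
        heckeFront D.τ₂ (n + 1) r ((pow D.F₁ (n + 2)).obj (D.E₁.obj x)) ≫
        (pow D.E₂ (n + 1)).map (heckeCounit D.τF D.adj.counit (n + 1) (r + 1) x) := by
  have h1 := push_nat D.lam (n + 1) (heckeCounit D.τF D.adj.counit n r x)
  have h2 := slidePow_heckeFront D.comm₂' 1 (n + 1) r ((pow D.F₁ (n + 1)).obj (D.E₁.obj x))
  rw [slidePow_one_left] at h2
  simp only [offTerm, heckeCounit_succ]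
  dsimp at *
  simp only [Functor.map_comp, Category.assoc] at *
  rw [h1, reassoc_of% h2]

/-- The morphism `π(ς)`, with its type written in terms of `E₁` and `E₂`. -/
def dualπ {m : V} (ς : ∀ i, (D.EF i).obj m ⟶ m) : D.E₂.obj m ⟶ D.E₁.obj m := D.π ς

/-- The only property of `π(ς)` used in most arguments below: its transpose is `ς₁ ∘ λ`. -/
theorem π_counit {m : V} (ς : ∀ i, (D.EF i).obj m ⟶ m) :
    D.F₁.map (D.dualπ ς) ≫ D.adj.counit.app m = D.lam.app m ≫ ς 1 := by
  have h1 := counit_nat D.adj.counit (ς 1)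
  have h2 := D.σ_counit (D.F₁.obj m)
  have h3 := cross_nat D.lam (D.adj.unit.app m)
  have h4 := congrArg D.E₂.map (D.left_triangle m)
  simp only [dualπ, π]
  dsimp [toSigma] at *
  simp only [Functor.map_comp, Category.assoc, CategoryTheory.Functor.map_id] at *
  rw [h1, reassoc_of% h2, reassoc_of% h3, reassoc_of% h4]

end DualSetup
end OffDiagonalCross

section Entries

variable {k : Type w} [Field k] {V : Type u} [Category.{v} V] [Preadditive V] [Linear k V]
  [DiffCategory k V]

/-! ### The entries of `ς'` -/

namespace DualSetup

variable (D : DualSetup k V) {m : V} (ς : ∀ i, (D.EF i).obj m ⟶ m)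

/-- The upper left entry of `ς'`. -/
def entry₂ (i : ℕ) : (D.EF i).obj (D.E₂.obj m) ⟶ D.E₂.obj m :=
  wordSlide D.lam D.τ₂ i m ≫ D.E₂.map (ς i)

/-- The lower right entry of `ς'`. -/
def entry₁ (i : ℕ) : (D.EF i).obj (D.E₁.obj m) ⟶ D.E₁.obj m :=
  wordSlide D.ρ D.σ i m ≫ D.E₁.map (ς i)

variable {D ς} (h : IsDualObj D.toLambdaSetup m ς)
include h

theorem hecke_entry₂ (i r : ℕ) (hr : r + 1 < i) :
    hecke D.τ₂ i r ((pow D.F₁ i).obj (D.E₂.obj m)) ≫ D.entry₂ ς i =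
      (pow D.E₂ i).map (hecke D.τF i r (D.E₂.obj m)) ≫ D.entry₂ ς i := by
  have h1 := hecke_wordSlide_left (sF := D.lam) D.rep₂.braid i r m
  have h2 := hecke_wordSlide_right (sA := D.τ₂) D.commF' i r m
  have h3 := congrArg D.E₂.map (h.equivariant i r hr)
  simp only [Functor.map_comp] at h3
  rw [entry₂, reassoc_of% h1, reassoc_of% h2, h3]

theorem hecke_entry₁ (i r : ℕ) (hr : r + 1 < i) :
    hecke D.τ₂ i r ((pow D.F₁ i).obj (D.E₁.obj m)) ≫ D.entry₁ ς i =
      (pow D.E₂ i).map (hecke D.τF i r (D.E₁.obj m)) ≫ D.entry₁ ς i := by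
  have h1 := hecke_wordSlide_left (sF := D.ρ) D.τ₂_σ i r m
  have h2 := hecke_wordSlide_right (sA := D.σ) D.τF_ρ i r m
  have h3 := congrArg D.E₁.map (h.equivariant i r hr)
  simp only [Functor.map_comp] at h3
  rw [entry₁, reassoc_of% h1, reassoc_of% h2, h3]

/-- `T_s` exchanges strands `s` and `s + 1`, so it relabels the chosen strand. If that strand is
neither of the two, `T_s` passes through to `ς_n`, where equivariance converts it. -/
theorem hecke_offTerm (n s r : ℕ) (hs : s < n) (hr : r ≤ n) :
    hecke D.τ₂ (n + 1) s ((pow D.F₁ (n + 1)).obj (D.E₁.obj m)) ≫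
        D.offTerm n r m ≫ D.E₂.map (ς n) =
      (pow D.E₂ (n + 1)).map (hecke D.τF (n + 1) s (D.E₁.obj m)) ≫
        D.offTerm n (Equiv.swap s (s + 1) r) m ≫ D.E₂.map (ς n) := by
  have hn := heckeFront_nat D.τ₂ (n + 1) (Equiv.swap s (s + 1) r)
    (hecke D.τF (n + 1) s (D.E₁.obj m))
  simp only [offTerm, Category.assoc]
  dsimp at hn ⊢
  rw [reassoc_of% hn]
  rcases lt_trichotomy r s with hlt | rfl | hgt
  · rw [Equiv.swap_apply_of_ne_of_ne (by omega) (by omega)]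
    obtain ⟨t, rfl⟩ : ∃ t, s = t + 1 := ⟨s - 1, by omega⟩
    have h1 := hecke_heckeFront_right D.τ₂ (r := r) (s := t) (by omega) n
      ((pow D.F₁ (n + 1)).obj (D.E₁.obj m))
    have h2 := congrArg (fun g => D.E₂.map ((pow D.E₂ n).map g)) (hecke_heckeCounit_right
      (ε := D.adj.counit) D.repF.braid (r := r) (s := t) (n := n) (by omega) (by omega) m)
    have h3 := congrArg D.E₂.map (h.equivariant n t (by omega))
    have h4 := congrArg D.E₂.map (hecke_nat D.τ₂ n t (heckeCounit D.τF D.adj.counit n r m))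
    dsimp at *
    simp only [Functor.map_comp] at *
    rw [reassoc_of% h1, reassoc_of% h2, ← reassoc_of% h4, h3]
  · rw [Equiv.swap_apply_left]
    have h2 := congrArg (fun g => D.E₂.map ((pow D.E₂ n).map g)) (hecke_heckeCounit_succ
      (τ := D.τF) (ε := D.adj.counit) hs m)
    dsimp at *
    simp only [Functor.map_comp] at *
    rw [reassoc_of% h2, heckeFront, Category.assoc]
  · rcases Nat.eq_or_lt_of_le hgt with rfl | hgt
    -- For `r = s + 1` both sides vanish by `T_s² = 0`, one because of the pull of `E₂`, the other
    -- because of the contraction of `F₁`.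
    · have h1 := hecke_heckeFront_succ_zero D.rep₂ hs ((pow D.F₁ (n + 1)).obj (D.E₁.obj m))
      have h2 := congrArg (fun g => D.E₂.map ((pow D.E₂ n).map g)) (hecke_heckeCounit_zero
        (ε := D.adj.counit) D.repF hs m)
      rw [Equiv.swap_apply_right]
      simp only [map_zero' k] at h2
      dsimp at *
      simp only [Functor.map_comp] at *
      rw [reassoc_of% h1, reassoc_of% h2]
      simp only [Limits.zero_comp, Limits.comp_zero]
    · rw [Equiv.swap_apply_of_ne_of_ne (by omega) (by omega)]
      have h1 := hecke_heckeFront_left D.rep₂.braid (r := r) (s := s) (by omega) n hr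
        ((pow D.F₁ (n + 1)).obj (D.E₁.obj m))
      have h2 := congrArg (fun g => D.E₂.map ((pow D.E₂ n).map g)) (hecke_heckeCounit_left
        (τ := D.τF) (ε := D.adj.counit) (r := r) (s := s) (n := n) (by omega) hr m)
      have h3 := congrArg D.E₂.map (h.equivariant n s (by omega))
      have h4 := congrArg D.E₂.map (hecke_nat D.τ₂ n s (heckeCounit D.τF D.adj.counit n r m))
      dsimp at *
      simp only [Functor.map_comp] at *
      rw [reassoc_of% h1, reassoc_of% h2, ← reassoc_of% h4, h3]

theorem hecke_stepOffDiag (i r : ℕ) (hr : r + 1 < i) :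
    hecke D.τ₂ i r ((pow D.F₁ i).obj (D.E₁.obj m)) ≫ D.stepOffDiag ς i =
      (pow D.E₂ i).map (hecke D.τF i r (D.E₁.obj m)) ≫ D.stepOffDiag ς i := by
  obtain ⟨n, rfl⟩ : ∃ n, i = n + 1 := ⟨i - 1, by omega⟩
  rw [stepOffDiag_succ]
  simp only [offSlide, Preadditive.sum_comp, Preadditive.comp_sum]
  -- The transposition preserves the range of summation, so it only reorders the summands.
  refine Finset.sum_equiv (Equiv.swap r (r + 1)) (fun s => ?_) fun s hs =>
    hecke_offTerm h n r s (by omega) (Finset.mem_range_succ_iff.1 hs)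
  simp only [Finset.mem_range]
  rcases eq_or_ne s r with rfl | h1
  · rw [Equiv.swap_apply_left]; omega
  · rcases eq_or_ne s (r + 1) with rfl | h2
    · rw [Equiv.swap_apply_right]; omega
    · rw [Equiv.swap_apply_of_ne_of_ne h1 h2]

theorem wordMul_entry₂ (i j n : ℕ) (hn : j + i = n) :
    (pow D.E₂ i).map ((pow D.F₁ i).map (D.entry₂ ς j)) ≫ D.entry₂ ς i =
      wordMul D.lam i j n hn (D.E₂.obj m) ≫ D.entry₂ ς n := by
  have h1 := wordMul_wordSlide (sF := D.lam) (sA := D.τ₂) D.comm₂' i j n hn m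
  have h2 := congrArg D.E₂.map (h.wordMul_comp i j n hn)
  have h3 := wordSlide_nat D.lam D.τ₂ i (ς j)
  simp only [Functor.map_comp, entry₂, Category.assoc] at *
  rw [reassoc_of% h3, h2, reassoc_of% h1]

theorem wordMul_entry₁ (i j n : ℕ) (hn : j + i = n) :
    (pow D.E₂ i).map ((pow D.F₁ i).map (D.entry₁ ς j)) ≫ D.entry₁ ς i =
      wordMul D.lam i j n hn (D.E₁.obj m) ≫ D.entry₁ ς n := by
  have h1 := wordMul_wordSlide (sF := D.ρ) (sA := D.σ) D.lam_σ_ρ i j n hn m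
  have h2 := congrArg D.E₁.map (h.wordMul_comp i j n hn)
  have h3 := wordSlide_nat D.ρ D.σ i (ς j)
  simp only [Functor.map_comp, entry₁, Category.assoc] at *
  rw [reassoc_of% h3, h2, reassoc_of% h1]

/-- The off-diagonal entry of the matrix identity `ς'_i ∘ E₂^i F₁^i ς'_j = ς'_{i+j} ∘ μ`: the `i +
j` summands split according to the block that contains the chosen strand. -/
theorem wordMul_stepOffDiag (i j n : ℕ) (hi : 1 ≤ i) (hj : 1 ≤ j) (hn : j + i = n) :
    (pow D.E₂ i).map ((pow D.F₁ i).map (D.stepOffDiag ς j)) ≫ D.entry₂ ς i +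
        (pow D.E₂ i).map ((pow D.F₁ i).map (D.entry₁ ς j)) ≫ D.stepOffDiag ς i =
      wordMul D.lam i j n hn (D.E₁.obj m) ≫ D.stepOffDiag ς n := by
  obtain ⟨p, rfl⟩ : ∃ p, i = p + 1 := ⟨i - 1, by omega⟩
  obtain ⟨q, rfl⟩ : ∃ q, j = q + 1 := ⟨j - 1, by omega⟩
  obtain ⟨N, rfl⟩ : ∃ N, n = N + 1 := ⟨n - 1, by omega⟩
  have h1 := h.wordMul_comp (p + 1) q N (by omega)
  have h2 := h.wordMul_comp p (q + 1) N (by omega)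
  have h3 := wordSlide_nat D.lam D.τ₂ (p + 1) (ς q)
  have h4 := fun r => D.offTerm_nat p r (ς (q + 1))
  have k1 := congrArg D.E₂.map h1
  have k2 := congrArg D.E₂.map h2
  simp only [Functor.map_comp] at k1 k2
  rw [stepOffDiag_succ, stepOffDiag_succ, stepOffDiag_succ]
  have e1 : ∀ t ∈ Finset.range (q + 1), wordMul D.lam (p + 1) (q + 1) (N + 1) hn (D.E₁.obj m) ≫
        D.offTerm N (p + 1 + t) m ≫ D.E₂.map (ς N) =
      (pow D.E₂ (p + 1)).map ((pow D.F₁ (p + 1)).map (D.offTerm q t m)) ≫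
        (pow D.E₂ (p + 1)).map ((pow D.F₁ (p + 1)).map (D.E₂.map (ς q))) ≫
          D.entry₂ ς (p + 1) := by
    intro t _
    have h5 := D.wordMul_offTerm_right (p + 1) q N t (by omega) m
    rw [reassoc_of% h5, entry₂]
    dsimp at *
    rw [reassoc_of% h3, k1]
  have e2 : ∀ r ∈ Finset.range (p + 1), wordMul D.lam (p + 1) (q + 1) (N + 1) hn (D.E₁.obj m) ≫
        D.offTerm N r m ≫ D.E₂.map (ς N) =
      (pow D.E₂ (p + 1)).map ((pow D.F₁ (p + 1)).map (D.entry₁ ς (q + 1))) ≫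
        D.offTerm p r m ≫ D.E₂.map (ς p) := by
    intro r hr
    have h5 := D.wordMul_offTerm_left p (q + 1) N r (by omega) (Finset.mem_range_succ_iff.1 hr) m
    have h6 := h4 r
    simp only [entry₁, Functor.map_comp, Category.assoc]
    rw [reassoc_of% h5]
    dsimp at *
    rw [reassoc_of% h6, k2]
  have hr : Finset.range (N + 1) = Finset.range (p + 1 + (q + 1)) := congrArg _ (by omega)
  simp only [offSlide, Preadditive.sum_comp, Preadditive.comp_sum, Functor.map_comp,
    map_sum' k, Category.assoc]
  rw [hr, Finset.sum_range_add _ (p + 1) (q + 1), Finset.sum_congr rfl e1, Finset.sum_congr rfl e2]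
  exact add_comm _ _

end DualSetup
end Entries

section EntriesDifferential

variable {k : Type w} [Field k] {V : Type u} [Category.{v} V] [Preadditive V] [Linear k V]
  [DiffCategory k V]

theorem d_powConcat (E : V ⥤ V) [IsDiff k E] (i j n : ℕ) (hn : j + i = n) (x : V) :
    d k (powConcat E i j n hn x) = 0 := by
  induction i generalizing n with
  | zero =>
    obtain rfl : n = j := by omega
    rw [powConcat_zero_left]
    exact d_id k _
  | succ i ih =>
    obtain ⟨n, rfl⟩ : ∃ n', n = n' + 1 := ⟨n - 1, by omega⟩
    rw [powConcat_succ_left]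
    exact d_map_closed k E (ih n (by omega))

theorem heckeDown_nat {E : V ⥤ V} (τ : E ⋙ E ⟶ E ⋙ E) (n r l : ℕ) {x y : V} (f : x ⟶ y) :
    (pow E n).map f ≫ heckeDown τ n r l y = heckeDown τ n r l x ≫ (pow E n).map f := by
  induction l with
  | zero => simp [heckeDown]
  | succ l ih =>
    have h := hecke_nat τ n (r + l) f
    simp only [heckeDown, Category.assoc]
    rw [reassoc_of% h, ih]

namespace DualSetup

variable {D : DualSetup k V} {m : V} {ς : ∀ i, (D.EF i).obj m ⟶ m}
  (h : IsDualObj D.toLambdaSetup m ς)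
include h

/-! ### Relations of the entries with `π` -/

theorem ς_closed (i : ℕ) : d k (ς i) = 0 := by
  rcases Nat.eq_zero_or_pos i with rfl | hi
  · rw [h.zero]
    exact d_id k m
  · exact h.closed i hi

/-- The unit inside `π(ς)` creates an `F₁` at the right end, and contracting strand `r` with its
partner `E₁` leaves strand `r` moved to that end, by the triangle identity. Then `ς₁` and `ς_n`
combine to `ς_{n+1}`. -/
theorem π_heckeCounit (n r : ℕ) (hr : r ≤ n) :
    (pow D.E₂ n).map ((pow D.F₁ (n + 1)).map (D.dualπ ς)) ≫
        (pow D.E₂ n).map (heckeCounit D.τF D.adj.counit n r m) ≫ ς n =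
      (pow D.E₂ n).map (slide D.lam (n + 1) m) ≫
        powConcat D.E₂ n 1 (n + 1) (by omega) ((pow D.F₁ (n + 1)).obj m) ≫
        (pow D.E₂ (n + 1)).map (heckeBack D.τF (n + 1) r (n - r) m) ≫ ς (n + 1) := by
  have h1 := congrArg (pow D.E₂ n).map
    (heckeCounit_nat (τ := D.τF) (ε := D.adj.counit) n r (ς 1))
  have h2 := h.slide_comp n
  have h3 := congrArg (pow D.E₂ n).map
    (heckeCounit_slide D.commF' D.σ_counit n r (D.F₁.obj m))
  have h4 := congrArg (pow D.E₂ n).map (slide_nat D.lam (n + 1) (D.adj.unit.app m))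
  have h5 := congrArg (pow D.E₂ (n + 1)).map
    (unit_heckeCounit (τ := D.τF) (η := D.adj.unit) (ε := D.adj.counit) D.left_triangle hr m)
  have h6 := powConcat_nat D.E₂ n 1 (n + 1) (by omega)
    (heckeCounit D.τF D.adj.counit n r (D.F₁.obj m))
  have h7 := powConcat_nat D.E₂ n 1 (n + 1) (by omega)
    ((pow D.F₁ (n + 1)).map (D.adj.unit.app m))
  simp only [dualπ, π]
  dsimp [toSigma] at *
  simp only [Functor.map_comp, Category.assoc] at *
  rw [reassoc_of% h1, h2, reassoc_of% h3, reassoc_of% h4, reassoc_of% h6, reassoc_of% h7,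
    reassoc_of% h5]

/-- After transposition both sides end in `ς_{i+1}`. On one side a strand `E₂` has been pulled to
the front, on the other a strand `F₁` moved to the back, and equivariance identifies the two. -/
theorem entry₂_π (i : ℕ) :
    D.entry₂ ς i ≫ D.dualπ ς = (pow D.E₂ i).map ((pow D.F₁ i).map (D.dualπ ς)) ≫ D.entry₁ ς i := by
  refine adj_hom_ext D.adj ?_
  have h1 := D.π_counit ς
  have h2 := cross_nat D.lam (ς i)
  have h3 := h.push_comp i
  have h4 := D.wordSlide_counit i m
  have h5 := counit_nat D.adj.counit (ς i)
  have h6 := push_nat D.lam i ((pow D.F₁ i).map (D.dualπ ς))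
  have h7 := π_heckeCounit h i 0 (Nat.zero_le _)
  have h8 := h.heckeFront_comp (i + 1) i (by omega)
  have h9 := congrArg D.F₁.map (slide_eq_heckeFront D.τ₂ i ((pow D.F₁ i).obj m))
  have k1 := push_powConcat D.lam i ((pow D.F₁ i).obj m)
  have k2 := push_nat D.lam i (slide D.lam i m)
  have k3 := slidePow_heckeFront D.comm₂' 1 (i + 1) i ((pow D.F₁ i).obj m)
  rw [slidePow_one_left] at k3
  simp only [entry₁, entry₂, wordSlide] at *
  dsimp [slide, push, toSigma] at *
  simp only [Functor.map_comp, Category.assoc] at *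
  rw [h1, reassoc_of% h2, h3, reassoc_of% h9, reassoc_of% k3, h8, h5, reassoc_of% h4,
    reassoc_of% h6, h7, ← reassoc_of% k2, reassoc_of% k1]

/-- Omitting one crossing of the slide leaves a pull of strand `r` followed by a run of crossings,
which `ς_{n+1}` converts into crossings of `F₁`. -/
theorem d_slide_τ₂ (n : ℕ) :
    d k (slide D.τ₂ (n + 1) ((pow D.F₁ (n + 1)).obj m)) ≫ D.E₂.map (ς (n + 1)) =
      ∑ r ∈ Finset.range (n + 1),
        heckeFront D.τ₂ (n + 1) r (D.E₂.obj ((pow D.F₁ (n + 1)).obj m)) ≫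
          D.E₂.map (powConcat D.E₂ n 1 (n + 1) (by omega) ((pow D.F₁ (n + 1)).obj m)) ≫
          D.E₂.map ((pow D.E₂ (n + 1)).map (heckeBack D.τF (n + 1) r (n - r) m)) ≫
          D.E₂.map (ς (n + 1)) := by
  have hc : d k (powConcat D.E₂ (n + 1) 1 (n + 1 + 1) (by omega)
      ((pow D.F₁ (n + 1)).obj m)) = 0 := d_powConcat D.E₂ _ _ _ _ _
  rw [slide_eq_heckeFront, d_comp, hc, Limits.zero_comp, zero_add,
    d_heckeFront D.rep₂ (Nat.le_refl (n + 1)), Category.assoc]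
  simp only [Preadditive.comp_sum, Preadditive.sum_comp]
  refine Finset.sum_congr rfl fun r hr => ?_
  have h1 := heckeFront_powConcat_left D.τ₂ n 1 (n + 1) r (by omega)
    (Finset.mem_range_succ_iff.1 hr) ((pow D.F₁ (n + 1)).obj m)
  have h2 := congrArg D.E₂.map (h.heckeDown_comp (n + 1) r (n - r)
    (by have := Finset.mem_range.1 hr; omega))
  have e : n + 1 - 1 - r = n - r := by omega
  rw [e]
  dsimp at *
  simp only [Functor.map_comp, Category.assoc] at *
  rw [h2, ← reassoc_of% h1]

/-- Only the crossings `τ₂` have a nonzero differential. By `π_heckeCounit`, the term of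
`d_slide_τ₂` for strand `r` is the `r`-th off-diagonal summand preceded by `π`. -/
theorem d_entry₂ (i : ℕ) (hi : 1 ≤ i) :
    d k (D.entry₂ ς i) = (pow D.E₂ i).map ((pow D.F₁ i).map (D.dualπ ς)) ≫ D.stepOffDiag ς i := by
  obtain ⟨n, rfl⟩ : ∃ n, i = n + 1 := ⟨i - 1, by omega⟩
  have hc : ∀ n, d k (slide D.lam n m) = 0 := by
    intro n
    induction n with
    | zero => exact d_id k _
    | succ n ih => exact d_comp_closed k (d_map_closed k D.F₁ ih) (D.lam_closed _)
  have hς := d_map_closed k D.E₂ (ς_closed h (n + 1))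
  dsimp at hς
  rw [stepOffDiag_succ, entry₂, wordSlide, d_comp, d_comp,
    d_map_closed k (pow D.E₂ (n + 1)) (hc (n + 1)), hς, Limits.zero_comp, Limits.comp_zero,
    zero_add, add_zero, Category.assoc, d_slide_τ₂ h]
  simp only [offSlide, Preadditive.comp_sum, Preadditive.sum_comp]
  refine Finset.sum_congr rfl fun r hr => ?_
  have h1 := congrArg D.E₂.map (π_heckeCounit h n r (Finset.mem_range_succ_iff.1 hr))
  have h2 := heckeFront_nat D.τ₂ (n + 1) r (slide D.lam (n + 1) m)
  have h3 := heckeFront_nat D.τ₂ (n + 1) r ((pow D.F₁ (n + 1)).map (D.dualπ ς))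
  simp only [offTerm]
  dsimp [toSigma] at *
  simp only [Functor.map_comp, Category.assoc] at *
  rw [reassoc_of% h2, ← h1, reassoc_of% h3]

/-- Each pair of strands contributes twice, once through the differential of the pull and once
through that of the contraction. Equivariance shows the two contributions to be equal, so they
cancel in characteristic 2. -/
theorem d_stepOffDiag [CharP k 2] (i : ℕ) : d k (D.stepOffDiag ς i) = 0 := by
  cases i with
  | zero => exact map_zero _
  | succ n =>
    have e : ∀ r ∈ Finset.range (n + 1), d k (D.offTerm n r m) ≫ D.E₂.map (ς n) =
        (∑ s ∈ Finset.range r,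
          heckeFront D.τ₂ (n + 1) s ((pow D.F₁ (n + 1)).obj (D.E₁.obj m)) ≫
            D.E₂.map ((pow D.E₂ n).map (heckeCounit D.τF D.adj.counit n r m) ≫
              (pow D.E₂ n).map (heckeBack D.τF n s (r - 1 - s) m) ≫ ς n)) +
        ∑ s ∈ Finset.Ico (r + 1) (n + 1),
          heckeFront D.τ₂ (n + 1) r ((pow D.F₁ (n + 1)).obj (D.E₁.obj m)) ≫
            D.E₂.map ((pow D.E₂ n).map (heckeCounit D.τF D.adj.counit n s m) ≫
              (pow D.E₂ n).map (heckeBack D.τF n r (s - 1 - r) m) ≫ ς n) := by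
      intro r hr
      have hr := Finset.mem_range_succ_iff.1 hr
      have hd : D.E₂.map ((pow D.E₂ n).map (d k (heckeCounit D.τF D.adj.counit n r m))) =
          d k (D.E₂.map ((pow D.E₂ n).map (heckeCounit D.τF D.adj.counit n r m))) := by
        rw [IsDiff.map_d, IsDiff.map_d]
      rw [d_heckeCounit D.repF D.counit_closed hr] at hd
      rw [offTerm, d_comp, d_heckeFront D.rep₂ hr]
      dsimp at hd ⊢
      rw [← hd]
      simp only [map_sum' k, Preadditive.comp_sum, Preadditive.sum_comp, Preadditive.add_comp]
      refine congrArg₂ (· + ·) (Finset.sum_congr rfl fun s hs => ?_)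
        (Finset.sum_congr rfl fun s hs => ?_)
      · have hs := Finset.mem_range.1 hs
        rw [← h.heckeDown_comp n s (r - 1 - s) (by omega)]
        have h1 := heckeDown_nat D.τ₂ n s (r - 1 - s) (heckeCounit D.τF D.adj.counit n r m)
        have h2 := congrArg D.E₂.map h1
        simp only [Functor.map_comp, Category.assoc] at *
        rw [← reassoc_of% h2]
      · simp only [Functor.map_comp, Category.assoc]
    have hς := d_map_closed k D.E₂ (ς_closed h n)
    dsimp at hς
    -- Exchanging the order of summation in the first family turns it into the second.
    rw [stepOffDiag_succ, d_comp, hς, Limits.comp_zero, add_zero, offSlide, map_sum,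
      Preadditive.sum_comp, Finset.sum_congr rfl e, Finset.sum_add_distrib,
      Finset.sum_comm' (t' := Finset.range (n + 1)) (s' := fun s => Finset.Ico (s + 1) (n + 1))]
    · exact add_self k _
    · intro r s
      simp only [Finset.mem_range, Finset.mem_Ico]
      omega

/-- After transposition the entry is the contraction of strand 0. Each summand of `d_heckeCounit`
contracts a later strand `r + 1`, which is the `r`-th off-diagonal summand followed by the transpose
of `π`. -/
theorem d_entry₁ (i : ℕ) :
    d k (D.entry₁ ς i) = D.stepOffDiag ς i ≫ D.dualπ ς := by
  refine adj_hom_ext D.adj ?_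
  have h1 := D.π_counit ς
  have h4 := D.wordSlide_counit i m
  have h5 := counit_nat D.adj.counit (ς i)
  have hp : ∀ n x, d k (push D.lam n x) = 0 := by
    intro n x
    induction n with
    | zero => exact d_id k _
    | succ n ih => exact d_comp_closed k (D.lam_closed _) (d_map_closed k D.E₂ ih)
  have e : D.F₁.map (D.entry₁ ς i) ≫ D.adj.counit.app m =
      push D.lam i ((pow D.F₁ i).obj (D.E₁.obj m)) ≫
        (pow D.E₂ i).map (heckeCounit D.τF D.adj.counit i 0 m) ≫ ς i := by
    simp only [entry₁, Functor.map_comp, Category.assoc]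
    dsimp at *
    rw [h5, reassoc_of% h4]
  have e' := congrArg (d k) e
  have hς := ς_closed h i
  dsimp at e' hς
  rw [d_comp, d_comp, d_comp, D.counit_closed, hς, hp, ← IsDiff.map_d (k := k),
    ← IsDiff.map_d (k := k), d_heckeCounit D.repF D.counit_closed (Nat.zero_le _),
    Limits.comp_zero, Limits.comp_zero, Limits.zero_comp, add_zero, add_zero, zero_add] at e'
  rw [e', Functor.map_comp, Category.assoc, h1]
  cases i with
  | zero =>
    rw [stepOffDiag, map_zero' k, Limits.zero_comp]
    simp [map_zero' k]
  | succ n =>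
    have h2 := cross_nat D.lam (ς n)
    have h3 := h.push_comp n
    rw [stepOffDiag_succ, Functor.map_comp, Category.assoc]
    dsimp at *
    rw [reassoc_of% h2, h3, offSlide]
    simp only [map_sum' k, Preadditive.comp_sum, Preadditive.sum_comp]
    rw [Finset.sum_Ico_eq_sum_range]
    refine Finset.sum_congr rfl fun r hr => ?_
    have h6 := D.push_offTerm n r m
    have h7 := h.heckeFront_comp (n + 1) r (by have := Finset.mem_range.1 hr; omega)
    have h8 := heckeFront_nat D.τ₂ (n + 1) r (heckeCounit D.τF D.adj.counit (n + 1) (r + 1) m)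
    have e8 : 1 + r - 1 = r := by omega
    rw [e8, Nat.add_comm 1 r]
    dsimp [push] at *
    simp only [Functor.map_comp, Category.assoc] at *
    rw [reassoc_of% h6, ← reassoc_of% h8, h7]

end DualSetup
end EntriesDifferential

section DualCone

variable {k : Type w} [Field k] {V : Type u} [Category.{v} V] [Preadditive V] [Linear k V]
  [DiffCategory k V]

namespace DualSetup

variable (D : DualSetup k V) {m : V} (ς : ∀ i, (D.EF i).obj m ⟶ m)

/-! ### The action on a cone -/

/-- The morphism `E₂^i F₁^i (m') ⟶ m'` whose entries are those of the step of `Δ_λ`, on the cone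
`m' = E₂(m) ⊕ E₁(m)` of any morphism `E₂(m) ⟶ E₁(m)`. -/
def coneς {p : D.E₂.obj m ⟶ D.E₁.obj m} (c : ConeData k p) (i : ℕ) :
    (D.EF i).obj c.obj ⟶ c.obj :=
  (D.EF i).map c.fst ≫ D.entry₂ ς i ≫ c.inl +
  (D.EF i).map c.snd ≫ D.stepOffDiag ς i ≫ c.inl +
  (D.EF i).map c.snd ≫ D.entry₁ ς i ≫ c.inr

variable {D ς} {p : D.E₂.obj m ⟶ D.E₁.obj m} (c : ConeData k p)

theorem inl_coneς (i : ℕ) :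
    (pow D.E₂ i).map ((pow D.F₁ i).map c.inl) ≫ D.coneς ς c i = D.entry₂ ς i ≫ c.inl := by
  have h1 := fun (z : V) (f : _ ⟶ z) => c.map_inl_fst (D.EF i) f
  have h2 := fun (z : V) (f : _ ⟶ z) => c.map_inl_snd (D.EF i) f
  dsimp at h1 h2
  simp only [coneς, Preadditive.comp_add, Functor.comp_map, h1, h2, add_zero]

theorem inr_coneς (i : ℕ) :
    (pow D.E₂ i).map ((pow D.F₁ i).map c.inr) ≫ D.coneς ς c i =
      D.stepOffDiag ς i ≫ c.inl + D.entry₁ ς i ≫ c.inr := by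
  have h1 := fun (z : V) (f : _ ⟶ z) => c.map_inr_snd (D.EF i) f
  have h2 := fun (z : V) (f : _ ⟶ z) => c.map_inr_fst (D.EF i) f
  dsimp at h1 h2
  simp only [coneς, Preadditive.comp_add, Functor.comp_map, h1, h2, zero_add]

theorem coneς_zero (h : IsDualObj D.toLambdaSetup m ς) : D.coneς ς c 0 = 𝟙 c.obj := by
  have h2 : D.entry₂ ς 0 = 𝟙 _ := by
    simp [entry₂, wordSlide, slide, h.zero]
  have h1 : D.entry₁ ς 0 = 𝟙 _ := by
    simp [entry₁, wordSlide, slide, h.zero]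
  simp [coneς, h1, h2, stepOffDiag, c.total]

/-- The only axiom that needs the twist of the cone to be `π(ς)`: the terms from the twist cancel
the differentials of the entries. -/
theorem coneς_closed [CharP k 2] (h : IsDualObj D.toLambdaSetup m ς)
    (c : ConeData k (D.dualπ ς)) (i : ℕ) (hi : 1 ≤ i) : d k (D.coneς ς c i) = 0 := by
  have e₁ := congrArg (d k) (inl_coneς (ς := ς) c i)
  have e₂ := congrArg (d k) (inr_coneς (ς := ς) c i)
  have d₁ := c.d_map_inl (D.EF i)
  have d₂ := c.d_map_inr (D.EF i)
  have h₂ := inr_coneς (ς := ς) c i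
  have h₃ := entry₂_π h i
  dsimp at e₁ e₂ d₁ d₂ h₂
  simp only [d_comp, map_add, d₁, d₂, c.d_inl, c.d_inr, d_entry₂ h i hi, d_entry₁ h,
    d_stepOffDiag h, Limits.zero_comp, Limits.comp_zero, zero_add, add_zero, Category.assoc]
    at e₁ e₂
  rw [add_self k] at e₂
  rw [h₂, reassoc_of% h₃, Preadditive.comp_add] at e₁
  refine c.map_hom_ext (D.EF i) ?_ ?_
  · rw [Limits.comp_zero]
    exact add_left_cancel (e₁.trans (add_zero _).symm)
  · rw [Limits.comp_zero]
    exact e₂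

theorem coneς_mul (h : IsDualObj D.toLambdaSetup m ς) (i j n : ℕ) (hi : 1 ≤ i) (hj : 1 ≤ j)
    (hn : j + i = n) :
    (pow D.E₂ i).map ((pow D.F₁ i).map (D.coneς ς c j)) ≫ D.coneς ς c i =
      wordMul D.lam i j n hn c.obj ≫ D.coneς ς c n := by
  have a₁ := congrArg (D.EF i).map (inl_coneς (ς := ς) c j)
  have a₂ := congrArg (D.EF i).map (inr_coneς (ς := ς) c j)
  have b₁ := inl_coneς (ς := ς) c i
  have b₂ := inr_coneς (ς := ς) c i
  have c₁ := inl_coneς (ς := ς) c n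
  have c₂ := inr_coneς (ς := ς) c n
  have n₁ := wordMul_nat D.lam i j n hn c.inl
  have n₂ := wordMul_nat D.lam i j n hn c.inr
  have m₁ := wordMul_entry₂ h i j n hn
  have m₂ := wordMul_entry₁ h i j n hn
  have m₃ := wordMul_stepOffDiag h i j n hi hj hn
  refine c.map_hom_ext (D.EF j ⋙ D.EF i) ?_ ?_
  · dsimp at *
    simp only [Functor.map_comp] at *
    rw [reassoc_of% a₁, b₁, reassoc_of% n₁, c₁, reassoc_of% m₁]
  · dsimp at *
    simp only [Functor.map_comp, IsDiff.map_add (k := k)] at *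
    rw [reassoc_of% a₂, reassoc_of% n₂, c₂]
    simp only [Preadditive.add_comp, Preadditive.comp_add, Category.assoc]
    rw [b₁, b₂, ← reassoc_of% m₂, ← reassoc_of% m₃]
    simp only [Preadditive.add_comp, Preadditive.comp_add, Category.assoc, add_assoc]

theorem coneς_equivariant (h : IsDualObj D.toLambdaSetup m ς) (i r : ℕ) (hr : r + 1 < i) :
    hecke D.τ₂ i r ((pow D.F₁ i).obj c.obj) ≫ D.coneς ς c i =
      (pow D.E₂ i).map (hecke D.τF i r c.obj) ≫ D.coneς ς c i := by
  have b₁ := inl_coneς (ς := ς) c i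
  have b₂ := inr_coneς (ς := ς) c i
  have n₁ := hecke_nat D.τ₂ i r ((pow D.F₁ i).map c.inl)
  have n₂ := hecke_nat D.τ₂ i r ((pow D.F₁ i).map c.inr)
  have k₁ := congrArg (pow D.E₂ i).map (hecke_nat D.τF i r c.inl)
  have k₂ := congrArg (pow D.E₂ i).map (hecke_nat D.τF i r c.inr)
  have m₁ := hecke_entry₂ h i r hr
  have m₂ := hecke_entry₁ h i r hr
  have m₃ := hecke_stepOffDiag h i r hr
  refine c.map_hom_ext (D.EF i) ?_ ?_
  · dsimp at *
    simp only [Functor.map_comp] at *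
    rw [reassoc_of% n₁, reassoc_of% k₁, b₁, reassoc_of% m₁]
  · dsimp at *
    simp only [Functor.map_comp] at *
    rw [reassoc_of% n₂, reassoc_of% k₂, b₂]
    simp only [Preadditive.comp_add]
    rw [reassoc_of% m₂, reassoc_of% m₃]

theorem isDualObj_coneς [CharP k 2] (h : IsDualObj D.toLambdaSetup m ς)
    (c : ConeData k (D.dualπ ς)) : IsDualObj D.toLambdaSetup c.obj (D.coneς ς c) where
  zero := coneς_zero c h
  closed i hi := coneς_closed h c i hi
  mul i j hi hj := by
    have e := coneς_mul c h i j (j + i) hi hj rfl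
    dsimp at e ⊢
    rw [D.μ_eq, e]
  equivariant i r hr := coneς_equivariant c h i r hr

/-! ### Morphisms between cones -/

variable {m' : V} {ς' : ∀ i, (D.EF i).obj m' ⟶ m'} {p' : D.E₂.obj m' ⟶ D.E₁.obj m'}
  (c' : ConeData k p')

/-- `h₀` is a separate hypothesis because `IsDualHom` starts at `i = 1`, whereas the off-diagonal
entry for `i = 1` contains `ς 0`. -/
theorem isDualHom_coneς {f : m ⟶ m'} (hf : IsDualHom ς ς' f) (h₀ : ς 0 ≫ f = f ≫ ς' 0)
    {g : c.obj ⟶ c'.obj}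
    (hl : c.inl ≫ g = D.E₂.map f ≫ c'.inl) (hr : c.inr ≫ g = D.E₁.map f ≫ c'.inr) :
    IsDualHom (D.coneς ς c) (D.coneς ς' c') g := by
  have hf' : ∀ i, ς i ≫ f = (pow D.E₂ i).map ((pow D.F₁ i).map f) ≫ ς' i := by
    intro i
    rcases Nat.eq_zero_or_pos i with rfl | hi
    · exact h₀
    · exact hf i hi
  intro i hi
  obtain ⟨n, rfl⟩ : ∃ n, i = n + 1 := ⟨i - 1, by omega⟩
  have b₁ := inl_coneς (ς := ς) c (n + 1)
  have b₂ := inr_coneς (ς := ς) c (n + 1)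
  have b₁' := inl_coneς (ς := ς') c' (n + 1)
  have b₂' := inr_coneς (ς := ς') c' (n + 1)
  have hl' := congrArg (D.EF (n + 1)).map hl
  have hr' := congrArg (D.EF (n + 1)).map hr
  have n₁ := wordSlide_nat D.lam D.τ₂ (n + 1) f
  have n₂ := wordSlide_nat D.ρ D.σ (n + 1) f
  have n₃ := D.offSlide_nat n f
  have f₁ := congrArg D.E₁.map (hf' (n + 1))
  have f₂ := congrArg D.E₂.map (hf' (n + 1))
  have f₃ := congrArg D.E₂.map (hf' n)
  rw [stepOffDiag_succ] at b₂ b₂'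
  simp only [entry₁, entry₂] at *
  refine c.map_hom_ext (D.EF (n + 1)) ?_ ?_
  · dsimp at *
    simp only [Functor.map_comp, Category.assoc] at *
    rw [reassoc_of% b₁, hl, reassoc_of% f₂, reassoc_of% hl', b₁', reassoc_of% n₁]
  · dsimp at *
    simp only [Functor.map_comp, Category.assoc] at *
    rw [reassoc_of% b₂, reassoc_of% hr', b₂']
    simp only [Preadditive.comp_add, Preadditive.add_comp, Category.assoc]
    rw [hl, hr, reassoc_of% f₁, reassoc_of% f₃, reassoc_of% n₃, reassoc_of% n₂]

end DualSetup
end DualCone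

section DualGamma

variable {k : Type w} [Field k] {V : Type u} [Category.{v} V] [Preadditive V] [Linear k V]
  [DiffCategory k V]

namespace DualSetup

variable {D : DualSetup k V} {m : V} {ς : ∀ i, (D.EF i).obj m ⟶ m}

/-! ### The functor to `Δ_σ` -/

theorem dualπ_nat {m' : V} {ς' : ∀ i, (D.EF i).obj m' ⟶ m'} {f : m ⟶ m'}
    (hf : IsDualHom ς ς' f) : D.dualπ ς ≫ D.E₁.map f = D.E₂.map f ≫ D.dualπ ς' := by
  refine adj_hom_ext D.adj ?_
  have h1 := D.π_counit ς
  have h2 := D.π_counit ς'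
  have h3 := counit_nat D.adj.counit f
  have h4 := cross_nat D.lam f
  have h5 := hf 1 le_rfl
  dsimp at *
  simp only [Functor.map_comp, Category.assoc] at *
  rw [h3, reassoc_of% h1, h5, h2, reassoc_of% h4]

/-- By `e`, the transpose of `E₁π ∘ σ ∘ E₂π` is `ς₂` preceded by four crossings `λ`. Composition
with `τ₁` or `τ₂` inserts `τF` or `τ₂` before `ς₂`, and equivariance of `ς₂` equates them. -/
theorem dualπ_comm (h : IsDualObj D.toLambdaSetup m ς) :
    D.E₂.map (D.dualπ ς) ≫ D.σ.app m ≫ D.E₁.map (D.dualπ ς) ≫ D.τ₁.app m =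
      D.τ₂.app m ≫ D.E₂.map (D.dualπ ς) ≫ D.σ.app m ≫ D.E₁.map (D.dualπ ς) := by
  have e : D.F₁.map (D.F₁.map (D.E₂.map (D.dualπ ς) ≫ D.σ.app m ≫ D.E₁.map (D.dualπ ς))) ≫
      D.F₁.map (D.adj.counit.app (D.E₁.obj m)) ≫ D.adj.counit.app m =
      D.F₁.map (D.lam.app (D.E₂.obj m)) ≫ D.lam.app (D.F₁.obj (D.E₂.obj m)) ≫
        D.E₂.map (D.F₁.map (D.lam.app m)) ≫ D.E₂.map (D.lam.app (D.F₁.obj m)) ≫ ς 2 := by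
    have h1 := D.π_counit ς
    have h2 := congrArg D.E₂.map h1
    have h3 := congrArg D.F₁.map (counit_nat D.adj.counit (D.dualπ ς))
    have h4 := congrArg D.F₁.map (D.σ_counit m)
    have h5 := congrArg D.F₁.map (cross_nat D.lam (D.dualπ ς))
    have h6 := congrArg D.F₁.map h2
    have h7 := cross_nat D.lam (D.lam.app m)
    have h8 := cross_nat D.lam (ς 1)
    have h9 := h.push_comp 1
    dsimp [push] at *
    simp only [Functor.map_comp, Category.assoc, Category.comp_id,
      CategoryTheory.Functor.map_id] at *
    rw [reassoc_of% h3, h1, reassoc_of% h4, reassoc_of% h5, reassoc_of% h6, reassoc_of% h8, h9,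
      reassoc_of% h7]
  refine D.hom_ext₂ ?_
  have h1 := D.τ₁_counit m
  have h2 := cross_nat D.τF (D.E₂.map (D.dualπ ς) ≫ D.σ.app m ≫ D.E₁.map (D.dualπ ς))
  have h3 := D.commF' (D.E₂.obj m)
  have h4 := congrArg D.E₂.map (D.commF' m)
  have h5 := h.equivariant 2 0 (by omega)
  have h6 := congrArg D.F₁.map (D.comm₂' m)
  have h7 := D.comm₂' (D.F₁.obj m)
  have h8 := cross_nat D.lam (D.lam.app m)
  dsimp [hecke] at *
  simp only [Functor.map_comp, Category.assoc] at *
  rw [h1, reassoc_of% h2, e, ← reassoc_of% h3, ← reassoc_of% h4, ← h5,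
    ← reassoc_of% h8, ← reassoc_of% h8, reassoc_of% h6, reassoc_of% h7]

/-! ### The morphism `π` of a cone -/

theorem entry₂_one : D.entry₂ ς 1 = D.E₂.map (D.lam.app m) ≫ D.τ₂.app (D.F₁.obj m) ≫
    D.E₂.map (ς 1) := by
  simp [entry₂, wordSlide, slide]

theorem entry₁_one : D.entry₁ ς 1 = D.E₂.map (D.ρ.app m) ≫ D.σ.app (D.F₁.obj m) ≫
    D.E₁.map (ς 1) := by
  simp [entry₁, wordSlide, slide]

theorem stepOffDiag_one (h : ς 0 = 𝟙 m) :
    D.stepOffDiag ς 1 = D.E₂.map (D.adj.counit.app m) := by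
  simp [stepOffDiag, heckeFront, heckeBack, counitPow, h]

variable {p : D.E₂.obj m ⟶ D.E₁.obj m} (c : ConeData k p)

theorem inl_dualπ_coneς :
    D.E₂.map c.inl ≫ D.dualπ (D.coneς ς c) =
      D.τ₂.app m ≫ D.E₂.map (D.dualπ ς) ≫ D.σ.app m ≫ D.E₁.map c.inl := by
  refine adj_hom_ext D.adj ?_
  have h1 := congrArg D.E₂.map (D.π_counit ς)
  have h2 := D.π_counit (D.coneς ς c)
  have h3 := counit_nat D.adj.counit c.inl
  have h4 := cross_nat D.lam c.inl
  have h5 := inl_coneς (ς := ς) c 1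
  have h6 := D.σ_counit m
  have h7 := cross_nat D.lam (D.dualπ ς)
  have h8 := D.comm₂' m
  rw [entry₂_one] at h5
  dsimp at *
  simp only [Functor.map_comp, Category.assoc] at *
  rw [h2, reassoc_of% h4, h5, h3, reassoc_of% h6, reassoc_of% h7, reassoc_of% h1, reassoc_of% h8]

theorem inr_dualπ_coneς (h₀ : ς 0 = 𝟙 m) :
    D.E₂.map c.inr ≫ D.dualπ (D.coneς ς c) =
      D.σ.app m ≫ D.E₁.map c.inl +
        D.σ.app m ≫ D.E₁.map (D.dualπ ς) ≫ D.τ₁.app m ≫ D.E₁.map c.inr := by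
  refine adj_hom_ext D.adj ?_
  have h1 := congrArg D.E₁.map (D.π_counit ς)
  have h2 := D.π_counit (D.coneς ς c)
  have h3 := counit_nat D.adj.counit c.inl
  have h3' := counit_nat D.adj.counit c.inr
  have h4 := cross_nat D.lam c.inr
  have h5 := inr_coneς (ς := ς) c 1
  have h6 := D.σ_counit m
  have h7 := cross_nat D.ρ (D.dualπ ς)
  have h8 := D.lam_σ_ρ m
  have h9 := D.τ₁_counit_eq m
  rw [entry₁_one, stepOffDiag_one h₀] at h5
  dsimp at *
  simp only [Functor.map_comp, Category.assoc, IsDiff.map_add (k := k)] at *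
  rw [h2, reassoc_of% h4, h5, Preadditive.add_comp, Preadditive.comp_add]
  simp only [Category.assoc]
  rw [h3, h3', reassoc_of% h6, reassoc_of% h9, reassoc_of% h7, reassoc_of% h1, reassoc_of% h8]

/-- The bridge between the two categories: `π(ς') = π'`, compared column by column after
transposition. -/
theorem dualπ_coneς (h₀ : ς 0 = 𝟙 m) (c : ConeData k (D.dualπ ς)) :
    D.dualπ (D.coneς ς c) = diagStepπ (S := D.toSigma) c :=
  c.map_hom_ext D.E₂ ((inl_dualπ_coneς c).trans (inl_diagStepπ (S := D.toSigma) c).symm)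
    ((inr_dualπ_coneς c h₀).trans (inr_diagStepπ (S := D.toSigma) c).symm)

end DualSetup
end DualGamma

/-! ### Compatibility of `τ` with the action on a double cone -/

section DualTau

variable {k : Type w} [Field k] {V : Type u} [Category.{v} V] [Preadditive V] [Linear k V]
  [DiffCategory k V]

namespace DualSetup

section

variable (D : DualSetup k V)

theorem wordSlide_τ₂ (n : ℕ) (x : V) :
    (pow D.E₂ n).map ((pow D.F₁ n).map (D.τ₂.app x)) ≫ wordSlide D.lam D.τ₂ n (D.E₂.obj x) ≫
        D.E₂.map (wordSlide D.lam D.τ₂ n x) =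
      wordSlide D.lam D.τ₂ n (D.E₂.obj x) ≫ D.E₂.map (wordSlide D.lam D.τ₂ n x) ≫
        D.τ₂.app ((pow D.E₂ n).obj ((pow D.F₁ n).obj x)) :=
  wordSlide_cross D.comm₂' D.rep₂.braid n x

theorem wordSlide_σ (n : ℕ) (x : V) :
    (pow D.E₂ n).map ((pow D.F₁ n).map (D.σ.app x)) ≫ wordSlide D.ρ D.σ n (D.E₂.obj x) ≫
        D.E₁.map (wordSlide D.lam D.τ₂ n x) =
      wordSlide D.lam D.τ₂ n (D.E₁.obj x) ≫ D.E₂.map (wordSlide D.ρ D.σ n x) ≫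
        D.σ.app ((pow D.E₂ n).obj ((pow D.F₁ n).obj x)) :=
  wordSlide_cross D.lam_σ_ρ D.τ₂_σ n x

theorem wordSlide_τ₁ (n : ℕ) (x : V) :
    (pow D.E₂ n).map ((pow D.F₁ n).map (D.τ₁.app x)) ≫ wordSlide D.ρ D.σ n (D.E₁.obj x) ≫
        D.E₁.map (wordSlide D.ρ D.σ n x) =
      wordSlide D.ρ D.σ n (D.E₁.obj x) ≫ D.E₁.map (wordSlide D.ρ D.σ n x) ≫
        D.τ₁.app ((pow D.E₂ n).obj ((pow D.F₁ n).obj x)) :=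
  wordSlide_cross D.ρ_τ₁ D.σ_τ₁ n x

theorem wordSlide_offSlide₂ (n : ℕ) (x : V) :
    wordSlide D.lam D.τ₂ (n + 1) (D.E₁.obj x) ≫ D.E₂.map (D.offSlide n x) =
      (pow D.E₂ (n + 1)).map ((pow D.F₁ (n + 1)).map (D.σ.app x)) ≫
        D.offSlide n (D.E₂.obj x) ≫ D.E₂.map (wordSlide D.lam D.τ₂ n x) ≫
        D.τ₂.app ((pow D.E₂ n).obj ((pow D.F₁ n).obj x)) := by
  simp only [offSlide, map_sum' k, Preadditive.comp_sum, Preadditive.sum_comp,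
    D.wordSlide_offTerm₂]

theorem wordSlide_offSlide₁ (n : ℕ) (x : V) :
    wordSlide D.ρ D.σ (n + 1) (D.E₁.obj x) ≫ D.E₁.map (D.offSlide n x) =
      (pow D.E₂ (n + 1)).map ((pow D.F₁ (n + 1)).map (D.τ₁.app x)) ≫
        D.offSlide n (D.E₁.obj x) ≫ D.E₂.map (wordSlide D.ρ D.σ n x) ≫
        D.σ.app ((pow D.E₂ n).obj ((pow D.F₁ n).obj x)) := by
  simp only [offSlide, map_sum' k, Preadditive.comp_sum, Preadditive.sum_comp,
    D.wordSlide_offTerm₁]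

/-- The component from `E₁²` to `E₂²`, where two strands are contracted. For `n = 0` there is no
second strand and both sides are zero. -/
theorem offSlide_stepOffDiag {m : V} (ς : ∀ i, (D.EF i).obj m ⟶ m) (n : ℕ) :
    (pow D.E₂ (n + 1)).map ((pow D.F₁ (n + 1)).map (D.τ₁.app m)) ≫
        D.offSlide n (D.E₁.obj m) ≫ D.E₂.map (D.stepOffDiag ς n) =
      D.offSlide n (D.E₁.obj m) ≫ D.E₂.map (D.stepOffDiag ς n) ≫ D.τ₂.app m := by
  cases n with
  | zero =>
    simp only [stepOffDiag, map_zero' k, Limits.zero_comp, Limits.comp_zero]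
  | succ n =>
    have h1 := D.offSlide_offSlide_cross n m
    have h2 := cross_nat D.τ₂ (ς n)
    rw [stepOffDiag_succ]
    dsimp at *
    simp only [Functor.map_comp, Category.assoc] at *
    rw [reassoc_of% h1, h2]

end

variable {D : DualSetup k V} {m : V} {ς : ∀ i, (D.EF i).obj m ⟶ m}

/-- The differential plays no role, so `p` and `p₁` are arbitrary. The column of `E₂E₁` vanishes by
`τ₂² = 0`; that of `E₁²` uses `offSlide_stepOffDiag` and `τ₁² = 0`. The third column of `t` is
prescribed with `σ` in front so that no inverse appears. -/
theorem isDualHom_tau [∀ x, IsIso (D.σ.app x)] {p : D.E₂.obj m ⟶ D.E₁.obj m}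
    (c : ConeData k p) {p₁ : D.E₂.obj c.obj ⟶ D.E₁.obj c.obj} (c₁ : ConeData k p₁)
    {t : c₁.obj ⟶ c₁.obj}
    (t₁ : D.E₂.map c.inl ≫ c₁.inl ≫ t = D.τ₂.app m ≫ D.E₂.map c.inl ≫ c₁.inl)
    (t₂ : D.E₂.map c.inr ≫ c₁.inl ≫ t = 0)
    (t₃ : D.σ.app m ≫ D.E₁.map c.inl ≫ c₁.inr ≫ t = D.E₂.map c.inr ≫ c₁.inl)
    (t₄ : D.E₁.map c.inr ≫ c₁.inr ≫ t = D.τ₁.app m ≫ D.E₁.map c.inr ≫ c₁.inr) :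
    IsDualHom (D.coneς (D.coneς ς c) c₁) (D.coneς (D.coneς ς c) c₁) t := by
  intro i hi
  obtain ⟨n, rfl⟩ : ∃ n, i = n + 1 := ⟨i - 1, by omega⟩
  have P₁ := congrArg (D.EF (n + 1)).map t₁
  have P₂ := congrArg (D.EF (n + 1)).map t₂
  have P₃ := congrArg (D.EF (n + 1)).map t₃
  have P₄ := congrArg (D.EF (n + 1)).map t₄
  have b₁ := inl_coneς (ς := D.coneς ς c) c₁ (n + 1)
  have b₂ := inr_coneς (ς := D.coneς ς c) c₁ (n + 1)
  have a₁ := congrArg D.E₂.map (inl_coneς (ς := ς) c (n + 1))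
  have a₂ := congrArg D.E₂.map (inr_coneς (ς := ς) c (n + 1))
  have a₃ := congrArg D.E₁.map (inl_coneς (ς := ς) c (n + 1))
  have a₄ := congrArg D.E₁.map (inr_coneς (ς := ς) c (n + 1))
  have a₅ := congrArg D.E₂.map (inl_coneς (ς := ς) c n)
  have a₆ := congrArg D.E₂.map (inr_coneς (ς := ς) c n)
  have n₁ := wordSlide_nat D.lam D.τ₂ (n + 1) c.inl
  have n₂ := wordSlide_nat D.lam D.τ₂ (n + 1) c.inr
  have n₃ := wordSlide_nat D.ρ D.σ (n + 1) c.inl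
  have n₄ := wordSlide_nat D.ρ D.σ (n + 1) c.inr
  have n₅ := D.offSlide_nat n c.inl
  have n₆ := D.offSlide_nat n c.inr
  have d₁ := D.wordSlide_τ₂ (n + 1) m
  have d₃ := D.wordSlide_offSlide₂ n m
  have d₄ := D.wordSlide_σ (n + 1) m
  have d₅ := D.offSlide_stepOffDiag ς n
  have d₆ := D.wordSlide_offSlide₁ n m
  have d₈ := D.wordSlide_τ₁ (n + 1) m
  have e₁ := cross_nat D.τ₂ (ς (n + 1))
  have e₂ := cross_nat D.τ₂ (ς n)
  have e₃ := cross_nat D.σ (ς (n + 1))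
  have e₄ := cross_nat D.σ (ς n)
  have e₅ := cross_nat D.τ₁ (ς (n + 1))
  have s₂ := D.rep₂.sq m
  have s₁ := congrArg (D.EF (n + 1)).map (D.rep₁.sq m)
  rw [stepOffDiag_succ] at b₂ a₂ a₄
  simp only [entry₁, entry₂] at b₁ b₂ a₁ a₂ a₃ a₄ a₅ a₆
  dsimp at *
  simp only [Functor.map_comp, Category.assoc, IsDiff.map_add (k := k), map_zero' k] at *
  have l₁ : (pow D.E₂ (n + 1)).map ((pow D.F₁ (n + 1)).map (D.E₂.map c.inl)) ≫
      (pow D.E₂ (n + 1)).map ((pow D.F₁ (n + 1)).map c₁.inl) ≫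
        D.coneς (D.coneς ς c) c₁ (n + 1) =
      wordSlide D.lam D.τ₂ (n + 1) (D.E₂.obj m) ≫ D.E₂.map (wordSlide D.lam D.τ₂ (n + 1) m) ≫
        D.E₂.map (D.E₂.map (ς (n + 1))) ≫ D.E₂.map c.inl ≫ c₁.inl := by
    dsimp
    rw [b₁, reassoc_of% n₁, reassoc_of% a₁]
  have l₂ : (pow D.E₂ (n + 1)).map ((pow D.F₁ (n + 1)).map (D.E₂.map c.inr)) ≫
      (pow D.E₂ (n + 1)).map ((pow D.F₁ (n + 1)).map c₁.inl) ≫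
        D.coneς (D.coneς ς c) c₁ (n + 1) =
      wordSlide D.lam D.τ₂ (n + 1) (D.E₁.obj m) ≫ D.E₂.map (D.offSlide n m) ≫
        D.E₂.map (D.E₂.map (ς n)) ≫ D.E₂.map c.inl ≫ c₁.inl +
      wordSlide D.lam D.τ₂ (n + 1) (D.E₁.obj m) ≫ D.E₂.map (wordSlide D.ρ D.σ (n + 1) m) ≫
        D.E₂.map (D.E₁.map (ς (n + 1))) ≫ D.E₂.map c.inr ≫ c₁.inl := by
    dsimp
    rw [b₁, reassoc_of% n₂, reassoc_of% a₂]
    simp only [Preadditive.add_comp, Preadditive.comp_add, Category.assoc]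
  have l₃ : (pow D.E₂ (n + 1)).map ((pow D.F₁ (n + 1)).map (D.E₁.map c.inl)) ≫
      (pow D.E₂ (n + 1)).map ((pow D.F₁ (n + 1)).map c₁.inr) ≫
        D.coneς (D.coneς ς c) c₁ (n + 1) =
      D.offSlide n (D.E₂.obj m) ≫ D.E₂.map (wordSlide D.lam D.τ₂ n m) ≫
        D.E₂.map (D.E₂.map (ς n)) ≫ D.E₂.map c.inl ≫ c₁.inl +
      wordSlide D.ρ D.σ (n + 1) (D.E₂.obj m) ≫ D.E₁.map (wordSlide D.lam D.τ₂ (n + 1) m) ≫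
        D.E₁.map (D.E₂.map (ς (n + 1))) ≫ D.E₁.map c.inl ≫ c₁.inr := by
    dsimp
    rw [b₂]
    simp only [Preadditive.comp_add]
    rw [reassoc_of% n₃, reassoc_of% n₅, reassoc_of% a₃, reassoc_of% a₅]
  have l₄ : (pow D.E₂ (n + 1)).map ((pow D.F₁ (n + 1)).map (D.E₁.map c.inr)) ≫
      (pow D.E₂ (n + 1)).map ((pow D.F₁ (n + 1)).map c₁.inr) ≫
        D.coneς (D.coneς ς c) c₁ (n + 1) =
      (D.offSlide n (D.E₁.obj m) ≫ D.E₂.map (D.stepOffDiag ς n) ≫ D.E₂.map c.inl ≫ c₁.inl +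
       D.offSlide n (D.E₁.obj m) ≫ D.E₂.map (wordSlide D.ρ D.σ n m) ≫
        D.E₂.map (D.E₁.map (ς n)) ≫ D.E₂.map c.inr ≫ c₁.inl) +
      (wordSlide D.ρ D.σ (n + 1) (D.E₁.obj m) ≫ D.E₁.map (D.offSlide n m) ≫
        D.E₁.map (D.E₂.map (ς n)) ≫ D.E₁.map c.inl ≫ c₁.inr +
       wordSlide D.ρ D.σ (n + 1) (D.E₁.obj m) ≫ D.E₁.map (wordSlide D.ρ D.σ (n + 1) m) ≫
        D.E₁.map (D.E₁.map (ς (n + 1))) ≫ D.E₁.map c.inr ≫ c₁.inr) := by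
    dsimp
    rw [b₂]
    simp only [Preadditive.comp_add]
    rw [reassoc_of% n₄, reassoc_of% n₆, reassoc_of% a₄, reassoc_of% a₆]
    simp only [Preadditive.add_comp, Preadditive.comp_add, Category.assoc]
  dsimp at l₁ l₂ l₃ l₄
  refine c₁.map_hom_ext (D.EF (n + 1)) (c.map_hom_ext (D.E₂ ⋙ D.EF (n + 1)) ?_ ?_)
    (c.map_hom_ext (D.E₁ ⋙ D.EF (n + 1)) ?_ ?_) <;> dsimp
  · rw [reassoc_of% l₁, t₁, reassoc_of% P₁, l₁, reassoc_of% d₁, reassoc_of% e₁]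
  · rw [reassoc_of% l₂, reassoc_of% P₂]
    simp only [Preadditive.add_comp, Category.assoc, t₁, t₂, Limits.comp_zero, add_zero,
      Limits.zero_comp]
    rw [reassoc_of% d₃, ← reassoc_of% e₂, reassoc_of% s₂]
    simp only [Limits.comp_zero, Limits.zero_comp]
  -- Composing with the invertible image of `σ` turns the column of `E₁E₂` into the known column of
  -- `E₂E₁`.
  · have hσ : IsIso ((pow D.E₂ (n + 1)).map ((pow D.F₁ (n + 1)).map (D.σ.app m))) := inferInstance
    dsimp at hσ
    rw [← cancel_epi (D.E₂.map ((pow D.E₂ n).map (D.F₁.map ((pow D.F₁ n).map (D.σ.app m))))),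
      reassoc_of% P₃, l₂, reassoc_of% l₃]
    simp only [Preadditive.add_comp, Preadditive.comp_add, Category.assoc, t₁]
    rw [reassoc_of% d₃, reassoc_of% e₂, reassoc_of% d₄, ← reassoc_of% e₃, t₃]
  · rw [reassoc_of% l₄, reassoc_of% P₄, l₄]
    simp only [Preadditive.add_comp, Preadditive.comp_add, Category.assoc, t₁, t₂, t₄,
      Limits.comp_zero, add_zero]
    rw [reassoc_of% d₅, reassoc_of% d₆, reassoc_of% d₆, ← reassoc_of% e₄, t₃, reassoc_of% d₈,
      reassoc_of% e₅, reassoc_of% s₁]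
    simp only [Limits.zero_comp, zero_add]
    rw [add_assoc]

end DualSetup
end DualTau

section DualCategory

variable {k : Type w} [Field k] {V : Type u} [Category.{v} V] [Preadditive V] [Linear k V]
  [DiffCategory k V]

section Closure

variable {D : LambdaSetup k V}

/-! ### Idempotents and cones in `Δ_λ` -/

theorem μ_nat (i j : ℕ) {x y : V} (f : x ⟶ y) :
    (D.EF i).map ((D.EF j).map f) ≫ D.μ i j y = D.μ i j x ≫ (D.EF (j + i)).map f := by
  rw [D.μ_eq, D.μ_eq]
  exact wordMul_nat D.lam i j (j + i) rfl f

/-- The idempotent `p ≫ i` commutes with the action, so it can be absorbed between two successive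
actions. -/
theorem IsDualObj.retract {m y : V} {ς : ∀ i, (D.EF i).obj m ⟶ m} (h : IsDualObj D m ς)
    {i : y ⟶ m} {p : m ⟶ y} (hi : d k i = 0) (hp : d k p = 0) (hip : i ≫ p = 𝟙 y)
    (he : IsDualHom ς ς (p ≫ i)) :
    IsDualObj D y fun n => (D.EF n).map i ≫ ς n ≫ p where
  zero := by
    rw [h.zero]
    exact (congrArg (i ≫ ·) (Category.id_comp p)).trans hip
  closed n hn := d_comp_closed k (d_map_closed k _ hi) (d_comp_closed k (h.closed n hn) hp)
  mul a b ha hb := by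
    have h1 := h.mul a b ha hb
    have h2 := he a ha
    have h3 := μ_nat (D := D) a b i
    have h4 : p ≫ i ≫ p = p := by rw [hip, Category.comp_id]
    dsimp at *
    simp only [Functor.map_comp, Category.assoc] at *
    rw [← reassoc_of% h2, reassoc_of% h1, h4, reassoc_of% h3]
  equivariant n r hr := by
    have h1 := h.equivariant n r hr
    have h2 := hecke_nat D.τ₂ n r ((pow D.F₁ n).map i)
    have h3 := congrArg (pow D.E₂ n).map (hecke_nat D.τF n r i)
    dsimp at *
    simp only [Functor.map_comp] at *
    rw [← reassoc_of% h3, ← reassoc_of% h2, reassoc_of% h1]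

theorem idempotentComplete_dualObj (hV : IdempotentComplete k V) :
    IdempotentComplete k (DualObj D) := by
  intro X e he hee
  obtain ⟨y, i, p, hi, hp, hip, hpi⟩ := hV X.m e.val (congrArg DualHom.val he)
    (congrArg DualHom.val hee)
  have hE := e.isDualHom
  rw [← hpi] at hE
  refine ⟨⟨y, _, X.isDualObj.retract hi hp hip hE⟩, ⟨i, fun n hn => ?_⟩, ⟨p, fun n hn => ?_⟩,
    DualHom.ext hi, DualHom.ext hp, DualHom.ext hip, DualHom.ext hpi⟩
  · have h := hE n hn
    have h1 : (D.EF n).map i ≫ (D.EF n).map p = 𝟙 _ := by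
      rw [← Functor.map_comp, hip, CategoryTheory.Functor.map_id]
    dsimp at *
    simp only [Functor.map_comp, Category.assoc] at *
    rw [h, reassoc_of% h1]
  · have h := hE n hn
    have h1 : p ≫ i ≫ p = p := by rw [hip, Category.comp_id]
    dsimp at *
    simp only [Functor.map_comp, Category.assoc] at *
    rw [← reassoc_of% h, h1]

/-- The action is diagonal on the cone; it is closed because `f` intertwines the two actions, so the
twist terms agree. -/
theorem isDualObj_cone [CharP k 2] {A B : V} {α : ∀ i, (D.EF i).obj A ⟶ A}
    {β : ∀ i, (D.EF i).obj B ⟶ B} (hA : IsDualObj D A α) (hB : IsDualObj D B β) {f : A ⟶ B}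
    (hf : IsDualHom α β f) (c : ConeData k f) {γ : ∀ i, (D.EF i).obj c.obj ⟶ c.obj}
    (h₁ : ∀ i, (D.EF i).map c.inl ≫ γ i = α i ≫ c.inl)
    (h₂ : ∀ i, (D.EF i).map c.inr ≫ γ i = β i ≫ c.inr) : IsDualObj D c.obj γ where
  zero := by
    have e₁ := h₁ 0
    have e₂ := h₂ 0
    rw [hA.zero] at e₁
    rw [hB.zero] at e₂
    exact c.hom_ext (e₁.trans ((Category.id_comp _).trans (Category.comp_id _).symm))
      (e₂.trans ((Category.id_comp _).trans (Category.comp_id _).symm))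
  closed i hi := by
    have e₁ := congrArg (d k) (h₁ i)
    have e₂ := congrArg (d k) (h₂ i)
    have h₃ := hf i hi
    rw [d_comp, d_comp, c.d_map_inl, hA.closed i hi, c.d_inl, Limits.zero_comp, zero_add,
      Category.assoc, h₂] at e₁
    have h₄ : (D.EF i).map f ≫ β i ≫ c.inr = α i ≫ f ≫ c.inr := by
      rw [← Category.assoc, ← h₃, Category.assoc]
    rw [h₄] at e₁
    rw [d_comp, d_comp, c.d_map_inr, hB.closed i hi, c.d_inr, Limits.zero_comp, zero_add,
      Limits.zero_comp, zero_add, Limits.comp_zero] at e₂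
    refine c.map_hom_ext (D.EF i) ?_ ?_
    · rw [Limits.comp_zero]
      exact add_left_cancel (e₁.trans (add_zero _).symm)
    · rw [Limits.comp_zero]
      exact e₂
  mul i j hi hj := by
    have a₁ := hA.mul i j hi hj
    have a₂ := hB.mul i j hi hj
    have n₁ := μ_nat (D := D) i j c.inl
    have n₂ := μ_nat (D := D) i j c.inr
    have b₁ := congrArg (D.EF i).map (h₁ j)
    have b₂ := congrArg (D.EF i).map (h₂ j)
    have e₁ := h₁ i
    have e₂ := h₂ i
    have k₁ := h₁ (j + i)
    have k₂ := h₂ (j + i)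
    refine c.map_hom_ext (D.EF j ⋙ D.EF i) ?_ ?_
    · dsimp at *
      simp only [Functor.map_comp] at *
      rw [reassoc_of% b₁, e₁, reassoc_of% a₁, reassoc_of% n₁, k₁]
    · dsimp at *
      simp only [Functor.map_comp] at *
      rw [reassoc_of% b₂, e₂, reassoc_of% a₂, reassoc_of% n₂, k₂]
  equivariant i r hr := by
    have a₁ := hA.equivariant i r hr
    have a₂ := hB.equivariant i r hr
    have e₁ := h₁ i
    have e₂ := h₂ i
    have n₁ := hecke_nat D.τ₂ i r ((pow D.F₁ i).map c.inl)
    have n₂ := hecke_nat D.τ₂ i r ((pow D.F₁ i).map c.inr)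
    have k₁ := congrArg (pow D.E₂ i).map (hecke_nat D.τF i r c.inl)
    have k₂ := congrArg (pow D.E₂ i).map (hecke_nat D.τF i r c.inr)
    refine c.map_hom_ext (D.EF i) ?_ ?_
    · dsimp at *
      simp only [Functor.map_comp] at *
      rw [reassoc_of% n₁, reassoc_of% k₁, e₁, reassoc_of% a₁]
    · dsimp at *
      simp only [Functor.map_comp] at *
      rw [reassoc_of% n₂, reassoc_of% k₂, e₂, reassoc_of% a₂]

/-- The cone of a closed morphism of `Δ_λ`. -/
noncomputable def dualCone [CharP k 2] {X Y : DualObj D} (f : X ⟶ Y) (c : ConeData k f.val) : ConeData k f :=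
  have h₁ : ∀ i, (D.EF i).map c.inl ≫ ((D.EF i).map c.fst ≫ X.ς i ≫ c.inl +
      (D.EF i).map c.snd ≫ Y.ς i ≫ c.inr) = X.ς i ≫ c.inl := fun i => by
    rw [Preadditive.comp_add, c.map_inl_fst (D.EF i), c.map_inl_snd (D.EF i), add_zero]
  have h₂ : ∀ i, (D.EF i).map c.inr ≫ ((D.EF i).map c.fst ≫ X.ς i ≫ c.inl +
      (D.EF i).map c.snd ≫ Y.ς i ≫ c.inr) = Y.ς i ≫ c.inr := fun i => by
    rw [Preadditive.comp_add, c.map_inr_fst (D.EF i), c.map_inr_snd (D.EF i), zero_add]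
  { obj := ⟨c.obj, fun i => (D.EF i).map c.fst ≫ X.ς i ≫ c.inl +
        (D.EF i).map c.snd ≫ Y.ς i ≫ c.inr,
      isDualObj_cone X.isDualObj Y.isDualObj f.isDualHom c h₁ h₂⟩
    inl := ⟨c.inl, fun i _ => (h₁ i).symm⟩
    inr := ⟨c.inr, fun i _ => (h₂ i).symm⟩
    fst := ⟨c.fst, fun i _ => by
      simp only [Preadditive.add_comp, Category.assoc, c.inl_fst, c.inr_fst, Category.comp_id,
        Limits.comp_zero, add_zero]⟩
    snd := ⟨c.snd, fun i _ => by
      simp only [Preadditive.add_comp, Category.assoc, c.inl_snd, c.inr_snd, Category.comp_id,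
        Limits.comp_zero, zero_add]⟩
    inl_fst := DualHom.ext c.inl_fst
    inr_snd := DualHom.ext c.inr_snd
    inl_snd := DualHom.ext c.inl_snd
    inr_fst := DualHom.ext c.inr_fst
    total := DualHom.ext c.total
    d_inl := DualHom.ext c.d_inl
    d_inr := DualHom.ext c.d_inr
    d_fst := DualHom.ext c.d_fst
    d_snd := DualHom.ext c.d_snd }

theorem stronglyPretriangulated_dualObj [CharP k 2] [HasCones k V] :
    StronglyPretriangulated k (DualObj D) :=
  letI : HasCones k (DualObj D) :=
    ⟨fun f hf => dualCone f (HasCones.cone f.val (congrArg DualHom.val hf))⟩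
  stronglyPretriangulated_of_hasCones k

end Closure

variable (D : DualSetup k V)

theorem gammaWellDefined : GammaWellDefined D where
  obj X := ⟨D.π_closed X.isDualObj, DualSetup.dualπ_comm X.isDualObj⟩
  map f := DualSetup.dualπ_nat f.isDualHom

/-! ### The `2`-representation on `Δ_λ` -/

/-- `π₁` is only assumed equal to `π'`, because on `Δ_λ` this equality is the theorem `π_coneOf` and
does not hold by definition. -/
theorem d_tauMatrix [CharP k 2] {S : SigmaData k V} [∀ x, IsIso (S.σ.app x)] (hS : S.Compatible) {m : V}
    {π : S.E₂.obj m ⟶ S.E₁.obj m} (c : ConeData k π) {π₁ : S.E₂.obj c.obj ⟶ S.E₁.obj c.obj}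
    (hπ : π₁ = diagStepπ c) (c₁ : ConeData k π₁) : d k (tauMatrix c c₁) = 𝟙 _ := by
  subst hπ
  exact d_tauMatrix_diagStepπ c hS c₁

variable [HasCones k V]

theorem dualStepWellDefined [CharP k 2] : DualStepWellDefined D where
  obj X := DualSetup.isDualObj_coneς X.isDualObj (D.coneOf X)
  map {X Y} f := DualSetup.isDualHom_coneς (D.coneOf X) (D.coneOf Y) f.isDualHom
    (by
      rw [X.isDualObj.zero, Y.isDualObj.zero]
      exact (Category.id_comp f.val).trans (Category.comp_id f.val).symm)
    (inl_diagMap (S := D.toSigma) (D.coneOf X) (D.coneOf Y) f.val)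
    (inr_diagMap (S := D.toSigma) (D.coneOf X) (D.coneOf Y) f.val)

variable {D}

theorem π_coneOf (h : DualStepWellDefined D) (X : DualObj D.toLambdaSetup) :
    D.π ((dualStep h).obj X).ς = diagStepπ (S := D.toSigma) (D.coneOf X) :=
  DualSetup.dualπ_coneς X.isDualObj.zero (D.coneOf X)

variable [∀ x, IsIso (D.toSigma.σ.app x)]

/-- The endomorphism `τ` of the square of the endofunctor of `Δ_λ`. -/
noncomputable def dualTau (h : DualStepWellDefined D) :
    dualStep h ⋙ dualStep h ⟶ dualStep h ⋙ dualStep h where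
  app X := ⟨tauMatrix (S := D.toSigma) (D.coneOf X) (D.coneOf ((dualStep h).obj X)),
    haveI : ∀ x, IsIso (D.σ.app x) := inferInstanceAs (∀ x, IsIso (D.toSigma.σ.app x))
    DualSetup.isDualHom_tau (D.coneOf X) (D.coneOf ((dualStep h).obj X))
      (inl_inl_tauMatrix (S := D.toSigma) _ _) (inr_inl_tauMatrix (S := D.toSigma) _ _)
      ((congrArg (D.toSigma.σ.app X.m ≫ ·) (inl_inr_tauMatrix (S := D.toSigma) _ _)).trans
        (IsIso.hom_inv_id_assoc _ _))
      (inr_inr_tauMatrix (S := D.toSigma) _ _)⟩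
  naturality _ _ f := DualHom.ext (tauMatrix_nat (S := D.toSigma) _ _ _ _ f.val)

theorem isTwoRep_dualTau [CharP k 2] (h : DualStepWellDefined D) :
    IsTwoRep k (dualStep h) (dualTau h) where
  isDiff :=
    { map_add := fun f g => DualHom.ext (diagMap_add (S := D.toSigma) _ _ f.val g.val)
      map_smul := fun a f => DualHom.ext (diagMap_smul (S := D.toSigma) _ _ a f.val)
      map_d := fun f => DualHom.ext (d_diagMap (S := D.toSigma) _ _
        ((gammaWellDefined D).map f)) }
  d_tau X := DualHom.ext (d_tauMatrix D.compatible _ (π_coneOf h X) _)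
  sq _ := DualHom.ext (tauMatrix_sq (S := D.toSigma) _ _ D.compatible)
  braid _ := DualHom.ext (tauMatrix_braid (S := D.toSigma) _ _ D.compatible _)

/-- The comparison of the endofunctors of `Δ_λ` and `Δ_σ`, given by identities. -/
noncomputable def gammaIso (h : DualStepWellDefined D) (hS : DiagStepWellDefined D.toSigma)
    (hΓ : GammaWellDefined D) : dualStep h ⋙ gamma hΓ ≅ gamma hΓ ⋙ diagStep hS :=
  NatIso.ofComponents
    (fun X =>
      -- Both objects have the cone of `π(ς)` as underlying object; their maps to `E₁` agree by
      -- `π_coneOf`.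
      { hom := ⟨𝟙 _, by
          show D.π ((dualStep h).obj X).ς ≫ D.E₁.map (𝟙 _) = D.E₂.map (𝟙 _) ≫ _
          rw [CategoryTheory.Functor.map_id, CategoryTheory.Functor.map_id]
          exact (Category.comp_id _).trans ((π_coneOf h X).trans (Category.id_comp _).symm)⟩
        inv := ⟨𝟙 _, by
          show _ ≫ D.E₁.map (𝟙 _) = D.E₂.map (𝟙 _) ≫ D.π ((dualStep h).obj X).ς
          rw [CategoryTheory.Functor.map_id, CategoryTheory.Functor.map_id]
          exact (Category.comp_id _).trans ((π_coneOf h X).symm.trans (Category.id_comp _).symm)⟩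
        hom_inv_id := DiagHom.ext (Category.comp_id _)
        inv_hom_id := DiagHom.ext (Category.comp_id _) })
    (fun f => DiagHom.ext ((Category.comp_id _).trans (Category.id_comp _).symm))

theorem isTwoRepMorphism_gamma [CharP k 2] (h : DualStepWellDefined D) (hS : DiagStepWellDefined D.toSigma)
    (hΓ : GammaWellDefined D) :
    IsTwoRepMorphism k (dualTau h) (diagTau D.compatible hS) (gamma hΓ) (gammaIso h hS hΓ) where
  isDiff := ⟨fun _ _ => rfl, fun _ _ => rfl, fun _ => rfl⟩
  closed X := DiagHom.ext (d_id k _)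
  comm X := by
    -- The second cones on the two sides are taken of `π(ς')` and of `π'`, which are equal but not
    -- by definition. Naturality of `τ` at the identity of `m` compares them.
    have e := tauMatrix_nat (S := D.toSigma) (D.coneOf X) (D.coneOf X)
      (D.coneOf ((dualStep h).obj X))
      (coneOf ((diagStep hS).obj ((gamma hΓ).obj X)).m ((diagStep hS).obj ((gamma hΓ).obj X)).π
        ((diagStep hS).obj ((gamma hΓ).obj X)).isDiagObj.closed) (𝟙 X.m)
    rw [diagMap_id] at e
    refine DiagHom.ext ((Category.id_comp _).trans (e.trans ?_))
    exact congrArg _ (Category.id_comp _).symm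

end DualCategory

end DiffRep

/-! ### The theorem -/

theorem mainTheorem4 {k : Type*} [Field k] [CharP k 2] {W : Type*} [Category* W]
    [Preadditive W] [Linear k W] [DiffCategory k W] (D : DualSetup k W) [IsIso D.σ] :
    D.toSigma.Compatible ∧
    ∃ (hE : DualStepWellDefined D.extend)
      (τ : dualStep hE ⋙ dualStep hE ⟶ dualStep hE ⋙ dualStep hE),
      (∀ X, (τ.app X).val = tauMatrix (S := D.extend.toSigma) (D.extend.coneOf X)
        (D.extend.coneOf ((dualStep hE).obj X))) ∧
      IsTwoRep k (dualStep hE) τ ∧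
      IdempotentComplete k (DualObj D.extend.toLambdaSetup) ∧
      StronglyPretriangulated k (DualObj D.extend.toLambdaSetup) ∧
      ∃ (hS : DiagStepWellDefined D.extend.toSigma)
        (τ' : diagStep hS ⋙ diagStep hS ⟶ diagStep hS ⋙ diagStep hS)
        (hΓ : GammaWellDefined D.extend)
        (φ : dualStep hE ⋙ gamma hΓ ≅ gamma hΓ ⋙ diagStep hS),
        (∀ Y, (τ'.app Y).val = tauMatrix (S := D.extend.toSigma)
          (coneOf Y.m Y.π Y.isDiagObj.closed)
          (coneOf ((diagStep hS).obj Y).m ((diagStep hS).obj Y).π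
            ((diagStep hS).obj Y).isDiagObj.closed)) ∧
        IsTwoRep k (diagStep hS) τ' ∧
        (∀ X, (φ.hom.app X).val = 𝟙 (D.extend.coneOf X).obj) ∧
        IsTwoRepMorphism k τ τ' (gamma hΓ) φ := by
  -- Part (0) concerns `D` on `W` itself. The rest applies the preceding results to the extension of
  -- `D` to the completion, which has cones and split idempotents and on which `σ` stays invertible.
  have hE := dualStepWellDefined D.extend
  have hS := diagStepWellDefined D.extend.compatible
  have hΓ := gammaWellDefined D.extend
  exact ⟨D.compatible, hE, dualTau hE, fun _ => rfl, isTwoRep_dualTau hE,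
    idempotentComplete_dualObj Perf.idempotentComplete,
    stronglyPretriangulated_dualObj, hS, diagTau D.extend.compatible hS, hΓ,
    gammaIso hE hS hΓ, fun _ => rfl, isTwoRep_diagTau D.extend.compatible hS,
    fun _ => rfl, isTwoRepMorphism_gamma hE hS hΓ⟩
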